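/- Let $n\ge 2$, let $\Omega\subset\mathbb R^n$ be a smooth, bounded and strictly convex domain (i.e. $\Omega$ is convex and $\partial\Omega$ contains no line segment), and let $u\in C^\infty(\overline\Omega)$ be the strictly convex solution of $$\det D^2u=1\ \text{ in }\Omega,\qquad u=0\ \text{ on }\partial\Omega .$$ For a matrix $W=(w_{kl})$ let $\sigma_m(W)$ be the sum of its principal $m\times m$ minors (for symmetric $W$, the $m$-th elementary symmetric function of the eigenvalues). Let $$K=\sum_{k,l=1}^n\frac{\partial\sigma_n(D^2u)}{\partial u_{kl}}u_ku_l\,|Du|^{-n-1},\qquad H=\sum_{k,l=1}^n\frac{\partial\sigma_2(D^2u)}{\partial u_{kl}}u_ku_l\,|Du|^{-3}$$ be the Gauss curvature and the mean curvature (the sum of the principal curvatures) of the level sets of $u$, and let $\kappa_m$ and $\kappa_M$ be the minimal and the maximal principal curvature of the level set of $u$ through a point (with the sign that makes the boundary of a ball positively curved). At the critical point of $u$ the functions $K|Du|^{n+1}$ and $H|Du|^3$ are understood to be $0$. Then: (1) Each of the functions $K|Du|^{n+1}$ and $H|Du|^{3}$ attains its maximum over $\overline\Omega$, and attains it only at points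 of $\partial\Omega$. (2) Let $c\in(\min_{\Omega}u,0)$ and $\Omega'=\{x\in\Omega : u(x)<c\}$. Then the maxima and minima below exist, $\min_{\partial\Omega}\kappa_m^{n+1}>0$, and for every $x\in\Omega\setminus\Omega'$ $$K(x)<\frac{\max_{\partial\Omega}K\;\max_{\partial\Omega'}\kappa_M^{n+1}}{\min_{\partial\Omega}\kappa_m^{n+1}},\qquad H(x)<\frac{\max_{\partial\Omega}H\;\max_{\partial\Omega'}\kappa_M^{n+1}}{\min_{\partial\Omega}\kappa_m^{n+1}} .$$ -/

import Mathlib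

open Set Topology
open scoped ContDiff

noncomputable section

namespace MongeAmpere

variable {n : ℕ}

/-- `σ_k` of a square matrix: the sum of its `k × k` principal minors. It is a polynomial in the
`n²` entries, and for a symmetric matrix it is the `k`-th elementary symmetric function of the
eigenvalues (`sigma_eq_esymm_eigenvalues`). -/
def sigma (k : ℕ) (W : Matrix (Fin n) (Fin n) ℝ) : ℝ :=
  ∑ s ∈ (Finset.univ : Finset (Fin n)).powersetCard k,
    (W.submatrix (fun i : s => (i : Fin n)) (fun i : s => (i : Fin n))).det

theorem sigma_eq_esymm_eigenvalues {W : Matrix (Fin n) (Fin n) ℝ} (hW : W.IsHermitian)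
    (k : ℕ) : sigma k W = (Finset.univ.val.map hW.eigenvalues).esymm k := by
  by_cases hk : k ≤ n
  · have h1 := Matrix.charpoly_coeff_eq_sum_minors W k (by simpa using hk)
    have h2 : W.charpoly =
        ((Finset.univ.val.map hW.eigenvalues).map
          fun t => Polynomial.X - Polynomial.C t).prod := by
      rw [hW.charpoly_eq, Multiset.map_map]
      rfl
    have h3 := Multiset.prod_X_sub_C_coeff (Finset.univ.val.map hW.eigenvalues)
      (k := n - k) (by simp)
    rw [← h2] at h3
    simp only [Fintype.card_fin, Multiset.card_map, Finset.card_val, Finset.card_univ,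
      Nat.sub_sub_self hk] at h1 h3
    rw [h1] at h3
    exact mul_left_cancel₀ (pow_ne_zero k (by norm_num)) h3
  · have hk' : n < k := not_le.mp hk
    rw [sigma, Finset.powersetCard_eq_empty.mpr (by simpa using hk'), Multiset.esymm,
      Multiset.powersetCard_eq_empty k (by simpa using hk')]
    simp

/-- The partial derivative `∂σ_m / ∂w_{kl}` at `W`, where the `n²` entries are independent
variables. -/
def sigmaDeriv (m : ℕ) (W : Matrix (Fin n) (Fin n) ℝ) (k l : Fin n) : ℝ :=
  deriv (fun t : ℝ => sigma m (W + t • Matrix.single k l (1 : ℝ))) 0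

/-! In what follows `S` is the set on which the function `u` lives (the closure of a convex domain),
and derivatives are taken within `S`: at interior points of `S` they are the usual ones, and at
boundary points they are the one-sided ones, that is, the continuous extensions of the interior
derivatives if `u` is smooth up to the boundary. -/

/-- The gradient `Du`. -/
def Du (S : Set (EuclideanSpace ℝ (Fin n))) (u : EuclideanSpace ℝ (Fin n) → ℝ)
    (x : EuclideanSpace ℝ (Fin n)) : EuclideanSpace ℝ (Fin n) :=
  gradientWithin u S x

/-- The second derivative of `u` at `x`, as the linear map `v ↦ D_v (Du)`. -/
def hessOp (S : Set (EuclideanSpace ℝ (Fin n))) (u : EuclideanSpace ℝ (Fin n) → ℝ)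
    (x : EuclideanSpace ℝ (Fin n)) :
    EuclideanSpace ℝ (Fin n) →L[ℝ] EuclideanSpace ℝ (Fin n) :=
  fderivWithin ℝ (Du S u) S x

/-- The Hessian matrix `D²u = (u_{ij})`. -/
def hessian (S : Set (EuclideanSpace ℝ (Fin n))) (u : EuclideanSpace ℝ (Fin n) → ℝ)
    (x : EuclideanSpace ℝ (Fin n)) : Matrix (Fin n) (Fin n) ℝ :=
  Matrix.of fun i j => hessOp S u x (EuclideanSpace.single j 1) i

/-- `∑_{k,l} (∂σ_m(D²u) / ∂u_{kl}) u_k u_l`. -/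
def sigmaForm (S : Set (EuclideanSpace ℝ (Fin n))) (u : EuclideanSpace ℝ (Fin n) → ℝ) (m : ℕ)
    (x : EuclideanSpace ℝ (Fin n)) : ℝ :=
  ∑ k, ∑ l, sigmaDeriv m (hessian S u x) k l * Du S u x k * Du S u x l

/-- The Gauss curvature `K` at `x` of the level set of `u` through `x`. -/
def gaussCurvature (S : Set (EuclideanSpace ℝ (Fin n))) (u : EuclideanSpace ℝ (Fin n) → ℝ)
    (x : EuclideanSpace ℝ (Fin n)) : ℝ :=
  sigmaForm S u n x / ‖Du S u x‖ ^ (n + 1)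

/-- The mean curvature `H` (the sum of the principal curvatures) at `x` of the level set of `u`
through `x`. -/
def meanCurvature (S : Set (EuclideanSpace ℝ (Fin n))) (u : EuclideanSpace ℝ (Fin n) → ℝ)
    (x : EuclideanSpace ℝ (Fin n)) : ℝ :=
  sigmaForm S u 2 x / ‖Du S u x‖ ^ 3

/-- The tangent space at `x` of the level set of `u` through `x`. -/
abbrev levelTangent (S : Set (EuclideanSpace ℝ (Fin n))) (u : EuclideanSpace ℝ (Fin n) → ℝ)
    (x : EuclideanSpace ℝ (Fin n)) : Submodule ℝ (EuclideanSpace ℝ (Fin n)) :=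
  (ℝ ∙ Du S u x)ᗮ

/-- The shape operator at `x` of the level set of `u` through `x`: the derivative of the unit normal
field `Du / |Du|` along the level set, `v ↦ |Du|⁻¹ (D²u v)^⊤`. The sign is the one that makes
convex sublevel sets have nonnegative curvatures. -/
def shapeOperator (S : Set (EuclideanSpace ℝ (Fin n))) (u : EuclideanSpace ℝ (Fin n) → ℝ)
    (x : EuclideanSpace ℝ (Fin n)) : Module.End ℝ (levelTangent S u x) :=
  ‖Du S u x‖⁻¹ •
    ((levelTangent S u x).orthogonalProjectionOnto.toLinearMap ∘ₗ
      (hessOp S u x).toLinearMap ∘ₗ (levelTangent S u x).subtype)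

/-- The set of the principal curvatures at `x` of the level set of `u` through `x`. It is finite,
and nonempty if `n ≥ 2`. -/
def principalCurvatures (S : Set (EuclideanSpace ℝ (Fin n)))
    (u : EuclideanSpace ℝ (Fin n) → ℝ) (x : EuclideanSpace ℝ (Fin n)) : Set ℝ :=
  {κ | (shapeOperator S u x).HasEigenvalue κ}

/-- The minimal principal curvature `κ_m`. -/
def kappaMin (S : Set (EuclideanSpace ℝ (Fin n))) (u : EuclideanSpace ℝ (Fin n) → ℝ)
    (x : EuclideanSpace ℝ (Fin n)) : ℝ :=
  sInf (principalCurvatures S u x)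

/-- The maximal principal curvature `κ_M`. -/
def kappaMax (S : Set (EuclideanSpace ℝ (Fin n))) (u : EuclideanSpace ℝ (Fin n) → ℝ)
    (x : EuclideanSpace ℝ (Fin n)) : ℝ :=
  sSup (principalCurvatures S u x)

/-- The boundary of `Ω` is smooth: near each of its points `Ω` is the set `{ρ < 0}` of a smooth
function `ρ` whose derivative does not vanish there. -/
def HasSmoothBoundary (Ω : Set (EuclideanSpace ℝ (Fin n))) : Prop :=
  ∀ p ∈ frontier Ω, ∃ U : Set (EuclideanSpace ℝ (Fin n)), IsOpen U ∧ p ∈ U ∧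
    ∃ ρ : EuclideanSpace ℝ (Fin n) → ℝ, ContDiffOn ℝ ∞ ρ U ∧ fderiv ℝ ρ p ≠ 0 ∧
      Ω ∩ U = {x ∈ U | ρ x < 0}

/-- A smooth, bounded and strictly convex domain in `ℝⁿ`. Strict convexity is a condition on the
closure (for an open set, `StrictConvex` says no more than `Convex`). -/
structure IsSmoothStrictlyConvexDomain (Ω : Set (EuclideanSpace ℝ (Fin n))) : Prop where
  isOpen : IsOpen Ω
  nonempty : Ω.Nonempty
  isBounded : Bornology.IsBounded Ω
  convex : Convex ℝ Ω
  strictConvex_closure : StrictConvex ℝ (closure Ω)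
  smoothBoundary : HasSmoothBoundary Ω

/-- `u` is the smooth and strictly convex solution of `det D²u = 1` in `Ω`, `u = 0` on `∂Ω`.
Smooth means smooth up to the boundary. -/
structure IsSolution (Ω : Set (EuclideanSpace ℝ (Fin n)))
    (u : EuclideanSpace ℝ (Fin n) → ℝ) : Prop where
  smooth : ContDiffOn ℝ ∞ u (closure Ω)
  strictConvex : StrictConvexOn ℝ Ω u
  det_hessian : ∀ x ∈ Ω, (hessian (closure Ω) u x).det = 1
  eq_zero : ∀ x ∈ frontier Ω, u x = 0

/-- On the closure of `Ω`, the function `f` attains its maximum, and it does so only at points of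
the boundary of `Ω`. -/
def AttainsMaxOnlyOnBoundary (Ω : Set (EuclideanSpace ℝ (Fin n)))
    (f : EuclideanSpace ℝ (Fin n) → ℝ) : Prop :=
  (∃ x ∈ closure Ω, IsMaxOn f (closure Ω) x) ∧
    ∀ x ∈ closure Ω, IsMaxOn f (closure Ω) x → x ∈ frontier Ω

end MongeAmpere

end

/-! Let L = Σ u^{ij}∂_i∂_j with (u^{ij}) the inverse Hessian. Since det D²u = 1, the adjugate of D²u
is its inverse, so K|Du|^{n+1} = Σ u^{kl}u_k u_l, while H|Du|³ = Δu|Du|² − D²u(Du, Du).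
Differentiating the equation once and twice gives L u_k = 0 and L u_{km} = Σ
u^{ia}u^{jb}u_{ijk}u_{abm}. In an eigenframe of D²u with eigenvalues λ_i, L of the first function is
2n plus a nonnegative quadratic sum, and L of the second is a Lagrange-identity sum plus 2((Σλ_i)² −
Σλ_i²), which is positive for n ≥ 2. So neither has an interior local maximum
(`not_isLocalMax_inverse_form`, `not_isLocalMax_sigma_two`), and continuity on the compact closure
gives (1).

For (2), let R = max |Du| over ∂Ω. By (1), the numerator of K at x is less than max_{∂Ω} K ·
R^{n+1}, so K(x) < max_{∂Ω} K · (R/|Du(x)|)^{n+1}; the same holds for H with exponent 3. As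
R/|Du(x)| > 1 and 3 ≤ n + 1, it suffices to bound R/|Du(x)| by the ratio of curvatures.

Upper bound, R · min κ_m ≤ 1 (`exists_norm_Du_mul_kappaMin_le`): by AM–GM, L(|Du|² − 2su) > 0 for s
< 1, so this function peaks on ∂Ω, where u = 0, hence where |Du| does. The first order condition
there, as s → 1, makes Du an eigenvector of D²u with eigenvalue at least 1. If |Du|κ_m > 1 at that
point, then D²u ≥ I, and det D²u = 1 forces D²u = I, whose tangential part contradicts |Du|κ_m > 1.

Lower bound, |Du(x)| · max κ_M ≥ 1 where u(x) ≥ c (`one_le_mul_norm_Du`): Blaschke's rolling theorem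
places a ball of any radius r < 1/max κ_M inside {u ≤ c}, tangent at a given boundary point.
Comparison with a paraboloid in the ball gives |Du| ≥ r at that point. Convexity carries the bound
out to x, from the point of {u = c} with normal Du(x). -/

noncomputable section

namespace MongeAmpere

variable {n : ℕ}

/-! ### Derivatives of the determinant and of σ₂ in the matrix entries -/

/-- Jacobi's formula along a curve of matrices. -/
theorem hasDerivAt_det {A : ℝ → Matrix (Fin n) (Fin n) ℝ} {A' : Matrix (Fin n) (Fin n) ℝ} {t : ℝ}
    (h : ∀ i j, HasDerivAt (fun s => A s i j) (A' i j) t) :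
    HasDerivAt (fun s => (A s).det) (∑ i, ∑ j, (A t).adjugate j i * A' i j) t := by
  have h1 : HasDerivAt (fun s => (A s).det)
      (∑ σ : Equiv.Perm (Fin n), ((Equiv.Perm.sign σ : ℤ) : ℝ) *
        ∑ i, (∏ j ∈ Finset.univ.erase i, A t (σ j) j) * A' (σ i) i) t := by
    simp only [Matrix.det_apply']
    refine HasDerivAt.fun_sum fun σ _ => ?_
    refine HasDerivAt.const_mul _ ?_
    have := HasDerivAt.fun_finsetProd (u := Finset.univ) (f := fun i s => A s (σ i) i)
      (f' := fun i => A' (σ i) i) (x := t) (fun i _ => h (σ i) i)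
    simpa [smul_eq_mul] using this
  convert h1 using 1
  simp only [Finset.mul_sum]
  rw [Finset.sum_comm, Finset.sum_comm (s := Finset.univ (α := Equiv.Perm (Fin n)))]
  refine Finset.sum_congr rfl fun j _ => ?_
  have h2 : ∑ i, (A t).adjugate j i * A' i j = ((A t).updateCol j fun i => A' i j).det := by
    rw [← Matrix.cramer_apply, Matrix.cramer_eq_adjugate_mulVec]
    rfl
  rw [h2, Matrix.det_apply']
  refine Finset.sum_congr rfl fun σ _ => ?_
  rw [← Finset.mul_prod_erase _ _ (Finset.mem_univ j)]
  simp only [Matrix.updateCol_self]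
  rw [mul_comm (A' _ _)]
  congr 2
  refine Finset.prod_congr rfl fun i hi => ?_
  rw [Matrix.updateCol_ne (Finset.ne_of_mem_erase hi)]

theorem hasDerivAt_add_smul_apply (W E : Matrix (Fin n) (Fin n) ℝ) (i j : Fin n) (t : ℝ) :
    HasDerivAt (fun s : ℝ => (W + s • E) i j) (E i j) t := by
  have h : HasDerivAt (fun s : ℝ => W i j + s * E i j) (E i j) t := by
    simpa using ((hasDerivAt_id t).mul_const (E i j)).const_add (W i j)
  exact h

theorem sigma_self (W : Matrix (Fin n) (Fin n) ℝ) : sigma n W = W.det := by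
  have h : (Finset.univ : Finset (Fin n)).powersetCard n = {Finset.univ} := by
    simpa using Finset.powersetCard_self (Finset.univ : Finset (Fin n))
  rw [sigma, h, Finset.sum_singleton]
  exact Matrix.det_submatrix_equiv_self
    (Equiv.subtypeUnivEquiv (p := fun i => i ∈ Finset.univ) (fun i : Fin n => Finset.mem_univ i)) W

theorem sigmaDeriv_self (W : Matrix (Fin n) (Fin n) ℝ) (k l : Fin n) :
    sigmaDeriv n W k l = W.adjugate l k := by
  unfold sigmaDeriv
  simp only [sigma_self]
  have h := hasDerivAt_det (A := fun t : ℝ => W + t • Matrix.single k l (1 : ℝ))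
    (A' := Matrix.single k l 1) (t := 0) (fun i j =>
      hasDerivAt_add_smul_apply W _ i j 0)
  rw [h.deriv]
  simp [Matrix.single_apply, ite_and]

theorem det_submatrix_pair (W : Matrix (Fin n) (Fin n) ℝ) {a b : Fin n} (hab : a ≠ b) :
    (W.submatrix (fun i : ({a, b} : Finset (Fin n)) => (i : Fin n))
      (fun i : ({a, b} : Finset (Fin n)) => (i : Fin n))).det = W a a * W b b - W a b * W b a := by
  let f : Fin 2 → ({a, b} : Finset (Fin n)) := ![⟨a, by simp⟩, ⟨b, by simp⟩]
  have hf : Function.Bijective f := by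
    constructor
    · intro i j hij
      fin_cases i <;> fin_cases j <;> simp_all [f]
    · rintro ⟨x, hx⟩
      rcases (by simpa using hx : x = a ∨ x = b) with rfl | rfl
      · exact ⟨0, rfl⟩
      · exact ⟨1, rfl⟩
  rw [← Matrix.det_submatrix_equiv_self (Equiv.ofBijective f hf), Matrix.det_fin_two]
  rfl

/-- Each two-element index set comes from two ordered pairs, and the diagonal terms vanish. The
resulting double sum can be differentiated entry by entry. -/
theorem two_mul_sigma_two (W : Matrix (Fin n) (Fin n) ℝ) :
    2 * sigma 2 W = ∑ i, ∑ j, (W i i * W j j - W i j * W j i) := by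
  rw [← Finset.sum_product', ← Finset.sum_subset (Finset.filter_subset
    (fun p : Fin n × Fin n => p.1 ≠ p.2) (Finset.univ ×ˢ Finset.univ))]
  · rw [← Finset.sum_fiberwise_of_maps_to (g := fun p : Fin n × Fin n => ({p.1, p.2} : Finset (Fin n)))
      (t := (Finset.univ : Finset (Fin n)).powersetCard 2)]
    · rw [sigma, Finset.mul_sum]
      refine Finset.sum_congr rfl fun s hs => ?_
      obtain ⟨a, b, hab, rfl⟩ := Finset.card_eq_two.mp (Finset.mem_powersetCard.mp hs).2
      have : (((Finset.univ ×ˢ Finset.univ).filter fun p : Fin n × Fin n => p.1 ≠ p.2).filter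
          fun p => ({p.1, p.2} : Finset (Fin n)) = {a, b}) = {(a, b), (b, a)} := by
        ext ⟨x, y⟩
        simp only [Finset.mem_filter, Finset.mem_product, Finset.mem_univ, true_and,
          Finset.mem_insert, Finset.mem_singleton, Prod.mk.injEq]
        constructor
        · rintro ⟨hxy, h⟩
          have hx : x ∈ ({a, b} : Finset (Fin n)) := h ▸ by simp
          have hy : y ∈ ({a, b} : Finset (Fin n)) := h ▸ by simp
          simp only [Finset.mem_insert, Finset.mem_singleton] at hx hy
          grind
        · rintro (⟨rfl, rfl⟩ | ⟨rfl, rfl⟩)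
          · exact ⟨hab, rfl⟩
          · exact ⟨hab.symm, Finset.pair_comm _ _⟩
      rw [this, Finset.sum_pair (by simpa using fun h => absurd h hab), det_submatrix_pair W hab]
      ring
    · rintro ⟨x, y⟩ h
      exact Finset.mem_powersetCard.mpr ⟨Finset.subset_univ _,
        Finset.card_pair (Finset.mem_filter.mp h).2⟩
  · rintro ⟨x, y⟩ _ h
    have : x = y := by simpa using h
    subst this
    ring

theorem sigmaDeriv_two (W : Matrix (Fin n) (Fin n) ℝ) (k l : Fin n) :
    sigmaDeriv 2 W k l = (if k = l then W.trace else 0) - W l k := by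
  unfold sigmaDeriv
  have h2 : ∀ V : Matrix (Fin n) (Fin n) ℝ,
      sigma 2 V = (∑ i, ∑ j, (V i i * V j j - V i j * V j i)) / 2 := fun V => by
    rw [← two_mul_sigma_two]; ring
  simp only [h2]
  have he : ∀ i j, HasDerivAt (fun t : ℝ => (W + t • Matrix.single k l (1 : ℝ)) i j)
      (Matrix.single k l (1 : ℝ) i j) 0 := fun i j =>
    hasDerivAt_add_smul_apply W _ i j 0
  have h : HasDerivAt (fun t : ℝ => (∑ i, ∑ j,
      ((W + t • Matrix.single k l (1 : ℝ)) i i * (W + t • Matrix.single k l (1 : ℝ)) j j -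
        (W + t • Matrix.single k l (1 : ℝ)) i j * (W + t • Matrix.single k l (1 : ℝ)) j i)) / 2)
      _ 0 := (HasDerivAt.fun_sum fun i _ => HasDerivAt.fun_sum fun j _ =>
        ((he i i).mul (he j j)).sub ((he i j).mul (he j i))).div_const 2
  rw [h.deriv]
  simp only [zero_smul, add_zero, Matrix.single_apply, Finset.sum_sub_distrib,
    Finset.sum_add_distrib, ite_and]
  by_cases hkl : k = l
  · subst hkl
    simp [Matrix.trace]
    ring
  · have : ∀ i, ¬ (k = i ∧ l = i) := fun i h => hkl (h.1.trans h.2.symm)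
    simp [hkl, ← ite_and, this]
    simp [ite_and]

/-! ### Calculus along lines and the second order condition at a maximum -/

section LineDeriv

variable {E : Type*} [NormedAddCommGroup E] [NormedSpace ℝ E]

theorem hasLineDerivAt_mul {f g : E → ℝ} {a b : ℝ} {x v : E} (hf : HasLineDerivAt ℝ f a x v)
    (hg : HasLineDerivAt ℝ g b x v) :
    HasLineDerivAt ℝ (fun y => f y * g y) (a * g x + f x * b) x v := by
  have h := HasDerivAt.mul hf hg
  simp only [zero_smul, add_zero] at h
  exact h

theorem hasLineDerivAt_sub {f g : E → ℝ} {a b : ℝ} {x v : E} (hf : HasLineDerivAt ℝ f a x v)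
    (hg : HasLineDerivAt ℝ g b x v) :
    HasLineDerivAt ℝ (fun y => f y - g y) (a - b) x v :=
  HasDerivAt.sub hf hg

theorem hasLineDerivAt_const_mul {f : E → ℝ} {a : ℝ} {x v : E} (c : ℝ)
    (hf : HasLineDerivAt ℝ f a x v) :
    HasLineDerivAt ℝ (fun y => c * f y) (c * a) x v :=
  HasDerivAt.const_mul c hf

theorem hasLineDerivAt_add {f g : E → ℝ} {a b : ℝ} {x v : E} (hf : HasLineDerivAt ℝ f a x v)
    (hg : HasLineDerivAt ℝ g b x v) :
    HasLineDerivAt ℝ (fun y => f y + g y) (a + b) x v :=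
  HasDerivAt.add hf hg

theorem hasLineDerivAt_zero_of_eventuallyEq_const {f : E → ℝ} {c : ℝ} {x v : E}
    (h : f =ᶠ[𝓝 x] fun _ => c) : HasLineDerivAt ℝ f 0 x v :=
  HasLineDerivAt.congr_of_eventuallyEq (show HasLineDerivAt ℝ (fun _ => c) 0 x v from
    hasDerivAt_const _ _) h

theorem hasLineDerivAt_sum {ι : Type*} {s : Finset ι} {f : ι → E → ℝ} {a : ι → ℝ} {x v : E}
    (hf : ∀ i ∈ s, HasLineDerivAt ℝ (f i) (a i) x v) :
    HasLineDerivAt ℝ (fun y => ∑ i ∈ s, f i y) (∑ i ∈ s, a i) x v :=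
  HasDerivAt.fun_sum hf

/-- The necessary second order condition at a local maximum, along a line. -/
theorem second_lineDeriv_nonpos_of_isLocalMax {f f₁ : E → ℝ} {f₂ : ℝ} {x v : E}
    (hmax : IsLocalMax f x) (h₁ : ∀ᶠ y in 𝓝 x, HasLineDerivAt ℝ f (f₁ y) y v)
    (h₂ : HasLineDerivAt ℝ f₁ f₂ x v) : f₂ ≤ 0 := by
  by_contra! hpos
  set g : ℝ → ℝ := fun t => f (x + t • v) with hg
  have hline : Filter.Tendsto (fun t : ℝ => x + t • v) (𝓝 0) (𝓝 x) := by
    have : ContinuousAt (fun t : ℝ => x + t • v) 0 := by fun_prop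
    simpa [ContinuousAt] using this
  have hd : ∀ᶠ t in 𝓝 (0 : ℝ), HasDerivAt g (f₁ (x + t • v)) t := by
    filter_upwards [hline.eventually h₁] with t ht
    have h := HasDerivAt.scomp t (h := fun s : ℝ => s - t) (g₁ := fun s => f (x + t • v + s • v))
      (h' := 1) (by simpa [HasLineDerivAt] using ht) (by simpa using (hasDerivAt_id t).sub_const t)
    have he : (fun s => f (x + t • v + s • v)) ∘ (fun s : ℝ => s - t) = g := by
      funext s
      simp only [Function.comp_apply, hg]
      congr 1
      module
    rw [he] at h
    simpa using h
  have hd' : deriv g =ᶠ[𝓝 0] fun t => f₁ (x + t • v) := hd.mono fun t ht => ht.deriv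
  have hdd : deriv (deriv g) 0 = f₂ := by
    rw [hd'.deriv_eq]
    exact HasDerivAt.deriv h₂
  have hgmax : IsLocalMax g 0 := by
    have : ∀ᶠ t in 𝓝 (0 : ℝ), f (x + t • v) ≤ f x := hline.eventually hmax
    simpa [IsLocalMax, IsMaxFilter, hg] using this
  -- A positive second derivative would make 0 a local minimum as well as a local maximum. Then g is
  -- constant near 0 and its second derivative is 0.
  have hgmin : IsLocalMin g 0 :=
    isLocalMin_of_deriv_deriv_pos (by rw [hdd]; exact hpos) hgmax.deriv_eq_zero
      hd.self_of_nhds.continuousAt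
  have hconst : g =ᶠ[𝓝 0] fun _ => g 0 := by
    filter_upwards [hgmax, hgmin] with t h1 h2 using le_antisymm h1 h2
  have : deriv (deriv g) 0 = 0 := by
    rw [hconst.deriv.deriv_eq]
    simp
  linarith

/-- The derivative of `f` in the direction `v`, as a function. -/
def dirDeriv (v : E) (f : E → ℝ) (x : E) : ℝ := fderiv ℝ f x v

variable {Ω : Set E} {f g : E → ℝ}

theorem contDiffOn_dirDeriv (hΩ : IsOpen Ω) (hf : ContDiffOn ℝ ∞ f Ω) (v : E) :
    ContDiffOn ℝ ∞ (dirDeriv v f) Ω :=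
  (hf.fderiv_of_isOpen hΩ (by simp)).clm_apply contDiffOn_const

theorem hasLineDerivAt_dirDeriv (hΩ : IsOpen Ω) (hf : ContDiffOn ℝ ∞ f Ω) {x : E} (hx : x ∈ Ω)
    (v : E) : HasLineDerivAt ℝ f (dirDeriv v f x) x v :=
  ((hf.contDiffAt (hΩ.mem_nhds hx)).differentiableAt (by simp)).hasFDerivAt.hasLineDerivAt v

theorem dirDeriv_congr (hΩ : IsOpen Ω) (h : EqOn f g Ω) (v : E) :
    EqOn (dirDeriv v f) (dirDeriv v g) Ω := fun x hx => by
  unfold dirDeriv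
  rw [(h.eventuallyEq_of_mem (hΩ.mem_nhds hx)).fderiv_eq]

theorem dirDeriv_dirDeriv (hΩ : IsOpen Ω) (hf : ContDiffOn ℝ ∞ f Ω) {x : E} (hx : x ∈ Ω)
    (v w : E) : dirDeriv v (dirDeriv w f) x = fderiv ℝ (fderiv ℝ f) x v w := by
  have h : DifferentiableAt ℝ (fderiv ℝ f) x :=
    ((hf.fderiv_of_isOpen hΩ (m := ∞) (by simp)).contDiffAt (hΩ.mem_nhds hx)).differentiableAt
      (by simp)
  have := h.hasFDerivAt.clm_apply (hasFDerivAt_const w x)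
  unfold dirDeriv
  rw [this.fderiv]
  simp

theorem dirDeriv_comm (hΩ : IsOpen Ω) (hf : ContDiffOn ℝ ∞ f Ω) {x : E} (hx : x ∈ Ω) (v w : E) :
    dirDeriv v (dirDeriv w f) x = dirDeriv w (dirDeriv v f) x := by
  rw [dirDeriv_dirDeriv hΩ hf hx, dirDeriv_dirDeriv hΩ hf hx]
  exact ((hf.contDiffAt (hΩ.mem_nhds hx)).isSymmSndFDerivAt
    (by simpa using WithTop.coe_le_coe.mpr (le_top : (2 : ℕ∞) ≤ ⊤))) v w

end LineDeriv

/-- AM–GM in the form log t ≤ t − 1, summed over the factors. -/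
theorem card_le_sum_of_prod_eq_one {l : Fin n → ℝ} (hl : ∀ i, 0 < l i) (h : ∏ i, l i = 1) :
    (n : ℝ) ≤ ∑ i, l i := by
  have h1 : ∑ i, Real.log (l i) = 0 := by
    rw [← Real.log_prod (fun i _ => (hl i).ne'), h, Real.log_one]
  have h2 : ∑ i, Real.log (l i) ≤ ∑ i, (l i - 1) :=
    Finset.sum_le_sum fun i _ => Real.log_le_sub_one_of_pos (hl i)
  simp at h2
  linarith

/-! ### The linearized operator and the three maximum principles -/

section Frame

variable {E : Type*} [NormedAddCommGroup E] [NormedSpace ℝ E]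

/-- First derivatives with respect to a frame. -/
def frameD1 (b : Fin n → E) (u : E → ℝ) (i : Fin n) : E → ℝ := dirDeriv (b i) u

/-- Second derivatives with respect to a frame. -/
def frameD2 (b : Fin n → E) (u : E → ℝ) (i j : Fin n) : E → ℝ := dirDeriv (b j) (frameD1 b u i)

/-- Third derivatives with respect to a frame. -/
def frameD3 (b : Fin n → E) (u : E → ℝ) (i j k : Fin n) : E → ℝ :=
  dirDeriv (b k) (frameD2 b u i j)

/-- Fourth derivatives with respect to a frame. -/
def frameD4 (b : Fin n → E) (u : E → ℝ) (i j k l : Fin n) : E → ℝ :=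
  dirDeriv (b l) (frameD3 b u i j k)

/-- The Hessian matrix with respect to a frame. -/
def frameHess (b : Fin n → E) (u : E → ℝ) (x : E) : Matrix (Fin n) (Fin n) ℝ :=
  Matrix.of fun i j => frameD2 b u i j x

variable {b : Fin n → E} {u : E → ℝ} {Ω : Set E} (hΩ : IsOpen Ω) (hu : ContDiffOn ℝ ∞ u Ω)
include hΩ hu

theorem contDiffOn_frameD1 (i : Fin n) : ContDiffOn ℝ ∞ (frameD1 b u i) Ω :=
  contDiffOn_dirDeriv hΩ hu _

theorem contDiffOn_frameD2 (i j : Fin n) : ContDiffOn ℝ ∞ (frameD2 b u i j) Ω :=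
  contDiffOn_dirDeriv hΩ (contDiffOn_frameD1 hΩ hu i) _

theorem contDiffOn_frameD3 (i j k : Fin n) : ContDiffOn ℝ ∞ (frameD3 b u i j k) Ω :=
  contDiffOn_dirDeriv hΩ (contDiffOn_frameD2 hΩ hu i j) _

theorem frameD2_symm (i j : Fin n) : EqOn (frameD2 b u i j) (frameD2 b u j i) Ω :=
  fun _ hx => dirDeriv_comm hΩ hu hx _ _

theorem frameD3_symm_left (i j k : Fin n) : EqOn (frameD3 b u i j k) (frameD3 b u j i k) Ω :=
  dirDeriv_congr hΩ (frameD2_symm hΩ hu i j) _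

theorem frameD3_symm_right (i j k : Fin n) : EqOn (frameD3 b u i j k) (frameD3 b u i k j) Ω :=
  fun _ hx => dirDeriv_comm hΩ (contDiffOn_frameD1 hΩ hu i) hx _ _

theorem frameD4_symm_left (i j k l : Fin n) : EqOn (frameD4 b u i j k l) (frameD4 b u j i k l) Ω :=
  dirDeriv_congr hΩ (frameD3_symm_left hΩ hu i j k) _

theorem frameD4_symm_mid (i j k l : Fin n) : EqOn (frameD4 b u i j k l) (frameD4 b u i k j l) Ω :=
  dirDeriv_congr hΩ (frameD3_symm_right hΩ hu i j k) _

theorem frameD4_symm_right (i j k l : Fin n) : EqOn (frameD4 b u i j k l) (frameD4 b u i j l k) Ω :=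
  fun _ hx => dirDeriv_comm hΩ (contDiffOn_frameD2 hΩ hu i j) hx _ _

/-- The twice differentiated equation contracts the first pair of indices, whereas applying L to an
expression in the Hessian contracts the last pair. -/
theorem frameD4_swap (i j k l : Fin n) : EqOn (frameD4 b u i j k l) (frameD4 b u k l i j) Ω := by
  intro x hx
  rw [frameD4_symm_mid hΩ hu i j k l hx, frameD4_symm_left hΩ hu i k j l hx,
    frameD4_symm_right hΩ hu k i j l hx, frameD4_symm_mid hΩ hu k i l j hx]

theorem hasLineDerivAt_self (i : Fin n) {x : E} (hx : x ∈ Ω) :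
    HasLineDerivAt ℝ u (frameD1 b u i x) x (b i) := hasLineDerivAt_dirDeriv hΩ hu hx _

theorem hasLineDerivAt_frameD1 (i j : Fin n) {x : E} (hx : x ∈ Ω) :
    HasLineDerivAt ℝ (frameD1 b u i) (frameD2 b u i j x) x (b j) :=
  hasLineDerivAt_dirDeriv hΩ (contDiffOn_frameD1 hΩ hu i) hx _

theorem hasLineDerivAt_frameD2 (i j k : Fin n) {x : E} (hx : x ∈ Ω) :
    HasLineDerivAt ℝ (frameD2 b u i j) (frameD3 b u i j k x) x (b k) :=
  hasLineDerivAt_dirDeriv hΩ (contDiffOn_frameD2 hΩ hu i j) hx _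

theorem hasLineDerivAt_frameD3 (i j k l : Fin n) {x : E} (hx : x ∈ Ω) :
    HasLineDerivAt ℝ (frameD3 b u i j k) (frameD4 b u i j k l x) x (b l) :=
  hasLineDerivAt_dirDeriv hΩ (contDiffOn_frameD3 hΩ hu i j k) hx _

/-- The entries of the inverse Hessian are smooth. -/
theorem contDiffOn_adjugate (i j : Fin n) :
    ContDiffOn ℝ ∞ (fun x => (frameHess b u x).adjugate i j) Ω := by
  simp only [Matrix.adjugate_apply, Matrix.det_apply']
  refine ContDiffOn.sum fun σ _ => contDiffOn_const.mul (contDiffOn_prod fun k _ => ?_)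
  by_cases h : σ k = j
  · simp only [h, Matrix.updateRow_self]
    exact contDiffOn_const
  · simp only [Matrix.updateRow_ne h]
    exact contDiffOn_frameD2 hΩ hu _ _

variable (hdet : ∀ x ∈ Ω, (frameHess b u x).det = 1)
include hdet

/-- Jacobi's formula applied to the constant function det D²u. It holds at every point, not only
where the Hessian is diagonal, so it can be differentiated again. -/
theorem sum_adjugate_mul_frameD3 {x : E} (hx : x ∈ Ω) (k : Fin n) :
    ∑ i, ∑ j, (frameHess b u x).adjugate j i * frameD3 b u i j k x = 0 := by
  have h1 := hasDerivAt_det (A := fun t => frameHess b u (x + t • b k))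
    (A' := Matrix.of fun i j => frameD3 b u i j k x) (t := 0)
    (fun i j => hasLineDerivAt_frameD2 hΩ hu i j k hx)
  have h2 : HasLineDerivAt ℝ (fun y => (frameHess b u y).det) 0 x (b k) := by
    have h3 : (fun y => (frameHess b u y).det) =ᶠ[𝓝 x] fun _ => 1 := by
      filter_upwards [hΩ.mem_nhds hx] with y hy using hdet y hy
    exact hasLineDerivAt_zero_of_eventuallyEq_const h3
  have := h1.unique h2
  simpa using this

variable {x : E} (hx : x ∈ Ω) {l : Fin n → ℝ} (hl : ∀ i, 0 < l i)
  (hdiag : ∀ i j, frameD2 b u i j x = if i = j then l i else 0)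
include hx hl hdiag

omit hΩ hu hl in
theorem prod_eq_one : ∏ i, l i = 1 := by
  have h := hdet x hx
  have h2 : frameHess b u x = Matrix.diagonal l := by
    ext i j
    simp [frameHess, hdiag, Matrix.diagonal_apply]
  rwa [h2, Matrix.det_diagonal] at h

omit hΩ hu in
theorem adjugate_frameHess (i j : Fin n) :
    (frameHess b u x).adjugate i j = if i = j then (l i)⁻¹ else 0 := by
  have h := congrFun (congrFun (Matrix.adjugate_mul (frameHess b u x)) i) j
  rw [hdet x hx, Matrix.mul_apply] at h
  have hd : ∀ p q, frameHess b u x p q = if p = q then l p else 0 := hdiag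
  simp only [hd, mul_ite, mul_zero, Finset.sum_ite_eq', Finset.mem_univ, if_true, one_smul,
    Matrix.one_apply] at h
  rw [← mul_left_inj' (hl j).ne', h]
  by_cases hij : i = j
  · subst hij
    simp [(hl i).ne']
  · simp [hij]

theorem sum_frameD3_div (k : Fin n) : ∑ i, (l i)⁻¹ * frameD3 b u i i k x = 0 := by
  have h := sum_adjugate_mul_frameD3 hΩ hu hdet hx k
  simpa [adjugate_frameHess hdet hx hl hdiag] using h

/-- The derivative along `b m` of the identity u^{ij}u_{ijk} = 0: differentiating the inverse
Hessian produces the quadratic third order terms on the right. -/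
theorem sum_frameD4_div (k m : Fin n) : ∑ i, (l i)⁻¹ * frameD4 b u i i k m x =
    ∑ i, ∑ j, (l i)⁻¹ * (l j)⁻¹ * (frameD3 b u i j k x * frameD3 b u i j m x) := by
  set N : Fin n → Fin n → E → ℝ := fun i j y => (frameHess b u y).adjugate i j with hN
  have hNd : ∀ i j, HasLineDerivAt ℝ (N i j) (dirDeriv (b m) (N i j) x) x (b m) := fun i j =>
    hasLineDerivAt_dirDeriv hΩ (contDiffOn_adjugate hΩ hu i j) hx _
  have hNx : ∀ i j, N i j x = if i = j then (l i)⁻¹ else 0 :=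
    adjugate_frameHess hdet hx hl hdiag
  -- From N · D²u = 1 follows ∂N = −N (∂D²u) N, and N is diagonal at x.
  have hN' : ∀ i j, dirDeriv (b m) (N i j) x = - ((l i)⁻¹ * (l j)⁻¹ * frameD3 b u i j m x) := by
    intro i j
    have h1 := hasLineDerivAt_sum (s := Finset.univ) fun p _ =>
      hasLineDerivAt_mul (hNd i p) (hasLineDerivAt_frameD2 hΩ hu p j m hx)
    have h2 : HasLineDerivAt ℝ (fun y => ∑ p, N i p y * frameD2 b u p j y) 0 x (b m) := by
      have h3 : (fun y => ∑ p, N i p y * frameD2 b u p j y) =ᶠ[𝓝 x]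
          fun _ => (1 : Matrix (Fin n) (Fin n) ℝ) i j := by
        filter_upwards [hΩ.mem_nhds hx] with y hy
        have h := congrFun (congrFun (Matrix.adjugate_mul (frameHess b u y)) i) j
        rw [hdet y hy, Matrix.mul_apply, one_smul] at h
        exact h
      exact hasLineDerivAt_zero_of_eventuallyEq_const h3
    have h := HasLineDerivAt.unique h1 h2
    simp only [hdiag, hNx, Finset.sum_add_distrib, mul_ite, ite_mul, mul_zero, zero_mul,
      Finset.sum_ite_eq, Finset.sum_ite_eq', Finset.mem_univ, if_true] at h
    have := (hl j).ne'
    field_simp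
    field_simp at h
    linarith
  have h1 := hasLineDerivAt_sum (s := Finset.univ) fun i _ =>
    hasLineDerivAt_sum (s := Finset.univ) fun j _ =>
      hasLineDerivAt_mul (hNd j i) (hasLineDerivAt_frameD3 hΩ hu i j k m hx)
  have h2 : HasLineDerivAt ℝ (fun y => ∑ i, ∑ j, N j i y * frameD3 b u i j k y) 0 x (b m) := by
    have h3 : (fun y => ∑ i, ∑ j, N j i y * frameD3 b u i j k y) =ᶠ[𝓝 x] fun _ => 0 := by
      filter_upwards [hΩ.mem_nhds hx] with y hy using sum_adjugate_mul_frameD3 hΩ hu hdet hy k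
    exact hasLineDerivAt_zero_of_eventuallyEq_const h3
  have h := HasLineDerivAt.unique h1 h2
  simp only [hNx, hN', Finset.sum_add_distrib, ite_mul, zero_mul,
      Finset.sum_ite_eq', Finset.mem_univ, if_true] at h
  rw [eq_comm, ← sub_eq_zero, ← neg_eq_zero, ← h, neg_sub, sub_eq_add_neg, add_comm]
  congr 1
  rw [← Finset.sum_neg_distrib]
  refine Finset.sum_congr rfl fun i _ => ?_
  rw [← Finset.sum_neg_distrib]
  refine Finset.sum_congr rfl fun j _ => ?_
  rw [frameD3_symm_left hΩ hu j i m hx]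
  ring

omit hu hdet hdiag in
/-- `Σ λᵢ⁻¹ ∂ᵢᵢ f ≤ 0` at a local maximum. -/
theorem sum_second_deriv_nonpos_of_isLocalMax {f : E → ℝ} {f₁ : Fin n → E → ℝ} {f₂ : Fin n → ℝ}
    (hmax : IsLocalMax f x) (h₁ : ∀ i, ∀ y ∈ Ω, HasLineDerivAt ℝ f (f₁ i y) y (b i))
    (h₂ : ∀ i, HasLineDerivAt ℝ (f₁ i) (f₂ i) x (b i)) : ∑ i, (l i)⁻¹ * f₂ i ≤ 0 :=
  Finset.sum_nonpos fun i _ => mul_nonpos_of_nonneg_of_nonpos (inv_nonneg.mpr (hl i).le)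
    (second_lineDeriv_nonpos_of_isLocalMax hmax
      (Filter.eventually_of_mem (hΩ.mem_nhds hx) (h₁ i)) (h₂ i))

/-- `|Du|² - 2 s u` has no interior maximum if `s < 1`. -/
theorem not_isLocalMax_normSq (hn : 0 < n) {s : ℝ} (hs : s < 1) :
    ¬ IsLocalMax (fun y => ∑ k, frameD1 b u k y * frameD1 b u k y - 2 * s * u y) x := by
  intro hmax
  have h := sum_second_deriv_nonpos_of_isLocalMax hΩ hx hl hmax
    (fun i y hy => hasLineDerivAt_sub (hasLineDerivAt_sum fun k _ =>
      hasLineDerivAt_mul (hasLineDerivAt_frameD1 hΩ hu k i hy) (hasLineDerivAt_frameD1 hΩ hu k i hy))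
        (hasLineDerivAt_const_mul (2 * s) (hasLineDerivAt_self hΩ hu i hy)))
    (fun i => hasLineDerivAt_sub (hasLineDerivAt_sum fun k _ => hasLineDerivAt_add
      (hasLineDerivAt_mul (hasLineDerivAt_frameD2 hΩ hu k i i hx) (hasLineDerivAt_frameD1 hΩ hu k i hx))
      (hasLineDerivAt_mul (hasLineDerivAt_frameD1 hΩ hu k i hx) (hasLineDerivAt_frameD2 hΩ hu k i i hx)))
      (hasLineDerivAt_const_mul (2 * s) (hasLineDerivAt_frameD1 hΩ hu i i hx)))
  have h1 : ∀ k, ∑ i, (l i)⁻¹ * frameD3 b u k i i x = 0 := fun k => by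
    rw [← sum_frameD3_div hΩ hu hdet hx hl hdiag k]
    refine Finset.sum_congr rfl fun i _ => ?_
    rw [frameD3_symm_left hΩ hu k i i hx, frameD3_symm_right hΩ hu i k i hx]
  -- The third order terms sum to zero by `h1`, leaving L(|Du|² − 2su) = 2Σ l_i − 2ns.
  have h2 : ∀ i, (l i)⁻¹ * (∑ k, (frameD3 b u k i i x * frameD1 b u k x
      + frameD2 b u k i x * frameD2 b u k i x
      + (frameD2 b u k i x * frameD2 b u k i x + frameD1 b u k x * frameD3 b u k i i x))
      - 2 * s * frameD2 b u i i x) =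
      2 * (∑ k, frameD1 b u k x * ((l i)⁻¹ * frameD3 b u k i i x)) + 2 * l i - 2 * s := by
    intro i
    have h3 : ∑ k, frameD2 b u k i x * frameD2 b u k i x = l i * l i := by
      simp [hdiag]
    have h4 : ∑ k, (frameD3 b u k i i x * frameD1 b u k x
      + frameD2 b u k i x * frameD2 b u k i x
      + (frameD2 b u k i x * frameD2 b u k i x + frameD1 b u k x * frameD3 b u k i i x)) =
      2 * (∑ k, frameD1 b u k x * frameD3 b u k i i x) + 2 * (l i * l i) := by
      rw [← h3, Finset.mul_sum, Finset.mul_sum, ← Finset.sum_add_distrib]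
      exact Finset.sum_congr rfl fun k _ => by ring
    have h5 : ∑ k, frameD1 b u k x * ((l i)⁻¹ * frameD3 b u k i i x) =
        (l i)⁻¹ * ∑ k, frameD1 b u k x * frameD3 b u k i i x := by
      rw [Finset.mul_sum]
      exact Finset.sum_congr rfl fun k _ => by ring
    rw [h4, h5, hdiag, if_pos rfl]
    have := (hl i).ne'
    field_simp
  simp only [h2] at h
  rw [Finset.sum_sub_distrib, Finset.sum_add_distrib, ← Finset.mul_sum, ← Finset.mul_sum,
    Finset.sum_comm] at h
  simp only [← Finset.mul_sum, h1] at h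
  -- AM–GM bounds L from below by 2n(1 − s), which is positive because s < 1.
  have h6 := card_le_sum_of_prod_eq_one hl (prod_eq_one hdet hx hdiag)
  simp at h
  have h7 : (0 : ℝ) < n := by exact_mod_cast hn
  nlinarith

/-- `Δu |Du|² - D²u(Du, Du)` has no interior maximum. -/
theorem not_isLocalMax_sigma_two (hn : 2 ≤ n) :
    ¬ IsLocalMax (fun y => ∑ k, ∑ m, (frameD2 b u k k y * (frameD1 b u m y * frameD1 b u m y) -
      frameD2 b u k m y * (frameD1 b u k y * frameD1 b u m y))) x := by
  intro hmax
  have d1 := fun (k i : Fin n) (y : E) (hy : y ∈ Ω) => hasLineDerivAt_frameD1 (b := b) hΩ hu k i hy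
  have d2 := fun (k m i : Fin n) (y : E) (hy : y ∈ Ω) =>
    hasLineDerivAt_frameD2 (b := b) hΩ hu k m i hy
  have h := sum_second_deriv_nonpos_of_isLocalMax hΩ hx hl hmax
    (fun i y hy => hasLineDerivAt_sum fun k _ => hasLineDerivAt_sum fun m _ =>
      hasLineDerivAt_sub
        (hasLineDerivAt_mul (d2 k k i y hy) (hasLineDerivAt_mul (d1 m i y hy) (d1 m i y hy)))
        (hasLineDerivAt_mul (d2 k m i y hy) (hasLineDerivAt_mul (d1 k i y hy) (d1 m i y hy))))
    (fun i => by
      have e1 := fun k => d1 k i x hx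
      have e2 := fun k m => d2 k m i x hx
      have e3 := fun k m => hasLineDerivAt_frameD3 (b := b) hΩ hu k m i i hx
      exact hasLineDerivAt_sum fun k _ => hasLineDerivAt_sum fun m _ => hasLineDerivAt_sub
        (hasLineDerivAt_add
          (hasLineDerivAt_mul (e3 k k) (hasLineDerivAt_mul (e1 m) (e1 m)))
          (hasLineDerivAt_mul (e2 k k) (hasLineDerivAt_add (hasLineDerivAt_mul (e2 m i) (e1 m))
            (hasLineDerivAt_mul (e1 m) (e2 m i)))))
        (hasLineDerivAt_add
          (hasLineDerivAt_mul (e3 k m) (hasLineDerivAt_mul (e1 k) (e1 m)))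
          (hasLineDerivAt_mul (e2 k m) (hasLineDerivAt_add (hasLineDerivAt_mul (e2 k i) (e1 m))
            (hasLineDerivAt_mul (e1 k) (e2 m i))))))
  have t1 : ∀ k, ∑ i, (l i)⁻¹ * frameD3 b u k i i x = 0 := fun k => by
    rw [← sum_frameD3_div hΩ hu hdet hx hl hdiag k]
    refine Finset.sum_congr rfl fun i _ => ?_
    rw [frameD3_symm_left hΩ hu k i i hx, frameD3_symm_right hΩ hu i k i hx]
  have t2 : ∀ k m, ∑ i, (l i)⁻¹ * frameD4 b u k m i i x =
      ∑ i, ∑ j, (l i)⁻¹ * (l j)⁻¹ * (frameD3 b u i j k x * frameD3 b u i j m x) := fun k m => by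
    rw [← sum_frameD4_div hΩ hu hdet hx hl hdiag k m]
    exact Finset.sum_congr rfl fun i _ => by rw [frameD4_swap hΩ hu k m i i hx]
  set g : Fin n → ℝ := fun k => frameD1 b u k x with hg
  set T : Fin n → Fin n → Fin n → ℝ := fun i j k => frameD3 b u i j k x with hT
  set F : Fin n → Fin n → Fin n → Fin n → ℝ := fun i j k l => frameD4 b u i j k l x with hF
  -- The second derivative along the i-th frame vector, with the diagonal form of D²u inserted. It
  -- is sorted into fourth order, third order and purely second order terms.
  have key : ∀ i, (∑ k, ∑ m, (F k k i i * (g m * g m) + T k k i * (frameD2 b u m i x * g m +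
        g m * frameD2 b u m i x) + (T k k i * (frameD2 b u m i x * g m + g m * frameD2 b u m i x) +
        frameD2 b u k k x * (T m i i * g m + frameD2 b u m i x * frameD2 b u m i x +
          (frameD2 b u m i x * frameD2 b u m i x + g m * T m i i))) -
      (F k m i i * (g k * g m) + T k m i * (frameD2 b u k i x * g m + g k * frameD2 b u m i x) +
        (T k m i * (frameD2 b u k i x * g m + g k * frameD2 b u m i x) +
        frameD2 b u k m x * (T k i i * g m + frameD2 b u k i x * frameD2 b u m i x +
          (frameD2 b u k i x * frameD2 b u m i x + g k * T m i i)))))) =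
      (∑ k, ∑ m, (F k k i i * (g m * g m) - F k m i i * (g k * g m))) + 4 * (l i * ∑ k, T k k i * g i)
      + 2 * (∑ k, l k) * (∑ m, g m * T m i i) + 2 * (∑ k, l k) * (l i * l i)
      - 4 * (l i * ∑ m, T i m i * g m) - 2 * (∑ k, l k * g k * T k i i) - 2 * (l i * l i * l i) := by
    intro i
    simp only [mul_add, Finset.sum_add_distrib, Finset.sum_sub_distrib, hdiag, ite_mul,
      mul_ite, zero_mul, mul_zero, Finset.sum_ite_eq, Finset.sum_ite_eq', Finset.mem_univ, if_true,
      Finset.sum_ite_irrel, Finset.sum_const_zero]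
    have a1 : ∑ x, T x x i * (l i * g i) = l i * ∑ x, T x x i * g i := by
      rw [Finset.mul_sum]
      exact Finset.sum_congr rfl fun _ _ => by ring
    have a2 : ∑ x, T x x i * (g i * l i) = l i * ∑ x, T x x i * g i := by
      rw [Finset.mul_sum]
      exact Finset.sum_congr rfl fun _ _ => by ring
    have a3 : ∑ x, ∑ y, l x * (T y i i * g y) = (∑ k, l k) * ∑ m, g m * T m i i := by
      rw [Finset.sum_mul_sum]
      exact Finset.sum_congr rfl fun _ _ => Finset.sum_congr rfl fun _ _ => by ring
    have a4 : ∑ x, ∑ y, l x * (g y * T y i i) = (∑ k, l k) * ∑ m, g m * T m i i := by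
      rw [Finset.sum_mul_sum]
    have a5 : ∑ x, l x * (l i * l i) = (∑ k, l k) * (l i * l i) := by rw [Finset.sum_mul]
    have a6 : ∑ x, T i x i * (l i * g x) = l i * ∑ m, T i m i * g m := by
      rw [Finset.mul_sum]
      exact Finset.sum_congr rfl fun _ _ => by ring
    have a7 : ∑ x, T x i i * (g x * l i) = l i * ∑ m, T i m i * g m := by
      rw [Finset.mul_sum]
      refine Finset.sum_congr rfl fun m _ => ?_
      have : T m i i = T i m i := frameD3_symm_left hΩ hu m i i hx
      rw [this]
      ring
    have a8 : ∑ x, l x * (T x i i * g x) = ∑ k, l k * g k * T k i i :=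
      Finset.sum_congr rfl fun _ _ => by ring
    have a9 : ∑ x, l x * (g x * T x i i) = ∑ k, l k * g k * T k i i :=
      Finset.sum_congr rfl fun _ _ => by ring
    rw [a1, a2, a3, a4, a5, a6, a7, a8, a9]
    ring
  replace h := (Finset.sum_congr rfl fun i _ => congrArg ((l i)⁻¹ * ·) (key i)).symm.trans_le h
  have t3 : ∀ i, (l i)⁻¹ * ((∑ k, ∑ m, (F k k i i * (g m * g m) - F k m i i * (g k * g m)))
      + 4 * (l i * ∑ k, T k k i * g i)
      + 2 * (∑ k, l k) * (∑ m, g m * T m i i) + 2 * (∑ k, l k) * (l i * l i)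
      - 4 * (l i * ∑ m, T i m i * g m) - 2 * (∑ k, l k * g k * T k i i) - 2 * (l i * l i * l i)) =
      (l i)⁻¹ * (∑ k, ∑ m, (F k k i i * (g m * g m) - F k m i i * (g k * g m)))
      + 4 * (∑ k, T k k i * g i) + 2 * (∑ k, l k) * (∑ m, g m * ((l i)⁻¹ * T m i i))
      + 2 * (∑ k, l k) * l i - 4 * (∑ m, T i m i * g m)
      - 2 * (∑ k, l k * g k * ((l i)⁻¹ * T k i i)) - 2 * (l i * l i) := by
    intro i
    have e1 : ∑ m, g m * ((l i)⁻¹ * T m i i) = (l i)⁻¹ * ∑ m, g m * T m i i := by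
      rw [Finset.mul_sum]
      exact Finset.sum_congr rfl fun m _ => by ring
    have e2 : ∑ k, l k * g k * ((l i)⁻¹ * T k i i) = (l i)⁻¹ * ∑ k, l k * g k * T k i i := by
      rw [Finset.mul_sum]
      exact Finset.sum_congr rfl fun m _ => by ring
    rw [e1, e2]
    have := (hl i).ne'
    generalize ∑ k, T k k i * g i = a
    field_simp
  simp only [t3] at h
  have s1 : ∑ i, ∑ m, g m * ((l i)⁻¹ * T m i i) = 0 := by
    rw [Finset.sum_comm]
    simp only [← Finset.mul_sum, t1, hT, mul_zero, Finset.sum_const_zero]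
  have s2 : ∑ i, ∑ k, l k * g k * ((l i)⁻¹ * T k i i) = 0 := by
    rw [Finset.sum_comm]
    simp only [← Finset.mul_sum, t1, hT, mul_zero, Finset.sum_const_zero]
  -- After division by `l i`, the two cross terms with coefficients 4 and −4 cancel by symmetry of
  -- the third derivatives.
  have s3 : ∑ i, ∑ m, T i m i * g m = ∑ i, ∑ k, T k k i * g i := by
    rw [Finset.sum_comm]
    exact Finset.sum_congr rfl fun m _ => Finset.sum_congr rfl fun i _ => by
      rw [hT]
      simp only
      rw [frameD3_symm_right hΩ hu i m i hx]
  have s4 : ∑ i, (l i)⁻¹ * (∑ k, ∑ m, (F k k i i * (g m * g m) - F k m i i * (g k * g m))) =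
      ∑ i, ∑ j, (l i)⁻¹ * (l j)⁻¹ *
        ∑ k, ∑ m, (T i j k * T i j k * (g m * g m) - T i j k * T i j m * (g k * g m)) := by
    calc _ = ∑ k, ∑ m, ((∑ i, (l i)⁻¹ * F k k i i) * (g m * g m) -
          (∑ i, (l i)⁻¹ * F k m i i) * (g k * g m)) := by
          simp only [Finset.mul_sum, Finset.sum_mul, ← Finset.sum_sub_distrib]
          rw [Finset.sum_comm]
          refine Finset.sum_congr rfl fun k _ => ?_
          rw [Finset.sum_comm]
          exact Finset.sum_congr rfl fun m _ => Finset.sum_congr rfl fun i _ => by ring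
      _ = ∑ k, ∑ m, ∑ i, ∑ j, (l i)⁻¹ * (l j)⁻¹ *
            (T i j k * T i j k * (g m * g m) - T i j k * T i j m * (g k * g m)) := by
          refine Finset.sum_congr rfl fun k _ => Finset.sum_congr rfl fun m _ => ?_
          rw [t2 k k, t2 k m]
          simp only [Finset.sum_mul, ← Finset.sum_sub_distrib]
          exact Finset.sum_congr rfl fun i _ => Finset.sum_congr rfl fun j _ => by ring
      _ = ∑ i, ∑ j, ∑ k, ∑ m, (l i)⁻¹ * (l j)⁻¹ *
            (T i j k * T i j k * (g m * g m) - T i j k * T i j m * (g k * g m)) := by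
          rw [Finset.sum_congr rfl fun k _ => Finset.sum_comm]
          rw [Finset.sum_comm]
          refine Finset.sum_congr rfl fun i _ => ?_
          rw [Finset.sum_congr rfl fun k _ => Finset.sum_comm, Finset.sum_comm]
      _ = _ := by simp only [Finset.mul_sum]
  -- Lagrange's identity: for each i, j the inner sum is |T|²|g|² − ⟨T, g⟩² with T the vector
  -- u_{ij·}, half of a sum of squares.
  have s5 : 0 ≤ ∑ i, ∑ j, (l i)⁻¹ * (l j)⁻¹ *
        ∑ k, ∑ m, (T i j k * T i j k * (g m * g m) - T i j k * T i j m * (g k * g m)) := by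
    refine Finset.sum_nonneg fun i _ => Finset.sum_nonneg fun j _ =>
      mul_nonneg (mul_nonneg (inv_nonneg.mpr (hl i).le) (inv_nonneg.mpr (hl j).le)) ?_
    have e : ∑ k, ∑ m, (T i j k * T i j k * (g m * g m) - T i j k * T i j m * (g k * g m)) =
        ∑ k, ∑ m, (T i j m * T i j m * (g k * g k) - T i j k * T i j m * (g k * g m)) := by
      rw [Finset.sum_comm]
      exact Finset.sum_congr rfl fun m _ => Finset.sum_congr rfl fun i _ => by ring
    have e' : 0 ≤ ∑ k, ∑ m, (T i j k * g m - T i j m * g k) ^ 2 :=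
      Finset.sum_nonneg fun k _ => Finset.sum_nonneg fun m _ => sq_nonneg _
    have e2 : ∑ k, ∑ m, (T i j k * g m - T i j m * g k) ^ 2 =
        (∑ k, ∑ m, (T i j k * T i j k * (g m * g m) - T i j k * T i j m * (g k * g m))) +
        ∑ k, ∑ m, (T i j m * T i j m * (g k * g k) - T i j k * T i j m * (g k * g m)) := by
      simp only [← Finset.sum_add_distrib]
      exact Finset.sum_congr rfl fun m _ => Finset.sum_congr rfl fun i _ => by ring
    linarith
  -- This is where the strict sign arises: with at least two indices the products l_i l_j, i ≠ j,
  -- are present and positive.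
  have s6 : ∑ i, l i * l i < (∑ k, l k) * ∑ i, l i := by
    rw [Finset.mul_sum]
    have hnt : Nontrivial (Fin n) := Fin.nontrivial_iff_two_le.mpr hn
    refine Finset.sum_lt_sum_of_nonempty ⟨⟨0, by omega⟩, Finset.mem_univ _⟩ fun i _ => ?_
    refine mul_lt_mul_of_pos_right ?_ (hl i)
    obtain ⟨j, hj⟩ := exists_ne i
    exact Finset.single_lt_sum hj (Finset.mem_univ _) (Finset.mem_univ _) (hl j)
      fun k _ _ => (hl k).le
  rw [← s4] at s5
  simp only [Finset.sum_sub_distrib, Finset.sum_add_distrib, ← Finset.mul_sum] at h s5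
  rw [s1, s2, s3] at h
  linarith

/-- `Σ uᵏᵐ u_k u_m` has no interior maximum. -/
theorem not_isLocalMax_inverse_form (hn : 0 < n) :
    ¬ IsLocalMax (fun y => ∑ k, (∑ m, (frameHess b u y).adjugate k m * frameD1 b u m y) *
      frameD1 b u k y) x := by
  intro hmax
  -- X = (D²u)⁻¹Du. Its derivatives are computed from D²u · X = Du, so the inverse Hessian need not
  -- be differentiated explicitly.
  set X : Fin n → E → ℝ := fun k y => ∑ m, (frameHess b u y).adjugate k m * frameD1 b u m y with hX
  have hXs : ∀ k, ContDiffOn ℝ ∞ (X k) Ω := fun k => ContDiffOn.sum fun m _ =>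
    (contDiffOn_adjugate hΩ hu k m).mul (contDiffOn_frameD1 hΩ hu m)
  have hXd : ∀ k i, ∀ y ∈ Ω, HasLineDerivAt ℝ (X k) (dirDeriv (b i) (X k) y) y (b i) :=
    fun k i y hy => hasLineDerivAt_dirDeriv hΩ (hXs k) hy _
  have hMX : ∀ j, ∀ y ∈ Ω, ∑ k, frameD2 b u j k y * X k y = frameD1 b u j y := by
    intro j y hy
    have h : (frameHess b u y).mulVec ((frameHess b u y).adjugate.mulVec
        fun m => frameD1 b u m y) = fun m => frameD1 b u m y := by
      rw [Matrix.mulVec_mulVec, Matrix.mul_adjugate, hdet y hy, one_smul, Matrix.one_mulVec]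
    exact congrFun h j
  have hMX' : ∀ j i, ∀ y ∈ Ω, ∑ k, frameD2 b u j k y * dirDeriv (b i) (X k) y =
      frameD2 b u j i y - ∑ k, frameD3 b u j k i y * X k y := by
    intro j i y hy
    have h1 := hasLineDerivAt_sum (s := Finset.univ) fun k _ =>
      hasLineDerivAt_mul (hasLineDerivAt_frameD2 (b := b) hΩ hu j k i hy) (hXd k i y hy)
    have h2 : (fun y => ∑ k, frameD2 b u j k y * X k y) =ᶠ[𝓝 y] frameD1 b u j := by
      filter_upwards [hΩ.mem_nhds hy] with z hz using hMX j z hz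
    have h := h1.unique (HasLineDerivAt.congr_of_eventuallyEq
      (hasLineDerivAt_frameD1 (b := b) hΩ hu j i hy) h2)
    rw [Finset.sum_add_distrib] at h
    linarith
  -- Writing Du = D²u · X, the derivatives of X appear only contracted with D²u, so `hMX'`
  -- eliminates them and ∂_i(X · Du) = 2u_i − u_{kmi}X_kX_m.
  have d1 : ∀ i, ∀ y ∈ Ω, HasLineDerivAt ℝ (fun y => ∑ k, X k y * frameD1 b u k y)
      (2 * frameD1 b u i y - ∑ k, ∑ m, frameD3 b u k m i y * (X k y * X m y)) y (b i) := by
    intro i y hy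
    have h := hasLineDerivAt_sum (s := Finset.univ) fun k _ =>
      hasLineDerivAt_mul (hXd k i y hy) (hasLineDerivAt_frameD1 (b := b) hΩ hu k i hy)
    convert h using 1
    have h1 : ∑ k, X k y * frameD2 b u k i y = frameD1 b u i y := by
      rw [← hMX i y hy]
      exact Finset.sum_congr rfl fun k _ => by rw [frameD2_symm hΩ hu k i hy, mul_comm]
    have h2 : ∑ k, dirDeriv (b i) (X k) y * frameD1 b u k y = frameD1 b u i y -
        ∑ k, ∑ m, frameD3 b u k m i y * (X k y * X m y) := by
      calc ∑ k, dirDeriv (b i) (X k) y * frameD1 b u k y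
          = ∑ k, ∑ m, X m y * (frameD2 b u m k y * dirDeriv (b i) (X k) y) := by
            refine Finset.sum_congr rfl fun k _ => ?_
            rw [← hMX k y hy, Finset.mul_sum]
            refine Finset.sum_congr rfl fun m _ => ?_
            rw [frameD2_symm hΩ hu k m hy]
            ring
        _ = ∑ m, X m y * (frameD2 b u m i y - ∑ k, frameD3 b u m k i y * X k y) := by
            rw [Finset.sum_comm]
            refine Finset.sum_congr rfl fun m _ => ?_
            rw [← hMX' m i y hy, Finset.mul_sum]
        _ = _ := by
            simp only [mul_sub, Finset.sum_sub_distrib, h1, Finset.mul_sum]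
            congr 1
            exact Finset.sum_congr rfl fun k _ => Finset.sum_congr rfl fun m _ => by ring
    rw [Finset.sum_add_distrib, h1, h2]
    ring
  have h := sum_second_deriv_nonpos_of_isLocalMax hΩ hx hl hmax d1
    (fun i => hasLineDerivAt_sub
      (hasLineDerivAt_const_mul 2 (hasLineDerivAt_frameD1 (b := b) hΩ hu i i hx))
      (hasLineDerivAt_sum fun k _ => hasLineDerivAt_sum fun m _ =>
        hasLineDerivAt_mul (hasLineDerivAt_frameD3 (b := b) hΩ hu k m i i hx)
          (hasLineDerivAt_mul (hXd k i x hx) (hXd m i x hx))))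
  set a : Fin n → Fin n → ℝ := fun k i => ∑ m, frameD3 b u k m i x * X m x with ha
  have hX' : ∀ k i, dirDeriv (b i) (X k) x = (if k = i then 1 else 0) - (l k)⁻¹ * a k i := by
    intro k i
    have h1 := hMX' k i x hx
    simp only [hdiag, ite_mul, zero_mul, Finset.sum_ite_eq, Finset.mem_univ, if_true] at h1
    have := (hl k).ne'
    split_ifs with hki
    · rw [if_pos hki] at h1
      field_simp
      linarith
    · rw [if_neg hki] at h1
      field_simp
      linarith
  have ha' : ∀ i j, a i j = ∑ k, frameD3 b u i j k x * X k x := fun i j =>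
    Finset.sum_congr rfl fun k _ => by rw [frameD3_symm_right hΩ hu i k j hx]
  have t0 : ∑ i, (l i)⁻¹ * a i i = 0 := by
    simp only [ha', Finset.mul_sum]
    rw [Finset.sum_comm]
    refine Finset.sum_eq_zero fun k _ => ?_
    have := sum_frameD3_div hΩ hu hdet hx hl hdiag k
    calc _ = (∑ i, (l i)⁻¹ * frameD3 b u i i k x) * X k x := by
          rw [Finset.sum_mul]
          exact Finset.sum_congr rfl fun i _ => by ring
      _ = 0 := by rw [this, zero_mul]
  have t1 : ∑ i, (l i)⁻¹ * ∑ k, ∑ m, frameD4 b u k m i i x * (X k x * X m x) =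
      ∑ i, ∑ j, (l i)⁻¹ * (l j)⁻¹ * (a i j * a i j) := by
    calc _ = ∑ k, ∑ m, (∑ i, (l i)⁻¹ * frameD4 b u i i k m x) * (X k x * X m x) := by
          simp only [Finset.mul_sum, Finset.sum_mul]
          rw [Finset.sum_comm]
          refine Finset.sum_congr rfl fun k _ => ?_
          rw [Finset.sum_comm]
          refine Finset.sum_congr rfl fun m _ => Finset.sum_congr rfl fun i _ => ?_
          rw [frameD4_swap hΩ hu k m i i hx]
          ring
      _ = ∑ k, ∑ m, ∑ i, ∑ j, (l i)⁻¹ * (l j)⁻¹ *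
            ((frameD3 b u i j k x * X k x) * (frameD3 b u i j m x * X m x)) := by
          refine Finset.sum_congr rfl fun k _ => Finset.sum_congr rfl fun m _ => ?_
          rw [sum_frameD4_div hΩ hu hdet hx hl hdiag k m]
          simp only [Finset.sum_mul]
          exact Finset.sum_congr rfl fun i _ => Finset.sum_congr rfl fun j _ => by ring
      _ = ∑ i, ∑ j, ∑ k, ∑ m, (l i)⁻¹ * (l j)⁻¹ *
            ((frameD3 b u i j k x * X k x) * (frameD3 b u i j m x * X m x)) := by
          rw [Finset.sum_congr rfl fun k _ => Finset.sum_comm]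
          rw [Finset.sum_comm]
          refine Finset.sum_congr rfl fun i _ => ?_
          rw [Finset.sum_congr rfl fun k _ => Finset.sum_comm, Finset.sum_comm]
      _ = _ := by
          refine Finset.sum_congr rfl fun i _ => Finset.sum_congr rfl fun j _ => ?_
          rw [ha', Finset.sum_mul_sum, Finset.mul_sum]
          exact Finset.sum_congr rfl fun k _ => by rw [← Finset.mul_sum]
  have t2 : ∀ i, ∑ k, ∑ m, (frameD4 b u k m i i x * (X k x * X m x) + frameD3 b u k m i x *
      (dirDeriv (b i) (X k) x * X m x + X k x * dirDeriv (b i) (X m) x)) =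
      (∑ k, ∑ m, frameD4 b u k m i i x * (X k x * X m x)) + 2 * a i i -
        2 * ∑ k, (l k)⁻¹ * (a k i * a k i) := by
    intro i
    have e1 : ∑ k, ∑ m, frameD3 b u k m i x * (dirDeriv (b i) (X k) x * X m x) =
        ∑ k, dirDeriv (b i) (X k) x * a k i := by
      simp only [ha, Finset.mul_sum]
      exact Finset.sum_congr rfl fun k _ => Finset.sum_congr rfl fun m _ => by ring
    have e2 : ∑ k, ∑ m, frameD3 b u k m i x * (X k x * dirDeriv (b i) (X m) x) =
        ∑ k, dirDeriv (b i) (X k) x * a k i := by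
      simp only [ha, Finset.mul_sum]
      rw [Finset.sum_comm]
      refine Finset.sum_congr rfl fun k _ => Finset.sum_congr rfl fun m _ => ?_
      rw [frameD3_symm_left hΩ hu m k i hx]
      ring
    have e3 : ∑ k, dirDeriv (b i) (X k) x * a k i = a i i - ∑ k, (l k)⁻¹ * (a k i * a k i) := by
      simp only [hX', sub_mul, Finset.sum_sub_distrib, ite_mul, one_mul, zero_mul,
        Finset.sum_ite_eq', Finset.mem_univ, if_true, mul_assoc]
    simp only [mul_add, Finset.sum_add_distrib, e1, e2, e3]
    ring
  simp only [t2] at h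
  have t3 : ∀ i, (l i)⁻¹ * (2 * frameD2 b u i i x - ((∑ k, ∑ m, frameD4 b u k m i i x *
      (X k x * X m x)) + 2 * a i i - 2 * ∑ k, (l k)⁻¹ * (a k i * a k i))) =
      2 - (l i)⁻¹ * (∑ k, ∑ m, frameD4 b u k m i i x * (X k x * X m x)) - 2 * ((l i)⁻¹ * a i i) +
      2 * ∑ k, (l k)⁻¹ * (l i)⁻¹ * (a k i * a k i) := by
    intro i
    have e : ∑ k, (l k)⁻¹ * (l i)⁻¹ * (a k i * a k i) =
        (l i)⁻¹ * ∑ k, (l k)⁻¹ * (a k i * a k i) := by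
      rw [Finset.mul_sum]
      exact Finset.sum_congr rfl fun k _ => by ring
    rw [e, hdiag, if_pos rfl]
    have := (hl i).ne'
    field_simp
    ring
  simp only [t3] at h
  rw [Finset.sum_add_distrib, Finset.sum_sub_distrib, Finset.sum_sub_distrib, ← Finset.mul_sum,
    ← Finset.mul_sum, t0, t1, Finset.sum_comm] at h
  -- By now L(X · Du) has become 2n + Σ λ_i⁻¹λ_j⁻¹a_ij²: the fourth derivatives contribute this sum
  -- with coefficient −1, the derivatives of X with coefficient +2.
  have h7 : (0 : ℝ) < n := by exact_mod_cast hn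
  have h8 : 0 ≤ ∑ i, ∑ j, (l i)⁻¹ * (l j)⁻¹ * (a i j * a i j) :=
    Finset.sum_nonneg fun i _ => Finset.sum_nonneg fun j _ =>
      mul_nonneg (mul_nonneg (inv_nonneg.mpr (hl i).le) (inv_nonneg.mpr (hl j).le))
        (mul_self_nonneg _)
  rw [Finset.sum_comm] at h8
  simp only [Finset.sum_const, Finset.card_univ, Fintype.card_fin, nsmul_eq_mul] at h
  linarith

end Frame

open scoped RealInnerProductSpace

/-! ### Convexity and the equation up to the boundary -/

section Domain

variable {Ω : Set (EuclideanSpace ℝ (Fin n))} (hΩ : IsSmoothStrictlyConvexDomain Ω)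
include hΩ

theorem IsSmoothStrictlyConvexDomain.uniqueDiffOn_closure : UniqueDiffOn ℝ (closure Ω) :=
  uniqueDiffOn_convex hΩ.convex.closure
    (hΩ.nonempty.mono (interior_maximal subset_closure hΩ.isOpen))

theorem IsSmoothStrictlyConvexDomain.isCompact_closure : IsCompact (closure Ω) :=
  hΩ.isBounded.isCompact_closure

theorem IsSmoothStrictlyConvexDomain.closure_mem_nhds {x : EuclideanSpace ℝ (Fin n)}
    (hx : x ∈ Ω) : closure Ω ∈ 𝓝 x :=
  Filter.mem_of_superset (hΩ.isOpen.mem_nhds hx) subset_closure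

theorem IsSmoothStrictlyConvexDomain.frontier_eq : frontier Ω = closure Ω \ Ω :=
  hΩ.isOpen.frontier_eq

/-- A continuous function on the closure of the domain without interior maximum attains its
maximum, and only on the boundary. -/
theorem attainsMaxOnlyOnBoundary_of_not_isLocalMax {f : EuclideanSpace ℝ (Fin n) → ℝ}
    (hf : ContinuousOn f (closure Ω)) (h : ∀ x ∈ Ω, ¬ IsLocalMax f x) :
    AttainsMaxOnlyOnBoundary Ω f := by
  refine ⟨hΩ.isCompact_closure.exists_isMaxOn hΩ.nonempty.closure hf, fun x hx hmax => ?_⟩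
  rw [hΩ.frontier_eq]
  exact ⟨hx, fun hx' => h x hx' (hmax.isLocalMax (hΩ.closure_mem_nhds hx'))⟩

end Domain

/-- The maximum is attained at a boundary point, and is strictly larger than the interior values. -/
theorem AttainsMaxOnlyOnBoundary.exists_frontier {Ω : Set (EuclideanSpace ℝ (Fin n))}
    (hΩ : IsOpen Ω) {f : EuclideanSpace ℝ (Fin n) → ℝ} (h : AttainsMaxOnlyOnBoundary Ω f) :
    ∃ y ∈ frontier Ω, (∀ x ∈ closure Ω, f x ≤ f y) ∧ ∀ x ∈ Ω, f x < f y := by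
  obtain ⟨⟨y, hy, hmax⟩, h2⟩ := h
  refine ⟨y, h2 y hy hmax, fun x hx => hmax hx, fun x hx => ?_⟩
  refine lt_of_le_of_ne (hmax (subset_closure hx)) fun he => ?_
  have : x ∈ frontier Ω := h2 x (subset_closure hx) fun z hz => (hmax hz).trans he.ge
  rw [hΩ.frontier_eq] at this
  exact this.2 hx

section Regularity

variable {Ω : Set (EuclideanSpace ℝ (Fin n))} (hΩ : IsSmoothStrictlyConvexDomain Ω)
  {u : EuclideanSpace ℝ (Fin n) → ℝ} (hu : IsSolution Ω u)
include hΩ hu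

theorem contDiffOn_Du : ContDiffOn ℝ ∞ (Du (closure Ω) u) (closure Ω) :=
  ((InnerProductSpace.toDual ℝ (EuclideanSpace ℝ (Fin n))).symm.contDiff (n := ∞)).comp_contDiffOn
    (hu.smooth.fderivWithin hΩ.uniqueDiffOn_closure (by simp))

theorem continuousOn_Du : ContinuousOn (Du (closure Ω) u) (closure Ω) :=
  (contDiffOn_Du hΩ hu).continuousOn

theorem continuousOn_hessOp : ContinuousOn (hessOp (closure Ω) u) (closure Ω) :=
  ((contDiffOn_Du hΩ hu).fderivWithin (m := ∞) hΩ.uniqueDiffOn_closure (by simp)).continuousOn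

omit hΩ in
theorem hasFDerivWithinAt_self {x : EuclideanSpace ℝ (Fin n)} (hx : x ∈ closure Ω) :
    HasFDerivWithinAt u (innerSL ℝ (Du (closure Ω) u x)) (closure Ω) x := by
  have h := ((hu.smooth x hx).differentiableWithinAt (by simp)).hasFDerivWithinAt
  have e : innerSL ℝ (Du (closure Ω) u x) = fderivWithin ℝ u (closure Ω) x :=
    (InnerProductSpace.toDual ℝ (EuclideanSpace ℝ (Fin n))).apply_symm_apply _
  rwa [e]

theorem hasFDerivWithinAt_Du {x : EuclideanSpace ℝ (Fin n)} (hx : x ∈ closure Ω) :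
    HasFDerivWithinAt (Du (closure Ω) u) (hessOp (closure Ω) u x) (closure Ω) x :=
  ((contDiffOn_Du hΩ hu x hx).differentiableWithinAt (by simp)).hasFDerivWithinAt

theorem hasFDerivAt_self {x : EuclideanSpace ℝ (Fin n)} (hx : x ∈ Ω) :
    HasFDerivAt u (innerSL ℝ (Du (closure Ω) u x)) x :=
  (hasFDerivWithinAt_self hu (subset_closure hx)).hasFDerivAt (hΩ.closure_mem_nhds hx)

theorem hasFDerivAt_Du {x : EuclideanSpace ℝ (Fin n)} (hx : x ∈ Ω) :
    HasFDerivAt (Du (closure Ω) u) (hessOp (closure Ω) u x) x :=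
  (hasFDerivWithinAt_Du hΩ hu (subset_closure hx)).hasFDerivAt (hΩ.closure_mem_nhds hx)

omit hΩ in
theorem contDiffOn_interior : ContDiffOn ℝ ∞ u Ω := hu.smooth.mono subset_closure

theorem dirDeriv_eq_inner (v : EuclideanSpace ℝ (Fin n)) :
    EqOn (dirDeriv v u) (fun x => ⟪Du (closure Ω) u x, v⟫) Ω := fun x hx => by
  rw [dirDeriv, (hasFDerivAt_self hΩ hu hx).fderiv]
  rfl

theorem dirDeriv_dirDeriv_eq_inner {x : EuclideanSpace ℝ (Fin n)} (hx : x ∈ Ω)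
    (v w : EuclideanSpace ℝ (Fin n)) :
    dirDeriv w (dirDeriv v u) x = ⟪hessOp (closure Ω) u x w, v⟫ := by
  rw [dirDeriv_congr hΩ.isOpen (dirDeriv_eq_inner hΩ hu v) w hx, dirDeriv,
    ((hasFDerivAt_Du hΩ hu hx).inner ℝ (hasFDerivAt_const v x)).fderiv]
  simp

/-- Symmetry of second derivatives in the interior, carried to the boundary by continuity. -/
theorem hessOp_symm {x : EuclideanSpace ℝ (Fin n)} (hx : x ∈ closure Ω)
    (v w : EuclideanSpace ℝ (Fin n)) :
    ⟪hessOp (closure Ω) u x v, w⟫ = ⟪v, hessOp (closure Ω) u x w⟫ := by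
  have hc : ∀ v, ContinuousOn (fun x => hessOp (closure Ω) u x v) (closure Ω) := fun v =>
    (continuousOn_hessOp hΩ hu).clm_apply continuousOn_const
  have h : EqOn (fun x => ⟪hessOp (closure Ω) u x v, w⟫)
      (fun x => ⟪v, hessOp (closure Ω) u x w⟫) Ω := by
    intro x hx
    have := dirDeriv_comm hΩ.isOpen (contDiffOn_interior hu) hx v w
    rw [dirDeriv_dirDeriv_eq_inner hΩ hu hx, dirDeriv_dirDeriv_eq_inner hΩ hu hx] at this
    simp only
    rw [this, real_inner_comm]
  exact h.of_subset_closure ((hc v).inner continuousOn_const)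
    (continuousOn_const.inner (hc w)) subset_closure subset_rfl hx

omit hΩ hu in
theorem hessian_eq_toMatrix (x : EuclideanSpace ℝ (Fin n)) :
    hessian (closure Ω) u x = LinearMap.toMatrix (EuclideanSpace.basisFun (Fin n) ℝ).toBasis
      (EuclideanSpace.basisFun (Fin n) ℝ).toBasis (hessOp (closure Ω) u x).toLinearMap := by
  ext i j
  simp [hessian, LinearMap.toMatrix_apply]

theorem det_hessOp {x : EuclideanSpace ℝ (Fin n)} (hx : x ∈ closure Ω) :
    LinearMap.det (hessOp (closure Ω) u x).toLinearMap = 1 := by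
  have hc : ContinuousOn (hessian (closure Ω) u) (closure Ω) := by
    refine continuousOn_pi.mpr fun i => continuousOn_pi.mpr fun j => ?_
    have : ContinuousOn (fun x => hessOp (closure Ω) u x (EuclideanSpace.single j 1))
      (closure Ω) := (continuousOn_hessOp hΩ hu).clm_apply continuousOn_const
    exact (EuclideanSpace.proj (𝕜 := ℝ) i).continuous.comp_continuousOn this
  have h : EqOn (fun x => (hessian (closure Ω) u x).det) (fun _ => 1) (closure Ω) :=
    EqOn.of_subset_closure (fun x hx => hu.det_hessian x hx) 
      (continuous_id.matrix_det.comp_continuousOn hc) continuousOn_const subset_closure subset_rfl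
  have := h hx
  simp only at this
  rw [← this, hessian_eq_toMatrix, LinearMap.det_toMatrix]

/-- The convexity inequality is closed in the pair of endpoints, so it passes from Ω × Ω to its
closure. -/
theorem convexOn_closure : ConvexOn ℝ (closure Ω) u := by
  have hcu := hu.smooth.continuousOn
  refine ⟨hΩ.convex.closure, fun a ha b hb s t hs ht hst => ?_⟩
  have key : ∀ p ∈ closure (Ω ×ˢ Ω), u (s • p.1 + t • p.2) ≤ s • u p.1 + t • u p.2 := by
    intro p hp
    refine le_on_closure (s := Ω ×ˢ Ω) (f := fun p => u (s • p.1 + t • p.2))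
      (g := fun p => s • u p.1 + t • u p.2) (fun q hq =>
      hu.strictConvex.convexOn.2 hq.1 hq.2 hs ht hst) ?_ ?_ hp
    · rw [closure_prod_eq]
      refine hcu.comp (by fun_prop) fun q hq => hΩ.convex.closure hq.1 hq.2 hs ht hst
    · rw [closure_prod_eq]
      exact ((hcu.comp continuousOn_fst fun q hq => hq.1).const_smul s).add
        ((hcu.comp continuousOn_snd fun q hq => hq.2).const_smul t)
  exact key (a, b) (by rw [closure_prod_eq]; exact ⟨ha, hb⟩)

/-- The gradient inequality of the convex function `u`. -/
theorem gradient_ineq {x y : EuclideanSpace ℝ (Fin n)} (hx : x ∈ closure Ω) (hy : y ∈ closure Ω) :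
    u x + ⟪Du (closure Ω) u x, y - x⟫ ≤ u y := by
  have hconv := convexOn_closure hΩ hu
  have hd : HasDerivWithinAt (fun t : ℝ => u (x + t • (y - x)))
      ⟪Du (closure Ω) u x, y - x⟫ (Icc 0 1) 0 := by
    have h1 : HasFDerivWithinAt u (innerSL ℝ (Du (closure Ω) u x)) (closure Ω)
        (x + (0 : ℝ) • (y - x)) := by simpa using hasFDerivWithinAt_self hu hx
    have h2 : HasDerivWithinAt (fun t : ℝ => x + t • (y - x)) (y - x) (Icc 0 1) 0 := by
      simpa using (((hasDerivAt_id (0 : ℝ)).smul_const (y - x)).const_add x).hasDerivWithinAt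
    have h3 : MapsTo (fun t : ℝ => x + t • (y - x)) (Icc 0 1) (closure Ω) := fun t ht =>
      hΩ.convex.closure.add_smul_sub_mem hx hy ht
    exact h1.comp_hasDerivWithinAt 0 h2 h3
  have hd2 : HasDerivWithinAt (fun t : ℝ => u (x + t • (y - x)) - (u x + t * (u y - u x)))
      (⟪Du (closure Ω) u x, y - x⟫ - (u y - u x)) (Icc 0 1) 0 := by
    refine hd.sub ?_
    simpa using (((hasDerivAt_id (0 : ℝ)).mul_const (u y - u x)).const_add (u x)).hasDerivWithinAt
  -- Convexity puts u below its chord, with equality at t = 0. A one-sided maximum suffices, so x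
  -- may lie on the boundary.
  have hmax : IsLocalMaxOn (fun t : ℝ => u (x + t • (y - x)) - (u x + t * (u y - u x)))
      (Icc 0 1) 0 := by
    refine Filter.eventually_of_mem self_mem_nhdsWithin fun t ht => ?_
    have := hconv.2 hx hy (sub_nonneg.mpr ht.2) ht.1 (by ring)
    have e : (1 - t) • x + t • y = x + t • (y - x) := by module
    rw [e] at this
    simp only [smul_eq_mul] at this
    simp
    linarith
  have hcone : (1 : ℝ) ∈ posTangentConeAt (Icc 0 1) 0 := by
    have h := sub_mem_posTangentConeAt_of_segment_subset (segment_eq_Icc zero_le_one).subset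
      (x := (0 : ℝ)) (y := 1)
    rwa [sub_zero] at h
  have h := hmax.hasFDerivWithinAt_nonpos hd2.hasFDerivWithinAt hcone
  rw [ContinuousLinearMap.toSpanSingleton_apply, one_smul] at h
  linarith

/-- By the gradient inequality, y ↦ ⟨Du(z), y⟩ − u(y) is maximal at an interior z; the second order
condition is then closed up to the boundary. -/
theorem hessOp_nonneg {x : EuclideanSpace ℝ (Fin n)} (hx : x ∈ closure Ω)
    (v : EuclideanSpace ℝ (Fin n)) : 0 ≤ ⟪hessOp (closure Ω) u x v, v⟫ := by
  have hc : ContinuousOn (fun x => hessOp (closure Ω) u x v) (closure Ω) :=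
    (continuousOn_hessOp hΩ hu).clm_apply continuousOn_const
  refine le_on_closure (s := Ω) (f := fun _ => 0)
    (g := fun x => ⟪hessOp (closure Ω) u x v, v⟫) (fun z hz => ?_) continuousOn_const
    (hc.inner continuousOn_const) hx
  have hmax : IsLocalMax (fun y => ⟪Du (closure Ω) u z, y⟫ - u y) z := by
    filter_upwards [hΩ.isOpen.mem_nhds hz] with y hy
    have := gradient_ineq hΩ hu (subset_closure hz) (subset_closure hy)
    rw [inner_sub_right] at this
    linarith
  have h := second_lineDeriv_nonpos_of_isLocalMax (v := v)
    (f₁ := fun y => ⟪Du (closure Ω) u z, v⟫ - dirDeriv v u y)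
    (f₂ := 0 - ⟪hessOp (closure Ω) u z v, v⟫) hmax ?_ ?_
  · linarith
  · filter_upwards [hΩ.isOpen.mem_nhds hz] with y hy
    exact hasLineDerivAt_sub ((innerSL ℝ (Du (closure Ω) u z)).hasFDerivAt.hasLineDerivAt v)
      (hasLineDerivAt_dirDeriv hΩ.isOpen (contDiffOn_interior hu) hy v)
  · refine hasLineDerivAt_sub (hasLineDerivAt_zero_of_eventuallyEq_const
      (Filter.Eventually.of_forall fun _ => rfl)) ?_
    rw [← dirDeriv_dirDeriv_eq_inner hΩ hu hz]
    exact hasLineDerivAt_dirDeriv hΩ.isOpen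
      (contDiffOn_dirDeriv hΩ.isOpen (contDiffOn_interior hu) v) hz v

/-- An orthonormal eigenbasis of the Hessian. -/
theorem exists_eigenbasis {x : EuclideanSpace ℝ (Fin n)} (hx : x ∈ closure Ω) :
    ∃ (b : OrthonormalBasis (Fin n) ℝ (EuclideanSpace ℝ (Fin n))) (l : Fin n → ℝ),
      (∀ i, hessOp (closure Ω) u x (b i) = l i • b i) ∧ (∀ i, 0 < l i) ∧ ∏ i, l i = 1 := by
  have hs : (hessOp (closure Ω) u x).toLinearMap.IsSymmetric := hessOp_symm hΩ hu hx
  have hfr : Module.finrank ℝ (EuclideanSpace ℝ (Fin n)) = n := by simp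
  set b := hs.eigenvectorBasis hfr
  have hb : ∀ i, hessOp (closure Ω) u x (b i) = hs.eigenvalues hfr i • b i :=
    hs.apply_eigenvectorBasis hfr
  have hprod : ∏ i, hs.eigenvalues hfr i = 1 := by
    rw [← det_hessOp hΩ hu hx, ← LinearMap.det_toMatrix b.toBasis, ← Matrix.det_diagonal]
    congr 1
    ext i j
    rw [LinearMap.toMatrix_apply]
    simp only [OrthonormalBasis.coe_toBasis, ContinuousLinearMap.coe_coe, hb]
    simp [Matrix.diagonal_apply, OrthonormalBasis.repr_self]
    aesop
  refine ⟨b, hs.eigenvalues hfr, hb, fun i => ?_, hprod⟩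
  have h1 := hessOp_nonneg hΩ hu hx (b i)
  rw [hb, inner_smul_left] at h1
  have h2 : 0 ≤ hs.eigenvalues hfr i := by simpa using h1
  refine lt_of_le_of_ne h2 fun h0 => ?_
  rw [Finset.prod_eq_zero (Finset.mem_univ i) h0.symm] at hprod
  exact zero_ne_one hprod

/-- Nonnegative eigenvalues with product 1 are positive, at boundary points too. -/
theorem hessOp_pos {x : EuclideanSpace ℝ (Fin n)} (hx : x ∈ closure Ω)
    {v : EuclideanSpace ℝ (Fin n)} (hv : v ≠ 0) : 0 < ⟪hessOp (closure Ω) u x v, v⟫ := by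
  obtain ⟨b, l, hb, hl, -⟩ := exists_eigenbasis hΩ hu hx
  have h : ⟪hessOp (closure Ω) u x v, v⟫ = ∑ i, l i * ⟪b i, v⟫ ^ 2 := by
    rw [← b.sum_inner_mul_inner]
    refine Finset.sum_congr rfl fun i _ => ?_
    rw [hessOp_symm hΩ hu hx, hb, inner_smul_right, real_inner_comm]
    ring
  rw [h]
  obtain ⟨i, hi⟩ : ∃ i, ⟪b i, v⟫ ≠ 0 := by
    by_contra! h0
    exact hv (by rw [← b.sum_repr' v]; simp [h0])
  exact Finset.sum_pos' (fun i _ => mul_nonneg (hl i).le (sq_nonneg _))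
    ⟨i, Finset.mem_univ i, mul_pos (hl i) (by positivity)⟩

end Regularity

/-- For determinant 1 the adjugate is the inverse, so the sum is ⟨A⁻¹g, g⟩ in every orthonormal
basis. This allows passage from the standard coordinates to an eigenframe. -/
theorem sum_adjugate_toMatrix (b : OrthonormalBasis (Fin n) ℝ (EuclideanSpace ℝ (Fin n)))
    {A : EuclideanSpace ℝ (Fin n) →ₗ[ℝ] EuclideanSpace ℝ (Fin n)} (hA : LinearMap.det A = 1)
    {g ξ : EuclideanSpace ℝ (Fin n)} (hξ : A ξ = g) :
    ∑ k, (∑ m, (LinearMap.toMatrix b.toBasis b.toBasis A).adjugate k m * ⟪g, b m⟫) * ⟪g, b k⟫ =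
      ⟪ξ, g⟫ := by
  have h1 : ∀ v k, b.toBasis.repr v k = ⟪v, b k⟫ := fun v k => by
    rw [real_inner_comm, ← b.repr_apply_apply]
    rfl
  have h2 := LinearMap.toMatrix_mulVec_repr b.toBasis b.toBasis A ξ
  rw [hξ] at h2
  have h3 : (LinearMap.toMatrix b.toBasis b.toBasis A).adjugate.mulVec (b.toBasis.repr g) =
      b.toBasis.repr ξ := by
    rw [← h2, Matrix.mulVec_mulVec, Matrix.adjugate_mul, LinearMap.det_toMatrix, hA, one_smul,
      Matrix.one_mulVec]
  have h4 : ∀ k, ∑ m, (LinearMap.toMatrix b.toBasis b.toBasis A).adjugate k m * ⟪g, b m⟫ =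
      ⟪ξ, b k⟫ := fun k => by
    rw [← h1, ← h3, Matrix.mulVec, dotProduct]
    exact Finset.sum_congr rfl fun m _ => by rw [h1]
  simp only [h4]
  rw [← b.sum_inner_mul_inner ξ g]
  exact Finset.sum_congr rfl fun k _ => by rw [real_inner_comm g]

/-- The right side does not involve the basis, which frees the σ₂ expression from the standard
coordinates. -/
theorem sum_trace_sub (b : OrthonormalBasis (Fin n) ℝ (EuclideanSpace ℝ (Fin n)))
    (A : EuclideanSpace ℝ (Fin n) →L[ℝ] EuclideanSpace ℝ (Fin n))
    (g : EuclideanSpace ℝ (Fin n)) :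
    ∑ k, ∑ m, (⟪A (b k), b k⟫ * (⟪g, b m⟫ * ⟪g, b m⟫) -
      ⟪A (b m), b k⟫ * (⟪g, b k⟫ * ⟪g, b m⟫)) =
      LinearMap.trace ℝ _ A.toLinearMap * ‖g‖ ^ 2 - ⟪A g, g⟫ := by
  have h1 : LinearMap.trace ℝ _ A.toLinearMap = ∑ k, ⟪A (b k), b k⟫ := by
    rw [A.toLinearMap.trace_eq_sum_inner b]
    exact Finset.sum_congr rfl fun k _ => real_inner_comm _ _
  have h2 : ‖g‖ ^ 2 = ∑ m, ⟪g, b m⟫ * ⟪g, b m⟫ := by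
    rw [← real_inner_self_eq_norm_sq, ← b.sum_inner_mul_inner]
    exact Finset.sum_congr rfl fun k _ => by rw [real_inner_comm g]
  have h3 : ⟪A g, g⟫ = ∑ k, ∑ m, ⟪A (b m), b k⟫ * (⟪g, b k⟫ * ⟪g, b m⟫) := by
    rw [← b.sum_inner_mul_inner]
    refine Finset.sum_congr rfl fun k _ => ?_
    have : A g = ∑ m, ⟪g, b m⟫ • A (b m) := by
      conv_lhs => rw [← b.sum_repr' g]
      simp [map_sum, real_inner_comm]
    rw [this, sum_inner, Finset.sum_mul]
    refine Finset.sum_congr rfl fun m _ => ?_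
    rw [real_inner_smul_left, real_inner_comm g]
    ring
  rw [h1, h2, h3, Finset.sum_mul_sum, ← Finset.sum_sub_distrib]
  exact Finset.sum_congr rfl fun k _ => by rw [← Finset.sum_sub_distrib]

/-! ### The numerators of K and H in invariant form -/

section Frames

variable {Ω : Set (EuclideanSpace ℝ (Fin n))} (hΩ : IsSmoothStrictlyConvexDomain Ω)
  {u : EuclideanSpace ℝ (Fin n) → ℝ} (hu : IsSolution Ω u)

theorem sigmaForm_self_eq_sum (x : EuclideanSpace ℝ (Fin n)) :
    sigmaForm (closure Ω) u n x = ∑ k, (∑ m, (hessian (closure Ω) u x).adjugate k m *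
      Du (closure Ω) u x m) * Du (closure Ω) u x k := by
  rw [sigmaForm, Finset.sum_comm]
  refine Finset.sum_congr rfl fun k _ => ?_
  rw [Finset.sum_mul]
  refine Finset.sum_congr rfl fun m _ => ?_
  rw [sigmaDeriv_self]

theorem sigmaForm_two_eq_sum (x : EuclideanSpace ℝ (Fin n)) :
    sigmaForm (closure Ω) u 2 x = ∑ k, ∑ m, (hessian (closure Ω) u x k k *
      (Du (closure Ω) u x m * Du (closure Ω) u x m) - hessian (closure Ω) u x k m *
      (Du (closure Ω) u x k * Du (closure Ω) u x m)) := by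
  have h1 : sigmaForm (closure Ω) u 2 x = (hessian (closure Ω) u x).trace *
      (∑ m, Du (closure Ω) u x m * Du (closure Ω) u x m) -
      ∑ k, ∑ m, hessian (closure Ω) u x m k *
      (Du (closure Ω) u x k * Du (closure Ω) u x m) := by
    simp only [sigmaForm, sigmaDeriv_two, sub_mul, ite_mul, zero_mul, Finset.sum_sub_distrib,
      Finset.sum_ite_eq, Finset.mem_univ, if_true, Finset.mul_sum, mul_assoc]
  rw [h1, Matrix.trace, Finset.sum_mul_sum, Finset.sum_comm (f := fun k m => 
    hessian (closure Ω) u x m k * (Du (closure Ω) u x k * Du (closure Ω) u x m)),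
    ← Finset.sum_sub_distrib]
  refine Finset.sum_congr rfl fun k _ => ?_
  rw [← Finset.sum_sub_distrib]
  refine Finset.sum_congr rfl fun m _ => ?_
  rw [Matrix.diag_apply]
  ring

theorem sigmaForm_two (x : EuclideanSpace ℝ (Fin n)) :
    sigmaForm (closure Ω) u 2 x = LinearMap.trace ℝ _ (hessOp (closure Ω) u x).toLinearMap *
      ‖Du (closure Ω) u x‖ ^ 2 - ⟪hessOp (closure Ω) u x (Du (closure Ω) u x),
        Du (closure Ω) u x⟫ := by
  rw [sigmaForm_two_eq_sum]
  have h := sum_trace_sub (EuclideanSpace.basisFun (Fin n) ℝ)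
    (hessOp (closure Ω) u x) (Du (closure Ω) u x)
  rw [← h]
  simp [hessian, EuclideanSpace.inner_single_right]

include hΩ hu

theorem sigmaForm_self {x ξ : EuclideanSpace ℝ (Fin n)} (hx : x ∈ closure Ω)
    (hξ : hessOp (closure Ω) u x ξ = Du (closure Ω) u x) :
    sigmaForm (closure Ω) u n x = ⟪ξ, Du (closure Ω) u x⟫ := by
  rw [sigmaForm_self_eq_sum, ← sum_adjugate_toMatrix (EuclideanSpace.basisFun (Fin n) ℝ)
    (det_hessOp hΩ hu hx) hξ, hessian_eq_toMatrix]
  simp [EuclideanSpace.inner_single_right]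

theorem exists_hessOp_eq {x : EuclideanSpace ℝ (Fin n)} (hx : x ∈ closure Ω)
    (g : EuclideanSpace ℝ (Fin n)) : ∃ ξ, hessOp (closure Ω) u x ξ = g := by
  have hinj : Function.Injective (hessOp (closure Ω) u x).toLinearMap := by
    rw [← LinearMap.ker_eq_bot, LinearMap.ker_eq_bot']
    intro v hv
    by_contra h0
    have := hessOp_pos hΩ hu hx h0
    rw [show hessOp (closure Ω) u x v = 0 from hv, inner_zero_left] at this
    exact lt_irrefl _ this
  exact LinearMap.injective_iff_surjective.mp hinj g

theorem sigmaForm_self_nonneg {x : EuclideanSpace ℝ (Fin n)} (hx : x ∈ closure Ω) :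
    0 ≤ sigmaForm (closure Ω) u n x := by
  obtain ⟨ξ, hξ⟩ := exists_hessOp_eq hΩ hu hx (Du (closure Ω) u x)
  rw [sigmaForm_self hΩ hu hx hξ, ← hξ, real_inner_comm]
  exact hessOp_nonneg hΩ hu hx ξ

/-- In an eigenbasis the form is Σ λ_k(|Du|² − ⟨Du, b_k⟩²). -/
theorem sigmaForm_two_nonneg {x : EuclideanSpace ℝ (Fin n)} (hx : x ∈ closure Ω) :
    0 ≤ sigmaForm (closure Ω) u 2 x := by
  obtain ⟨b, l, hb, hl, -⟩ := exists_eigenbasis hΩ hu hx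
  rw [sigmaForm_two, ← sum_trace_sub b]
  refine Finset.sum_nonneg fun k _ => ?_
  simp only [hb, real_inner_smul_left,
    orthonormal_iff_ite.mp b.orthonormal, Finset.sum_sub_distrib, if_true, mul_one, mul_ite,
    mul_zero, ite_mul, zero_mul, Finset.sum_ite_eq', Finset.mem_univ, ← Finset.mul_sum]
  rw [← mul_sub]
  refine mul_nonneg (hl k).le (sub_nonneg.mpr ?_)
  exact Finset.single_le_sum (f := fun m => ⟪Du (closure Ω) u x, b m⟫ * ⟪Du (closure Ω) u x, b m⟫)
    (fun m _ => mul_self_nonneg _) (Finset.mem_univ k)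

theorem frameD1_eq (b : OrthonormalBasis (Fin n) ℝ (EuclideanSpace ℝ (Fin n))) (i : Fin n) :
    EqOn (frameD1 b u i) (fun x => ⟪Du (closure Ω) u x, b i⟫) Ω :=
  dirDeriv_eq_inner hΩ hu _

theorem frameD2_eq (b : OrthonormalBasis (Fin n) ℝ (EuclideanSpace ℝ (Fin n))) (i j : Fin n) :
    EqOn (frameD2 b u i j) (fun x => ⟪hessOp (closure Ω) u x (b j), b i⟫) Ω :=
  fun _ hx => dirDeriv_dirDeriv_eq_inner hΩ hu hx _ _

theorem frameHess_eq (b : OrthonormalBasis (Fin n) ℝ (EuclideanSpace ℝ (Fin n)))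
    {x : EuclideanSpace ℝ (Fin n)} (hx : x ∈ Ω) :
    frameHess b u x =
      LinearMap.toMatrix b.toBasis b.toBasis (hessOp (closure Ω) u x).toLinearMap := by
  ext i j
  rw [frameHess, Matrix.of_apply, frameD2_eq hΩ hu b i j hx, LinearMap.toMatrix_apply]
  simp [real_inner_comm, b.repr_apply_apply]

/-- At each interior point there is an orthonormal frame that diagonalizes the Hessian. -/
theorem exists_frame {x : EuclideanSpace ℝ (Fin n)} (hx : x ∈ Ω) :
    ∃ (b : OrthonormalBasis (Fin n) ℝ (EuclideanSpace ℝ (Fin n))) (l : Fin n → ℝ),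
      (∀ y ∈ Ω, (frameHess b u y).det = 1) ∧ (∀ i, 0 < l i) ∧
      ∀ i j, frameD2 b u i j x = if i = j then l i else 0 := by
  obtain ⟨b, l, hb, hl, -⟩ := exists_eigenbasis hΩ hu (subset_closure hx)
  refine ⟨b, l, fun y hy => ?_, hl, fun i j => ?_⟩
  · rw [frameHess_eq hΩ hu b hy, LinearMap.det_toMatrix, det_hessOp hΩ hu (subset_closure hy)]
  · rw [frameD2_eq hΩ hu b i j hx]
    simp only [hb, real_inner_smul_left, orthonormal_iff_ite.mp b.orthonormal]
    by_cases h : i = j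
    · simp [h]
    · simp [h, Ne.symm h]

theorem not_isLocalMax_norm_sq_Du (hn : 0 < n) {s : ℝ} (hs : s < 1)
    {x : EuclideanSpace ℝ (Fin n)} (hx : x ∈ Ω) :
    ¬ IsLocalMax (fun y => ‖Du (closure Ω) u y‖ ^ 2 - 2 * s * u y) x := by
  obtain ⟨b, l, hdet, hl, hd⟩ := exists_frame hΩ hu hx
  intro h
  refine not_isLocalMax_normSq hΩ.isOpen (contDiffOn_interior hu) hdet hx hl hd hn hs ?_
  refine h.congr ?_
  filter_upwards [hΩ.isOpen.mem_nhds hx] with y hy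
  simp only [frameD1_eq hΩ hu b _ hy]
  rw [← real_inner_self_eq_norm_sq, ← b.sum_inner_mul_inner]
  congr 1
  exact Finset.sum_congr rfl fun k _ => by rw [real_inner_comm (b k)]

theorem not_isLocalMax_sigmaForm_two (hn : 2 ≤ n) {x : EuclideanSpace ℝ (Fin n)} (hx : x ∈ Ω) :
    ¬ IsLocalMax (sigmaForm (closure Ω) u 2) x := by
  obtain ⟨b, l, hdet, hl, hd⟩ := exists_frame hΩ hu hx
  intro h
  refine not_isLocalMax_sigma_two hΩ.isOpen (contDiffOn_interior hu) hdet hx hl hd hn ?_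
  refine h.congr ?_
  filter_upwards [hΩ.isOpen.mem_nhds hx] with y hy
  rw [sigmaForm_two, ← sum_trace_sub b]
  simp only [frameD1_eq hΩ hu b _ hy, frameD2_eq hΩ hu b _ _ hy]

theorem not_isLocalMax_sigmaForm_self (hn : 0 < n) {x : EuclideanSpace ℝ (Fin n)} (hx : x ∈ Ω) :
    ¬ IsLocalMax (sigmaForm (closure Ω) u n) x := by
  obtain ⟨b, l, hdet, hl, hd⟩ := exists_frame hΩ hu hx
  intro h
  refine not_isLocalMax_inverse_form hΩ.isOpen (contDiffOn_interior hu) hdet hx hl hd hn ?_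
  refine h.congr ?_
  filter_upwards [hΩ.isOpen.mem_nhds hx] with y hy
  have hy' := subset_closure hy
  obtain ⟨ξ, hξ⟩ := exists_hessOp_eq hΩ hu hy' (Du (closure Ω) u y)
  rw [sigmaForm_self hΩ hu hy' hξ, ← sum_adjugate_toMatrix b (det_hessOp hΩ hu hy') hξ]
  simp only [frameD1_eq hΩ hu b _ hy, frameHess_eq hΩ hu b hy]

theorem continuousOn_hessian : ContinuousOn (hessian (closure Ω) u) (closure Ω) := by
  refine continuousOn_pi.mpr fun i => continuousOn_pi.mpr fun j => ?_
  have : ContinuousOn (fun x => hessOp (closure Ω) u x (EuclideanSpace.single j 1))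
    (closure Ω) := (continuousOn_hessOp hΩ hu).clm_apply continuousOn_const
  exact (EuclideanSpace.proj (𝕜 := ℝ) i).continuous.comp_continuousOn this

theorem continuousOn_Du_apply (i : Fin n) :
    ContinuousOn (fun x => Du (closure Ω) u x i) (closure Ω) :=
  (EuclideanSpace.proj (𝕜 := ℝ) i).continuous.comp_continuousOn (continuousOn_Du hΩ hu)

theorem continuousOn_sigmaForm_self : ContinuousOn (sigmaForm (closure Ω) u n) (closure Ω) := by
  have h1 := continuousOn_Du_apply hΩ hu
  have h2 : ContinuousOn (fun x => (hessian (closure Ω) u x).adjugate) (closure Ω) :=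
    continuous_id.matrix_adjugate.comp_continuousOn (continuousOn_hessian hΩ hu)
  have h3 := fun k m => continuousOn_pi.mp (continuousOn_pi.mp h2 k) m
  refine ContinuousOn.congr ?_ fun x _ => sigmaForm_self_eq_sum x
  exact continuousOn_finsetSum _ fun k _ => (continuousOn_finsetSum _ fun m _ =>
    (h3 k m).mul (h1 m)).mul (h1 k)

theorem continuousOn_sigmaForm_two : ContinuousOn (sigmaForm (closure Ω) u 2) (closure Ω) := by
  have h1 := continuousOn_Du_apply hΩ hu
  have h3 := fun k m => continuousOn_pi.mp (continuousOn_pi.mp (continuousOn_hessian hΩ hu) k) m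
  refine ContinuousOn.congr ?_ fun x _ => sigmaForm_two_eq_sum x
  exact continuousOn_finsetSum _ fun k _ => continuousOn_finsetSum _ fun m _ =>
    ((h3 k k).mul ((h1 m).mul (h1 m))).sub ((h3 k m).mul ((h1 k).mul (h1 m)))

omit hΩ hu in
theorem sigmaForm_eq_zero {x : EuclideanSpace ℝ (Fin n)} (h : Du (closure Ω) u x = 0) (m : ℕ) :
    sigmaForm (closure Ω) u m x = 0 := by
  simp [sigmaForm, h]

omit hΩ hu in
-- At the critical point both sides are 0 because division by zero gives 0, which matches the
-- convention in the statement.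
theorem gaussCurvature_mul (x : EuclideanSpace ℝ (Fin n)) :
    gaussCurvature (closure Ω) u x * ‖Du (closure Ω) u x‖ ^ (n + 1) =
      sigmaForm (closure Ω) u n x := by
  rw [gaussCurvature]
  by_cases h : Du (closure Ω) u x = 0
  · rw [sigmaForm_eq_zero h, zero_div, zero_mul]
  · exact div_mul_cancel₀ _ (by positivity)

omit hΩ hu in
theorem meanCurvature_mul (x : EuclideanSpace ℝ (Fin n)) :
    meanCurvature (closure Ω) u x * ‖Du (closure Ω) u x‖ ^ 3 =
      sigmaForm (closure Ω) u 2 x := by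
  rw [meanCurvature]
  by_cases h : Du (closure Ω) u x = 0
  · rw [sigmaForm_eq_zero h, zero_div, zero_mul]
  · exact div_mul_cancel₀ _ (by positivity)

theorem attainsMax_sigmaForm_self (hn : 2 ≤ n) :
    AttainsMaxOnlyOnBoundary Ω (sigmaForm (closure Ω) u n) :=
  attainsMaxOnlyOnBoundary_of_not_isLocalMax hΩ (continuousOn_sigmaForm_self hΩ hu)
    fun _ hx => not_isLocalMax_sigmaForm_self hΩ hu (by omega) hx

theorem attainsMax_sigmaForm_two (hn : 2 ≤ n) :
    AttainsMaxOnlyOnBoundary Ω (sigmaForm (closure Ω) u 2) :=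
  attainsMaxOnlyOnBoundary_of_not_isLocalMax hΩ (continuousOn_sigmaForm_two hΩ hu)
    fun _ hx => not_isLocalMax_sigmaForm_two hΩ hu hn hx

theorem attainsMax_norm_sq_Du (hn : 2 ≤ n) {s : ℝ} (hs : s < 1) :
    AttainsMaxOnlyOnBoundary Ω (fun y => ‖Du (closure Ω) u y‖ ^ 2 - 2 * s * u y) :=
  attainsMaxOnlyOnBoundary_of_not_isLocalMax hΩ
    (((continuousOn_Du hΩ hu).norm.pow 2).sub (continuousOn_const.mul hu.smooth.continuousOn))
    fun _ hx => not_isLocalMax_norm_sq_Du hΩ hu (by omega) hs hx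

end Frames

/-- Farkas' lemma for one half-space: a functional that is nonpositive on an open half-space is a
nonnegative multiple of the functional defining it. Approximation gives the closed half-space, and
v, −v together give the hyperplane. -/
theorem exists_smul_eq_of_inner_neg {F : Type*} [NormedAddCommGroup F] [InnerProductSpace ℝ F]
    {g p : F} (hg : g ≠ 0) (h : ∀ v, ⟪g, v⟫ < 0 → ⟪p, v⟫ ≤ 0) : ∃ s : ℝ, 0 ≤ s ∧ p = s • g := by
  have hgg : 0 < ⟪g, g⟫ := real_inner_self_pos.mpr hg
  have h' : ∀ v, ⟪g, v⟫ ≤ 0 → ⟪p, v⟫ ≤ 0 := by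
    intro v hv
    have h1 : ∀ t ∈ Ioi (0 : ℝ), ⟪p, v - t • g⟫ ≤ 0 := fun t ht => by
      refine h _ ?_
      rw [inner_sub_right, real_inner_smul_right]
      have := mul_pos (mem_Ioi.mp ht) hgg
      linarith
    have h2 := le_on_closure h1 (f := fun t : ℝ => ⟪p, v - t • g⟫) (g := fun _ => 0)
      (by fun_prop) (by fun_prop) (x := 0) (by simp)
    simpa using h2
  have h0 : ∀ v, ⟪g, v⟫ = 0 → ⟪p, v⟫ = 0 := fun v hv => by
    have h1 := h' v hv.le
    have h2 := h' (-v) (by rw [inner_neg_right, hv, neg_zero])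
    rw [inner_neg_right] at h2
    linarith
  refine ⟨⟪p, g⟫ / ⟪g, g⟫, div_nonneg ?_ hgg.le, ?_⟩
  · have := h' (-g) (by rw [inner_neg_right]; linarith)
    rw [inner_neg_right] at this
    linarith
  · set s := ⟪p, g⟫ / ⟪g, g⟫ with hs
    have h1 : ⟪g, p - s • g⟫ = 0 := by
      rw [inner_sub_right, real_inner_smul_right, hs, div_mul_cancel₀ _ hgg.ne', real_inner_comm,
        sub_self]
    have h2 : ⟪p - s • g, p - s • g⟫ = 0 := by
      rw [inner_sub_left, real_inner_smul_left, h1, h0 _ h1]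
      simp
    exact sub_eq_zero.mp (inner_self_eq_zero.mp h2)

/-! ### Principal curvatures as extreme values of the normal curvature -/

section SelfAdjoint

variable {F : Type*} [NormedAddCommGroup F] [InnerProductSpace ℝ F] [FiniteDimensional ℝ F]
  [Nontrivial F] {T : Module.End ℝ F} (hT : T.IsSymmetric)
include hT

omit [Nontrivial F] in
theorem inner_apply_eq_sum_eigenvalues (v : F) : ⟪T v, v⟫ =
    ∑ i, hT.eigenvalues rfl i * ⟪hT.eigenvectorBasis rfl i, v⟫ ^ 2 := by
  rw [← (hT.eigenvectorBasis rfl).sum_inner_mul_inner]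
  refine Finset.sum_congr rfl fun i _ => ?_
  rw [hT, hT.apply_eigenvectorBasis, real_inner_smul_right, real_inner_comm v]
  simp only [RCLike.ofReal_real_eq_id, id]
  ring

omit [Nontrivial F] in
theorem norm_sq_eq_sum_eigenvectorBasis (v : F) : ‖v‖ ^ 2 =
    ∑ i, ⟪hT.eigenvectorBasis rfl i, v⟫ ^ 2 := by
  rw [← real_inner_self_eq_norm_sq, ← (hT.eigenvectorBasis rfl).sum_inner_mul_inner]
  refine Finset.sum_congr rfl fun i _ => ?_
  rw [real_inner_comm v]
  ring

theorem nonempty_eigenvalues : {κ | T.HasEigenvalue κ}.Nonempty :=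
  ⟨_, hT.hasEigenvalue_eigenvalues rfl ⟨0, Module.finrank_pos⟩⟩

omit [Nontrivial F] in
theorem inner_apply_le_sSup (v : F) :
    ⟪T v, v⟫ ≤ sSup {κ | T.HasEigenvalue κ} * ‖v‖ ^ 2 := by
  rw [inner_apply_eq_sum_eigenvalues hT, norm_sq_eq_sum_eigenvectorBasis hT, Finset.mul_sum]
  exact Finset.sum_le_sum fun i _ => mul_le_mul_of_nonneg_right
    (le_csSup T.finite_hasEigenvalue.bddAbove (hT.hasEigenvalue_eigenvalues rfl i)) (sq_nonneg _)

omit [Nontrivial F] in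
theorem sInf_le_inner_apply (v : F) :
    sInf {κ | T.HasEigenvalue κ} * ‖v‖ ^ 2 ≤ ⟪T v, v⟫ := by
  rw [inner_apply_eq_sum_eigenvalues hT, norm_sq_eq_sum_eigenvectorBasis hT, Finset.mul_sum]
  exact Finset.sum_le_sum fun i _ => mul_le_mul_of_nonneg_right
    (csInf_le T.finite_hasEigenvalue.bddBelow (hT.hasEigenvalue_eigenvalues rfl i)) (sq_nonneg _)

omit [FiniteDimensional ℝ F] [Nontrivial F] hT in
theorem exists_unit_of_hasEigenvalue {κ : ℝ} (h : T.HasEigenvalue κ) :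
    ∃ v, ‖v‖ = 1 ∧ ⟪T v, v⟫ = κ := by
  obtain ⟨v, hv⟩ := h.exists_hasEigenvector
  have hv0 : ‖v‖ ≠ 0 := norm_ne_zero_iff.mpr hv.2
  refine ⟨‖v‖⁻¹ • v, by rw [norm_smul, norm_inv, norm_norm, inv_mul_cancel₀ hv0], ?_⟩
  rw [map_smul, hv.apply_eq_smul, real_inner_smul_left, real_inner_smul_left,
    real_inner_smul_right, real_inner_self_eq_norm_sq]
  field_simp

theorem exists_unit_eq_sSup : ∃ v, ‖v‖ = 1 ∧ ⟪T v, v⟫ = sSup {κ | T.HasEigenvalue κ} :=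
  exists_unit_of_hasEigenvalue ((nonempty_eigenvalues hT).csSup_mem T.finite_hasEigenvalue)

theorem exists_unit_eq_sInf : ∃ v, ‖v‖ = 1 ∧ ⟪T v, v⟫ = sInf {κ | T.HasEigenvalue κ} :=
  exists_unit_of_hasEigenvalue ((nonempty_eigenvalues hT).csInf_mem T.finite_hasEigenvalue)

end SelfAdjoint

/-- Ensures that the shape operator has an eigenvalue, so `kappaMin` and `kappaMax` are attained and
not the default value of `sInf` or `sSup` on the empty set. -/
theorem nontrivial_levelTangent (hn : 2 ≤ n) (S : Set (EuclideanSpace ℝ (Fin n)))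
    (u : EuclideanSpace ℝ (Fin n) → ℝ) (x : EuclideanSpace ℝ (Fin n)) :
    Nontrivial (levelTangent S u x) := by
  rw [Submodule.nontrivial_iff_ne_bot]
  intro h
  have h1 := (ℝ ∙ Du S u x).finrank_add_finrank_orthogonal
  have h2 : Module.finrank ℝ (ℝ ∙ Du S u x) ≤ 1 := by
    simpa using finrank_span_le_card (R := ℝ) ({Du S u x} : Set (EuclideanSpace ℝ (Fin n)))
  rw [show (ℝ ∙ Du S u x)ᗮ = ⊥ from h, finrank_bot, finrank_euclideanSpace_fin] at h1
  omega

theorem inner_shapeOperator (S : Set (EuclideanSpace ℝ (Fin n)))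
    (u : EuclideanSpace ℝ (Fin n) → ℝ) (x : EuclideanSpace ℝ (Fin n))
    (v w : levelTangent S u x) :
    ⟪shapeOperator S u x v, w⟫ = ‖Du S u x‖⁻¹ * ⟪hessOp S u x v, (w : EuclideanSpace ℝ (Fin n))⟫ := by
  rw [shapeOperator, LinearMap.smul_apply, real_inner_smul_left]
  congr 1
  exact Submodule.inner_orthogonalProjectionOnto_eq_of_mem_right w _

section Curvature

variable {Ω : Set (EuclideanSpace ℝ (Fin n))} (hΩ : IsSmoothStrictlyConvexDomain Ω)
  {u : EuclideanSpace ℝ (Fin n) → ℝ} (hu : IsSolution Ω u)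
include hΩ hu

theorem shapeOperator_isSymmetric {x : EuclideanSpace ℝ (Fin n)} (hx : x ∈ closure Ω) :
    (shapeOperator (closure Ω) u x).IsSymmetric := fun v w => by
  rw [inner_shapeOperator, real_inner_comm _ v, inner_shapeOperator, hessOp_symm hΩ hu hx,
    real_inner_comm]

theorem inner_hessOp_le_kappaMax {x v : EuclideanSpace ℝ (Fin n)} (hx : x ∈ closure Ω)
    (hv : ⟪Du (closure Ω) u x, v⟫ = 0) :
    ‖Du (closure Ω) u x‖⁻¹ * ⟪hessOp (closure Ω) u x v, v⟫ ≤
      kappaMax (closure Ω) u x * ‖v‖ ^ 2 := by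
  have h := inner_apply_le_sSup (shapeOperator_isSymmetric hΩ hu hx)
    ⟨v, Submodule.mem_orthogonal_singleton_iff_inner_right.mpr hv⟩
  rwa [inner_shapeOperator] at h

theorem kappaMin_le_inner_hessOp {x v : EuclideanSpace ℝ (Fin n)} (hx : x ∈ closure Ω)
    (hv : ⟪Du (closure Ω) u x, v⟫ = 0) :
    kappaMin (closure Ω) u x * ‖v‖ ^ 2 ≤
      ‖Du (closure Ω) u x‖⁻¹ * ⟪hessOp (closure Ω) u x v, v⟫ := by
  have h := sInf_le_inner_apply (shapeOperator_isSymmetric hΩ hu hx)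
    ⟨v, Submodule.mem_orthogonal_singleton_iff_inner_right.mpr hv⟩
  rwa [inner_shapeOperator] at h

theorem exists_unit_kappaMax (hn : 2 ≤ n) {x : EuclideanSpace ℝ (Fin n)} (hx : x ∈ closure Ω) :
    ∃ v, ⟪Du (closure Ω) u x, v⟫ = 0 ∧ ‖v‖ = 1 ∧
      ‖Du (closure Ω) u x‖⁻¹ * ⟪hessOp (closure Ω) u x v, v⟫ = kappaMax (closure Ω) u x := by
  have := nontrivial_levelTangent hn (closure Ω) u x
  obtain ⟨v, hv, h⟩ := exists_unit_eq_sSup (shapeOperator_isSymmetric hΩ hu hx)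
  rw [inner_shapeOperator] at h
  exact ⟨v, Submodule.mem_orthogonal_singleton_iff_inner_right.mp v.2, hv, h⟩

theorem exists_unit_kappaMin (hn : 2 ≤ n) {x : EuclideanSpace ℝ (Fin n)} (hx : x ∈ closure Ω) :
    ∃ v, ⟪Du (closure Ω) u x, v⟫ = 0 ∧ ‖v‖ = 1 ∧
      ‖Du (closure Ω) u x‖⁻¹ * ⟪hessOp (closure Ω) u x v, v⟫ = kappaMin (closure Ω) u x := by
  have := nontrivial_levelTangent hn (closure Ω) u x
  obtain ⟨v, hv, h⟩ := exists_unit_eq_sInf (shapeOperator_isSymmetric hΩ hu hx)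
  rw [inner_shapeOperator] at h
  exact ⟨v, Submodule.mem_orthogonal_singleton_iff_inner_right.mp v.2, hv, h⟩

theorem kappaMin_pos (hn : 2 ≤ n) {x : EuclideanSpace ℝ (Fin n)} (hx : x ∈ closure Ω)
    (hx0 : Du (closure Ω) u x ≠ 0) : 0 < kappaMin (closure Ω) u x := by
  obtain ⟨v, -, hv, h⟩ := exists_unit_kappaMin hΩ hu hn hx
  rw [← h]
  exact mul_pos (inv_pos.mpr (norm_pos_iff.mpr hx0))
    (hessOp_pos hΩ hu hx (norm_ne_zero_iff.mp (by rw [hv]; exact one_ne_zero)))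

theorem kappaMax_pos (hn : 2 ≤ n) {x : EuclideanSpace ℝ (Fin n)} (hx : x ∈ closure Ω)
    (hx0 : Du (closure Ω) u x ≠ 0) : 0 < kappaMax (closure Ω) u x := by
  obtain ⟨v, -, hv, h⟩ := exists_unit_kappaMax hΩ hu hn hx
  rw [← h]
  exact mul_pos (inv_pos.mpr (norm_pos_iff.mpr hx0))
    (hessOp_pos hΩ hu hx (norm_ne_zero_iff.mp (by rw [hv]; exact one_ne_zero)))

/-- The unit tangent bundle of the level sets over a compact set is compact. -/
theorem isCompact_unitTangent {F : Set (EuclideanSpace ℝ (Fin n))} (hF : IsCompact F)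
    (hFΩ : F ⊆ closure Ω) :
    IsCompact ((F ×ˢ Metric.sphere (0 : EuclideanSpace ℝ (Fin n)) 1) ∩
      {p | ⟪Du (closure Ω) u p.1, p.2⟫ = 0}) := by
  have hK := hF.prod (isCompact_sphere (0 : EuclideanSpace ℝ (Fin n)) 1)
  have hc : ContinuousOn (fun p : EuclideanSpace ℝ (Fin n) × EuclideanSpace ℝ (Fin n) =>
      ⟪Du (closure Ω) u p.1, p.2⟫) (F ×ˢ Metric.sphere 0 1) :=
    ((continuousOn_Du hΩ hu).comp continuousOn_fst fun p hp => hFΩ hp.1).inner continuousOn_snd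
  exact hK.of_isClosed_subset (hc.preimage_isClosed_of_isClosed hK.isClosed isClosed_singleton)
    inter_subset_left

theorem continuousOn_normalCurvature {F : Set (EuclideanSpace ℝ (Fin n))} 
    (hFΩ : F ⊆ closure Ω) (h0 : ∀ x ∈ F, Du (closure Ω) u x ≠ 0) :
    ContinuousOn (fun p : EuclideanSpace ℝ (Fin n) × EuclideanSpace ℝ (Fin n) =>
      ‖Du (closure Ω) u p.1‖⁻¹ * ⟪hessOp (closure Ω) u p.1 p.2, p.2⟫)
      ((F ×ˢ Metric.sphere (0 : EuclideanSpace ℝ (Fin n)) 1) ∩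
        {p | ⟪Du (closure Ω) u p.1, p.2⟫ = 0}) := by
  refine ContinuousOn.mul (ContinuousOn.inv₀ ?_ ?_) ?_
  · exact ((continuousOn_Du hΩ hu).comp continuousOn_fst fun p hp => hFΩ hp.1.1).norm
  · exact fun p hp => norm_ne_zero_iff.mpr (h0 _ hp.1.1)
  · exact (((continuousOn_hessOp hΩ hu).comp continuousOn_fst fun p hp => hFΩ hp.1.1).clm_apply
      continuousOn_snd).inner continuousOn_snd

/-- The normal curvature is continuous on the compact unit tangent bundle over `F`, so it has a
maximum there. Continuity of `kappaMax` itself is not needed. -/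
theorem exists_kappaMax_le (hn : 2 ≤ n) {F : Set (EuclideanSpace ℝ (Fin n))} (hF : IsCompact F)
    (hne : F.Nonempty) (hFΩ : F ⊆ closure Ω) (h0 : ∀ x ∈ F, Du (closure Ω) u x ≠ 0) :
    ∃ x ∈ F, ∀ y ∈ F, kappaMax (closure Ω) u y ≤ kappaMax (closure Ω) u x := by
  have hmem : ∀ y ∈ F, ∃ p ∈ (F ×ˢ Metric.sphere (0 : EuclideanSpace ℝ (Fin n)) 1) ∩
      {p | ⟪Du (closure Ω) u p.1, p.2⟫ = 0},
      ‖Du (closure Ω) u p.1‖⁻¹ * ⟪hessOp (closure Ω) u p.1 p.2, p.2⟫ =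
        kappaMax (closure Ω) u y := fun y hy => by
    obtain ⟨v, hv0, hv1, hv⟩ := exists_unit_kappaMax hΩ hu hn (hFΩ hy)
    exact ⟨(y, v), ⟨⟨hy, by simpa using hv1⟩, hv0⟩, hv⟩
  obtain ⟨y₀, hy₀⟩ := hne
  obtain ⟨p₀, hp₀, -⟩ := hmem y₀ hy₀
  obtain ⟨p, hp, hmax⟩ := (isCompact_unitTangent hΩ hu hF hFΩ).exists_isMaxOn ⟨p₀, hp₀⟩
    (continuousOn_normalCurvature hΩ hu hFΩ h0)
  refine ⟨p.1, hp.1.1, fun y hy => ?_⟩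
  obtain ⟨q, hq, hqy⟩ := hmem y hy
  rw [← hqy]
  refine (hmax hq).trans ?_
  have := inner_hessOp_le_kappaMax hΩ hu (hFΩ hp.1.1) hp.2
  rwa [mem_sphere_zero_iff_norm.mp hp.1.2, one_pow, mul_one] at this

theorem exists_le_kappaMin (hn : 2 ≤ n) {F : Set (EuclideanSpace ℝ (Fin n))} (hF : IsCompact F)
    (hne : F.Nonempty) (hFΩ : F ⊆ closure Ω) (h0 : ∀ x ∈ F, Du (closure Ω) u x ≠ 0) :
    ∃ x ∈ F, ∀ y ∈ F, kappaMin (closure Ω) u x ≤ kappaMin (closure Ω) u y := by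
  have hmem : ∀ y ∈ F, ∃ p ∈ (F ×ˢ Metric.sphere (0 : EuclideanSpace ℝ (Fin n)) 1) ∩
      {p | ⟪Du (closure Ω) u p.1, p.2⟫ = 0},
      ‖Du (closure Ω) u p.1‖⁻¹ * ⟪hessOp (closure Ω) u p.1 p.2, p.2⟫ =
        kappaMin (closure Ω) u y := fun y hy => by
    obtain ⟨v, hv0, hv1, hv⟩ := exists_unit_kappaMin hΩ hu hn (hFΩ hy)
    exact ⟨(y, v), ⟨⟨hy, by simpa using hv1⟩, hv0⟩, hv⟩
  obtain ⟨y₀, hy₀⟩ := hne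
  obtain ⟨p₀, hp₀, -⟩ := hmem y₀ hy₀
  obtain ⟨p, hp, hmin⟩ := (isCompact_unitTangent hΩ hu hF hFΩ).exists_isMinOn ⟨p₀, hp₀⟩
    (continuousOn_normalCurvature hΩ hu hFΩ h0)
  refine ⟨p.1, hp.1.1, fun y hy => ?_⟩
  obtain ⟨q, hq, hqy⟩ := hmem y hy
  rw [← hqy]
  refine le_trans ?_ (hmin hq)
  have := kappaMin_le_inner_hessOp hΩ hu (hFΩ hp.1.1) hp.2
  rwa [mem_sphere_zero_iff_norm.mp hp.1.2, one_pow, mul_one] at this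

/-- The Hessian is positive definite, so u has no interior maximum, and its boundary values are 0.
-/
theorem neg_of_mem (hn : 0 < n) {x : EuclideanSpace ℝ (Fin n)} (hx : x ∈ Ω) : u x < 0 := by
  have h := attainsMaxOnlyOnBoundary_of_not_isLocalMax hΩ hu.smooth.continuousOn fun z hz hmax => by
    have hv : EuclideanSpace.single (⟨0, hn⟩ : Fin n) (1 : ℝ) ≠ 0 := by simp
    have h1 := hessOp_pos hΩ hu (subset_closure hz) hv
    rw [← dirDeriv_dirDeriv_eq_inner hΩ hu hz] at h1
    have h2 := second_lineDeriv_nonpos_of_isLocalMax hmax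
      (Filter.eventually_of_mem (hΩ.isOpen.mem_nhds hz) fun y hy =>
        hasLineDerivAt_dirDeriv hΩ.isOpen (contDiffOn_interior hu) hy _)
      (hasLineDerivAt_dirDeriv hΩ.isOpen (contDiffOn_dirDeriv hΩ.isOpen (contDiffOn_interior hu) _)
        hz (EuclideanSpace.single (⟨0, hn⟩ : Fin n) (1 : ℝ)))
    linarith
  obtain ⟨y, hy, -, hlt⟩ := h.exists_frontier hΩ.isOpen
  have := hlt x hx
  rwa [hu.eq_zero y hy] at this

theorem inner_Du_neg {x y : EuclideanSpace ℝ (Fin n)} (hx : x ∈ closure Ω) (hy : y ∈ closure Ω)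
    (h : u y < u x) : ⟪Du (closure Ω) u x, y - x⟫ < 0 := by
  have := gradient_ineq hΩ hu hx hy
  linarith

theorem Du_ne_zero_of_lt {x y : EuclideanSpace ℝ (Fin n)} (hx : x ∈ closure Ω)
    (hy : y ∈ closure Ω) (h : u y < u x) : Du (closure Ω) u x ≠ 0 := fun h0 => by
  have := inner_Du_neg hΩ hu hx hy h
  rw [h0, inner_zero_left] at this
  exact lt_irrefl _ this

theorem Du_ne_zero_of_mem_frontier (hn : 0 < n) {y : EuclideanSpace ℝ (Fin n)}
    (hy : y ∈ frontier Ω) : Du (closure Ω) u y ≠ 0 := by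
  obtain ⟨z, hz⟩ := hΩ.nonempty
  refine Du_ne_zero_of_lt hΩ hu (frontier_subset_closure hy) (subset_closure hz) ?_
  rw [hu.eq_zero y hy]
  exact neg_of_mem hΩ hu hn hz

/-- Directions in which `u` decreases point into the domain. -/
theorem exists_add_smul_mem (hn : 0 < n) {y v : EuclideanSpace ℝ (Fin n)} (hy : y ∈ frontier Ω)
    (hv : ⟪Du (closure Ω) u y, v⟫ < 0) : ∃ t : ℝ, 0 < t ∧ y + t • v ∈ Ω := by
  obtain ⟨U, hU, hyU, ρ, hρ, hdρ, hΩU⟩ := hΩ.smoothBoundary y hy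
  have hyc : y ∈ closure Ω := frontier_subset_closure hy
  have hdiff : DifferentiableAt ℝ ρ y :=
    (hρ.contDiffAt (hU.mem_nhds hyU)).differentiableAt (by simp)
  have hyΩ : y ∉ Ω := by
    have := hy
    rw [hΩ.frontier_eq] at this
    exact this.2
  have hρ0 : ρ y = 0 := by
    refine le_antisymm ?_ (not_lt.mp fun h => hyΩ ?_)
    · have hyc' : y ∈ closure (Ω ∩ U) := by
        rw [inter_comm]
        exact hU.inter_closure ⟨hyU, hyc⟩
      refine hdiff.continuousAt.continuousWithinAt.closure_le hyc' continuousWithinAt_const ?_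
      intro z hz
      rw [hΩU] at hz
      exact hz.2.le
    · have : y ∈ Ω ∩ U := by rw [hΩU]; exact ⟨hyU, h⟩
      exact this.1
  have key : ∀ w, fderiv ℝ ρ y w < 0 → ∃ t : ℝ, 0 < t ∧ y + t • w ∈ Ω := by
    intro w hw
    have hl : HasDerivAt (fun t : ℝ => ρ (y + t • w)) (fderiv ℝ ρ y w) 0 :=
      hdiff.hasFDerivAt.hasLineDerivAt w
    have h1 : ∀ᶠ t in 𝓝[>] (0 : ℝ), t⁻¹ • (ρ (y + t • w) - ρ y) < 0 := by
      have := hl.tendsto_slope_zero_right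
      simp only [zero_add, zero_smul, add_zero] at this
      exact this.eventually (gt_mem_nhds hw)
    have h2 : ∀ᶠ t in 𝓝[>] (0 : ℝ), y + t • w ∈ U := by
      have hc : ContinuousAt (fun t : ℝ => y + t • w) 0 := by fun_prop
      refine (hc.eventually (hU.mem_nhds (by simpa using hyU))).filter_mono nhdsWithin_le_nhds
    obtain ⟨t, ⟨ht1, ht2⟩, ht0⟩ := ((h1.and h2).and self_mem_nhdsWithin).exists
    have ht0' : (0 : ℝ) < t := ht0
    refine ⟨t, ht0', ?_⟩
    have hneg : ρ (y + t • w) < 0 := by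
      rw [hρ0, sub_zero, smul_eq_mul] at ht1
      by_contra! hcon
      have := mul_nonneg (inv_pos.mpr ht0').le hcon
      linarith
    have : y + t • w ∈ Ω ∩ U := by rw [hΩU]; exact ⟨ht2, hneg⟩
    exact this.1
  set d := (InnerProductSpace.toDual ℝ (EuclideanSpace ℝ (Fin n))).symm (fderiv ℝ ρ y) with hd
  have hdi : ∀ w, ⟪d, w⟫ = fderiv ℝ ρ y w := fun w => by
    rw [hd, InnerProductSpace.toDual_symm_apply]
  have hd0 : d ≠ 0 := fun h => hdρ (by ext w; rw [← hdi, h, inner_zero_left]; rfl)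
  -- Directions with ⟨d, w⟩ < 0 enter Ω, where u < 0, so they satisfy ⟨Du, w⟩ ≤ 0. Hence Du is a
  -- nonnegative multiple of d, and ⟨Du, v⟩ < 0 forces ⟨d, v⟩ < 0.
  obtain ⟨s, hs, hsd⟩ := exists_smul_eq_of_inner_neg (p := Du (closure Ω) u y) hd0 (by
    intro w hw
    rw [hdi] at hw
    obtain ⟨t, ht, hmem⟩ := key w hw
    have h1 := inner_Du_neg hΩ hu hyc (subset_closure hmem)
      (by rw [hu.eq_zero y hy]; exact neg_of_mem hΩ hu hn hmem)
    rw [add_sub_cancel_left, real_inner_smul_right] at h1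
    by_contra! hcon
    have := mul_pos ht hcon
    linarith)
  refine key v ?_
  rw [← hdi]
  rw [hsd, real_inner_smul_left] at hv
  by_contra! hcon
  have := mul_nonneg hs hcon
  linarith

/-! ### The upper gradient bound -/

/-- At a boundary point where `|Du|` is maximal, `|Du| κ_m ≤ 1`. -/
theorem exists_norm_Du_mul_kappaMin_le (hn : 2 ≤ n) : ∃ y ∈ frontier Ω,
    (∀ x ∈ Ω, ‖Du (closure Ω) u x‖ < ‖Du (closure Ω) u y‖) ∧
    (∀ x ∈ frontier Ω, ‖Du (closure Ω) u x‖ ≤ ‖Du (closure Ω) u y‖) ∧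
      ‖Du (closure Ω) u y‖ * kappaMin (closure Ω) u y ≤ 1 := by
  set G := Du (closure Ω) u with hG
  obtain ⟨y, hy, hmax, hlt⟩ :=
    (attainsMax_norm_sq_Du hΩ hu hn (s := 0) zero_lt_one).exists_frontier hΩ.isOpen
  simp only [mul_zero, zero_mul, sub_zero] at hmax hlt
  have hyc : y ∈ closure Ω := frontier_subset_closure hy
  refine ⟨y, hy, fun x hx => lt_of_pow_lt_pow_left₀ 2 (norm_nonneg _) (hlt x hx),
    fun x hx => le_of_sq_le_sq (hmax x (frontier_subset_closure hx)) (norm_nonneg _), ?_⟩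
  -- On ∂Ω all the functions |Du|² − 2su coincide with |Du|², since u = 0. Each attains its maximum
  -- on ∂Ω, so y maximizes all of them; the inequality is the first order condition at y. It is
  -- taken to s = 1 only afterwards.
  have hs : ∀ s ∈ Iio (1 : ℝ), ∀ x ∈ closure Ω,
      ⟪hessOp (closure Ω) u y (x - y), G y⟫ ≤ s * ⟪G y, x - y⟫ := by
    intro s hs x hx
    have hmaxs : IsMaxOn (fun z => ‖G z‖ ^ 2 - 2 * s * u z) (closure Ω) y := by
      obtain ⟨z, hz, hzmax, -⟩ :=
        (attainsMax_norm_sq_Du hΩ hu hn (s := s) hs).exists_frontier hΩ.isOpen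
      intro w hw
      have h1 := hzmax w hw
      have h2 := hmax z (frontier_subset_closure hz)
      simp only [hu.eq_zero z hz, mul_zero, sub_zero] at h1
      simp only [mem_ofPred_eq, hu.eq_zero y hy, mul_zero, sub_zero]
      exact h1.trans h2
    have hd : HasFDerivWithinAt (fun z => ‖G z‖ ^ 2 - 2 * s * u z) _ (closure Ω) y :=
      (hasFDerivWithinAt_Du hΩ hu hyc).norm_sq.sub
        ((hasFDerivWithinAt_self hu hyc).const_mul (2 * s))
    have h := hmaxs.localize.hasFDerivWithinAt_nonpos hd
      (sub_mem_posTangentConeAt_of_segment_subset (hΩ.convex.closure.segment_subset hyc hx))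
    simp at h
    rw [real_inner_comm, map_sub]
    linarith
  have h1 : ∀ x ∈ closure Ω, ⟪hessOp (closure Ω) u y (x - y), G y⟫ ≤ ⟪G y, x - y⟫ := by
    intro x hx
    have := le_on_closure (fun s hs' => hs s hs' x hx) (f := fun _ : ℝ =>
      ⟪hessOp (closure Ω) u y (x - y), G y⟫) (g := fun s : ℝ => s * ⟪G y, x - y⟫)
      continuousOn_const (by fun_prop) (x := 1) (by simp)
    simpa using this
  have hG0 : G y ≠ 0 := Du_ne_zero_of_mem_frontier hΩ hu (by omega) hy
  -- With A = D²u(y), the condition bounds ⟨AG − G, v⟩ for directions v into Ω, and by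
  -- `exists_add_smul_mem` these include the half-space ⟨G, v⟩ < 0. So AG − G is a nonnegative
  -- multiple of G.
  obtain ⟨s, hs0, hsG⟩ := exists_smul_eq_of_inner_neg
    (p := hessOp (closure Ω) u y (G y) - G y) hG0 (by
    intro v hv
    obtain ⟨t, ht, hmem⟩ := exists_add_smul_mem hΩ hu (by omega) hy hv
    have h2 := h1 _ (subset_closure hmem)
    rw [add_sub_cancel_left, hessOp_symm hΩ hu hyc, real_inner_smul_left, real_inner_smul_right,
      real_inner_comm] at h2
    rw [inner_sub_left]
    have := le_of_mul_le_mul_left h2 ht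
    linarith)
  have hAG : hessOp (closure Ω) u y (G y) = (1 + s) • G y := by
    rw [add_smul, one_smul, ← hsG]
    abel
  by_contra! hcon
  have hGn : 0 < ‖G y‖ := norm_pos_iff.mpr hG0
  have hT : ∀ v, ⟪G y, v⟫ = 0 → ‖G y‖ * kappaMin (closure Ω) u y * ‖v‖ ^ 2 ≤
      ⟪hessOp (closure Ω) u y v, v⟫ := by
    intro v hv
    have := mul_le_mul_of_nonneg_left (kappaMin_le_inner_hessOp hΩ hu hyc hv) hGn.le
    rwa [mul_inv_cancel_left₀ hGn.ne', ← mul_assoc] at this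
  -- A preserves the splitting into the span of G and its orthogonal complement. It is 1 + s ≥ 1 on
  -- the first, and at least 1 on the second by `hcon`.
  have hge : ∀ w, ‖w‖ ^ 2 ≤ ⟪hessOp (closure Ω) u y w, w⟫ := by
    intro w
    set a := ⟪G y, w⟫ / ⟪G y, G y⟫ with ha
    have hgg : ⟪G y, G y⟫ ≠ 0 := (real_inner_self_pos.mpr hG0).ne'
    have hv : ⟪G y, w - a • G y⟫ = 0 := by
      rw [inner_sub_right, real_inner_smul_right, ha, div_mul_cancel₀ _ hgg, sub_self]
    obtain ⟨v, hvw⟩ : ∃ v, v = w - a • G y := ⟨_, rfl⟩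
    rw [← hvw] at hv
    have hw : w = a • G y + v := by rw [hvw]; abel
    have h2 : ‖v‖ ^ 2 ≤ ⟪hessOp (closure Ω) u y v, v⟫ := by
      have h3 := hT v hv
      have h4 := mul_le_mul_of_nonneg_right hcon.le (sq_nonneg ‖v‖)
      linarith
    have hv' : ⟪v, G y⟫ = 0 := by rw [real_inner_comm, hv]
    have h5 : ⟪hessOp (closure Ω) u y v, G y⟫ = 0 := by
      rw [hessOp_symm hΩ hu hyc, hAG, real_inner_smul_right, hv', mul_zero]
    have h6 : ⟪hessOp (closure Ω) u y w, w⟫ =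
        a * a * (1 + s) * ⟪G y, G y⟫ + ⟪hessOp (closure Ω) u y v, v⟫ := by
      rw [hw, map_add, map_smul, hAG]
      simp only [inner_add_left, inner_add_right, real_inner_smul_left, real_inner_smul_right, hv,
        h5]
      ring
    have h7 : ‖w‖ ^ 2 = a * a * ⟪G y, G y⟫ + ‖v‖ ^ 2 := by
      rw [← real_inner_self_eq_norm_sq, ← real_inner_self_eq_norm_sq, hw]
      simp only [inner_add_left, inner_add_right, real_inner_smul_left, real_inner_smul_right, hv,
        hv']
      ring
    rw [h6, h7]
    have h8 : 0 ≤ a * a * s * ⟪G y, G y⟫ :=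
      mul_nonneg (mul_nonneg (mul_self_nonneg _) hs0) real_inner_self_nonneg
    linarith
  obtain ⟨b, l, hb, hl, hprod⟩ := exists_eigenbasis hΩ hu hyc
  have hl1 : ∀ i, 1 ≤ l i := fun i => by
    have := hge (b i)
    rw [hb, real_inner_smul_left, real_inner_self_eq_norm_sq, b.orthonormal.1 i] at this
    simpa using this
  -- Eigenvalues that are at least 1 and have product 1 all equal 1, so A is the identity and the
  -- tangential bound `hT` contradicts `hcon`.
  have hl2 : ∀ i, l i = 1 := fun i => by
    by_contra hne
    have hlt : 1 < l i := lt_of_le_of_ne (hl1 i) (Ne.symm hne)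
    have := Finset.prod_lt_prod (f := fun _ : Fin n => (1 : ℝ)) (g := l) (s := Finset.univ)
      (fun _ _ => zero_lt_one) (fun j _ => hl1 j) ⟨i, Finset.mem_univ i, hlt⟩
    rw [hprod] at this
    simp at this
  have hid : ∀ v, hessOp (closure Ω) u y v = v := fun v => by
    conv_lhs => rw [← b.sum_repr' v]
    conv_rhs => rw [← b.sum_repr' v]
    simp [map_sum, hb, hl2]
  obtain ⟨v, hv0, hv1, -⟩ := exists_unit_kappaMin hΩ hu hn hyc
  have := hT v hv0
  rw [hid, real_inner_self_eq_norm_sq, hv1] at this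
  linarith

end Curvature

/-! ### Blaschke's rolling theorem through support functions -/

/-- A continuous function that has local affine minorants at all points of `[0, 1]` lies above the
minorant at `0`. -/
theorem add_slope_le_of_local_affine_minorant {f : ℝ → ℝ} {s : ℝ → ℝ}
    (hc : ContinuousOn f (Icc 0 1))
    (h : ∀ t ∈ Icc (0 : ℝ) 1, ∀ᶠ τ in 𝓝 t, f t + s t * (τ - t) ≤ f τ) : f 0 + s 0 ≤ f 1 := by
  by_contra! hcon
  set d := f 1 - f 0 - s 0 with hd
  have hd0 : d < 0 := by rw [hd]; linarith
  -- The tilt by d makes g vanish at both ends, while its minorant at 0 has slope −d > 0. So g has a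
  -- positive interior maximum.
  set g : ℝ → ℝ := fun t => f t - f 0 - s 0 * t - d * t with hg
  have hg0 : g 0 = 0 := by simp [hg]
  have hg1 : g 1 = 0 := by simp [hg, hd]
  have hgc : ContinuousOn g (Icc 0 1) := by fun_prop
  have hgl : ∀ t ∈ Icc (0 : ℝ) 1, ∀ᶠ τ in 𝓝 t, g t + (s t - s 0 - d) * (τ - t) ≤ g τ := by
    intro t ht
    filter_upwards [h t ht] with τ hτ
    simp only [hg]
    linarith
  obtain ⟨m, hm, hmax⟩ := isCompact_Icc.exists_isMaxOn (nonempty_Icc.mpr zero_le_one) hgc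
  have hmpos : 0 < g m := by
    have h1 : ∀ᶠ τ in 𝓝[>] (0 : ℝ), g 0 + (s 0 - s 0 - d) * (τ - 0) ≤ g τ :=
      (hgl 0 (by simp)).filter_mono nhdsWithin_le_nhds
    have h2 : ∀ᶠ τ in 𝓝[>] (0 : ℝ), τ ∈ Ioo (0 : ℝ) 1 := Ioo_mem_nhdsGT zero_lt_one
    obtain ⟨τ, hτ1, hτ2⟩ := (h1.and h2).exists
    have h3 : 0 < -d * τ := mul_pos (neg_pos.mpr hd0) hτ2.1
    have h4 : g τ ≤ g m := hmax ⟨hτ2.1.le, hτ2.2.le⟩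
    rw [hg0] at hτ1
    linarith
  set K := Icc (0 : ℝ) 1 ∩ g ⁻¹' {g m} with hK
  have hKc : IsCompact K := isCompact_Icc.of_isClosed_subset
    (hgc.preimage_isClosed_of_isClosed isClosed_Icc isClosed_singleton) inter_subset_left
  -- The leftmost maximum: points to its right force the slope of the minorant to be nonpositive,
  -- and then a point to its left is also a maximum.
  obtain ⟨a, ha⟩ := hKc.exists_isLeast ⟨m, hm, rfl⟩
  have hag : g a = g m := ha.1.2
  have ha0 : 0 < a := lt_of_le_of_ne ha.1.1.1 fun h0 => by
    rw [← h0, hg0] at hag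
    linarith
  have ha1 : a < 1 := lt_of_le_of_ne ha.1.1.2 fun h1 => by
    rw [h1, hg1] at hag
    linarith
  have hloc : ∀ᶠ τ in 𝓝 a, g a + (s a - s 0 - d) * (τ - a) ≤ g τ ∧ τ ∈ Ioo (0 : ℝ) 1 :=
    (hgl a ha.1.1).and (Ioo_mem_nhds ha0 ha1)
  have hle : ∀ τ ∈ Ioo (0 : ℝ) 1, g τ ≤ g a := fun τ hτ => by
    rw [hag]
    exact hmax ⟨hτ.1.le, hτ.2.le⟩
  obtain ⟨τ₁, ⟨h1, h1'⟩, h1''⟩ :=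
    ((hloc.filter_mono nhdsWithin_le_nhds).and (self_mem_nhdsWithin : Ioi a ∈ 𝓝[>] a)).exists
  obtain ⟨τ₂, ⟨h2, h2'⟩, h2''⟩ :=
    ((hloc.filter_mono nhdsWithin_le_nhds).and (self_mem_nhdsWithin : Iio a ∈ 𝓝[<] a)).exists
  have e1 := hle _ h1'
  have e2 := hle _ h2'
  have p1 : 0 < τ₁ - a := sub_pos.mpr h1''
  have hσ : s a - s 0 - d ≤ 0 := by
    by_contra! hpos
    have := mul_pos hpos p1
    linarith
  have h3 : g a ≤ g τ₂ := by
    have := mul_nonneg_of_nonpos_of_nonpos hσ (sub_neg.mpr h2'').le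
    linarith
  have h4 : τ₂ ∈ K := ⟨⟨h2'.1.le, h2'.2.le⟩, (le_antisymm e2 h3).trans hag⟩
  exact absurd (ha.2 h4) (not_le.mpr h2'')

section Support

variable {F : Type*} [NormedAddCommGroup F] [InnerProductSpace ℝ F]

/-- The support function of a set. -/
def supportFn (C : Set F) (p : F) : ℝ := sSup ((fun x => ⟪x, p⟫) '' C)

variable {C : Set F} (hC : IsCompact C)
include hC

theorem inner_le_supportFn {x : F} (hx : x ∈ C) (p : F) : ⟪x, p⟫ ≤ supportFn C p :=
  le_csSup (hC.image (by fun_prop)).bddAbove (mem_image_of_mem _ hx)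

theorem exists_inner_eq_supportFn (hne : C.Nonempty) (p : F) : ∃ z ∈ C, ⟪z, p⟫ = supportFn C p :=
  (hC.image (f := fun x => ⟪x, p⟫) (by fun_prop)).sSup_mem (hne.image _)

theorem continuous_supportFn : Continuous (supportFn C) :=
  hC.continuous_sSup (f := fun p x => ⟪x, p⟫) (by fun_prop)

variable {r : ℝ} (hr : 0 < r)
  (hloc : ∀ z ∈ C, ∀ p, p ≠ 0 → ⟪z, p⟫ = supportFn C p → ∃ ε > 0, ∀ y, ‖y‖ < ε →
    ‖y + r • ‖p‖⁻¹ • p‖ ≤ r → z + y ∈ C)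
include hr hloc

/-- The displacement y = r(q/|q| − p/|p|) is small for q near p and y + r p/|p| has norm r, so z + y
lies in C by the local hypothesis. Testing it against q gives a local linear minorant of h_C − r|·|,
exact at p. -/
theorem eventually_supportFn_ge {z p : F} (hz : z ∈ C) (hp : p ≠ 0)
    (hzp : ⟪z, p⟫ = supportFn C p) :
    ∀ᶠ q in 𝓝 p, ⟪z - r • ‖p‖⁻¹ • p, q⟫ ≤ supportFn C q - r * ‖q‖ := by
  obtain ⟨ε, hε, h⟩ := hloc z hz p hp hzp
  have hpn : ‖p‖ ≠ 0 := norm_ne_zero_iff.mpr hp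
  have hcont : ContinuousAt (fun q : F => ‖r • ‖q‖⁻¹ • q - r • ‖p‖⁻¹ • p‖) p := by
    have : ContinuousAt (fun q : F => ‖q‖⁻¹) p := continuous_norm.continuousAt.inv₀ hpn
    fun_prop
  have h1 : ∀ᶠ q in 𝓝 p, ‖r • ‖q‖⁻¹ • q - r • ‖p‖⁻¹ • p‖ < ε :=
    hcont.eventually (gt_mem_nhds (by simpa using hε))
  filter_upwards [h1, isOpen_ne.mem_nhds hp] with q hq hq0
  have hqn : ‖q‖ ≠ 0 := norm_ne_zero_iff.mpr hq0
  have h2 := h _ hq (by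
    rw [sub_add_cancel, norm_smul, norm_smul, norm_inv, norm_norm, inv_mul_cancel₀ hqn, mul_one,
      Real.norm_of_nonneg hr.le])
  have h3 := inner_le_supportFn hC h2 q
  rw [add_sub_left_comm, inner_add_left] at h3
  have h4 : ⟪r • ‖q‖⁻¹ • q, q⟫ = r * ‖q‖ := by
    rw [real_inner_smul_left, real_inner_smul_left, real_inner_self_eq_norm_sq]
    field_simp
  rw [h4] at h3
  linarith

omit hloc hC hr in
theorem inner_sub_normalize {z p : F} (hp : p ≠ 0) (hzp : ⟪z, p⟫ = supportFn C p) :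
    ⟪z - r • ‖p‖⁻¹ • p, p⟫ = supportFn C p - r * ‖p‖ := by
  have hpn : ‖p‖ ≠ 0 := norm_ne_zero_iff.mpr hp
  rw [inner_sub_left, real_inner_smul_left, real_inner_smul_left, real_inner_self_eq_norm_sq, hzp]
  field_simp

/-- The local minorants along the segment from p to q combine by
`add_slope_le_of_local_affine_minorant`. The segment must avoid 0, where normals are undefined. -/
theorem supportFn_ge_of_segment (hne : C.Nonempty) {z p q : F} (hz : z ∈ C) (hp : p ≠ 0)
    (hzp : ⟪z, p⟫ = supportFn C p) (hq : ∀ t ∈ Icc (0 : ℝ) 1, p + t • (q - p) ≠ 0) :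
    ⟪z - r • ‖p‖⁻¹ • p, q⟫ ≤ supportFn C q - r * ‖q‖ := by
  classical
  choose Z hZC hZ using exists_inner_eq_supportFn hC hne
  set P : ℝ → F := fun t => p + t • (q - p) with hP
  -- Support points need not be unique: any choice serves for t ≠ 0, but at t = 0 it must be the
  -- prescribed z.
  set a : ℝ → F := fun t => (if t = 0 then z else Z (P t)) - r • ‖P t‖⁻¹ • P t with ha
  have hP0 : P 0 = p := by simp [hP]
  have hP1 : P 1 = q := by simp [hP]
  have hPc : Continuous P := by fun_prop
  have hsup : ∀ t, (if t = 0 then z else Z (P t)) ∈ C ∧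
      ⟪if t = 0 then z else Z (P t), P t⟫ = supportFn C (P t) := fun t => by
    split_ifs with ht
    · rw [ht, hP0]
      exact ⟨hz, hzp⟩
    · exact ⟨hZC _, hZ _⟩
  have h := add_slope_le_of_local_affine_minorant
    (f := fun t => supportFn C (P t) - r * ‖P t‖) (s := fun t => ⟪a t, q - p⟫)
    (((continuous_supportFn hC).comp hPc).sub (by fun_prop)).continuousOn (fun t ht => by
      have h1 := hPc.continuousAt.eventually (eventually_supportFn_ge hC hr hloc (hsup t).1
        (hq t ht) (hsup t).2)
      filter_upwards [h1] with τ hτ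
      refine le_trans (le_of_eq ?_) hτ
      change supportFn C (P t) - r * ‖P t‖ + ⟪a t, q - p⟫ * (τ - t) = ⟪a t, P τ⟫
      rw [← inner_sub_normalize (p := P t) (hq t ht) (hsup t).2]
      change ⟪a t, P t⟫ + _ = _
      have : P τ = P t + (τ - t) • (q - p) := by
        simp only [hP]
        module
      rw [this, inner_add_right (a t) (P t), real_inner_smul_right]
      exact congrArg _ (mul_comm _ _))
  simp only [hP0, hP1] at h
  have ha0 : a 0 = z - r • ‖p‖⁻¹ • p := by simp [ha, hP0]
  rw [ha0, ← inner_sub_normalize (r := r) hp hzp, inner_sub_right] at h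
  linarith

variable (hdim : ∀ p : F, ∃ w, w ≠ 0 ∧ ⟪p, w⟫ = 0)
include hdim

theorem supportFn_ge (hne : C.Nonempty) {z p : F} (hz : z ∈ C) (hp : p ≠ 0)
    (hzp : ⟪z, p⟫ = supportFn C p) (q : F) :
    ⟪z - r • ‖p‖⁻¹ • p, q⟫ ≤ supportFn C q - r * ‖q‖ := by
  by_cases hq : ∀ t ∈ Icc (0 : ℝ) 1, p + t • (q - p) ≠ 0
  · exact supportFn_ge_of_segment hC hr hloc hne hz hp hzp hq
  · push Not at hq
    obtain ⟨t, -, ht⟩ := hq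
    -- If the segment meets 0, then q is a multiple of p, so q ⟂ w as well. Moving q to q + τw
    -- avoids 0, and τ → 0 gives the claim by continuity.
    obtain ⟨w, hw0, hw⟩ := hdim p
    have ht0 : t ≠ 0 := fun h0 => hp (by simpa [h0] using ht)
    have hqw : ⟪q, w⟫ = 0 := by
      have h1 : ⟪p + t • (q - p), w⟫ = 0 := by rw [ht, inner_zero_left]
      rw [inner_add_left, real_inner_smul_left, inner_sub_left, hw] at h1
      simpa [ht0] using h1
    have h1 : ∀ τ ∈ Ioi (0 : ℝ), ⟪z - r • ‖p‖⁻¹ • p, q + τ • w⟫ ≤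
        supportFn C (q + τ • w) - r * ‖q + τ • w‖ := fun τ hτ => by
      refine supportFn_ge_of_segment hC hr hloc hne hz hp hzp fun s _ hs => ?_
      have h2 : ⟪p + s • (q + τ • w - p), w⟫ = 0 := by rw [hs, inner_zero_left]
      rw [inner_add_left, real_inner_smul_left, inner_sub_left, inner_add_left,
        real_inner_smul_left, hw, hqw] at h2
      have hτ0 : τ ≠ 0 := (mem_Ioi.mp hτ).ne'
      have hs0 : s = 0 := by simpa [hτ0, hw0] using h2
      exact hp (by simpa [hs0] using hs)
    have hcs := continuous_supportFn hC
    have := le_on_closure h1 (by fun_prop) (by fun_prop) (x := 0) (by simp)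
    simpa using this

/-- Blaschke's rolling theorem: if balls of radius `r` are locally contained in the convex body at
its boundary points, then they are globally contained in it. -/
theorem closedBall_subset_of_local [CompleteSpace F] (hconv : Convex ℝ C) {z p : F} (hz : z ∈ C)
    (hp : p ≠ 0) (hzp : ⟪z, p⟫ = supportFn C p) :
    Metric.closedBall (z - r • ‖p‖⁻¹ • p) r ⊆ C := by
  intro y hy
  by_contra hyC
  -- A separating direction q would make the support function of the ball exceed that of C, contrary
  -- to `supportFn_ge`.
  obtain ⟨f, s, hf, hs⟩ := geometric_hahn_banach_closed_point hconv hC.isClosed hyC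
  set q := (InnerProductSpace.toDual ℝ F).symm f with hq
  have hfq : ∀ x, f x = ⟪x, q⟫ := fun x => by
    rw [real_inner_comm, hq, InnerProductSpace.toDual_symm_apply]
  obtain ⟨x, hx, hxq⟩ := exists_inner_eq_supportFn hC ⟨z, hz⟩ q
  have h1 := hf x hx
  rw [hfq, hxq] at h1
  rw [hfq] at hs
  have h2 := supportFn_ge hC hr hloc hdim ⟨z, hz⟩ hz hp hzp q
  have h3 : ⟪y - (z - r • ‖p‖⁻¹ • p), q⟫ ≤ r * ‖q‖ :=
    (real_inner_le_norm _ _).trans (mul_le_mul_of_nonneg_right (mem_closedBall_iff_norm.mp hy)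
      (norm_nonneg _))
  rw [inner_sub_left] at h3
  linarith

end Support

theorem exists_ne_zero_inner_eq_zero (hn : 2 ≤ n) (p : EuclideanSpace ℝ (Fin n)) :
    ∃ w, w ≠ 0 ∧ ⟪p, w⟫ = 0 := by
  have h : (ℝ ∙ p)ᗮ ≠ ⊥ := fun h => by
    have h1 := (ℝ ∙ p).finrank_add_finrank_orthogonal
    have h2 : Module.finrank ℝ (ℝ ∙ p) ≤ 1 := by
      simpa using finrank_span_le_card (R := ℝ) ({p} : Set (EuclideanSpace ℝ (Fin n)))
    rw [h, finrank_bot, finrank_euclideanSpace_fin] at h1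
    omega
  obtain ⟨w, hw, hw0⟩ := Submodule.exists_mem_ne_zero_of_ne_bot h
  exact ⟨w, hw0, Submodule.mem_orthogonal_singleton_iff_inner_right.mp hw⟩

/-! ### Local interior balls of sublevel sets -/

section Sublevel

variable {Ω : Set (EuclideanSpace ℝ (Fin n))} (hΩ : IsSmoothStrictlyConvexDomain Ω)
  {u : EuclideanSpace ℝ (Fin n) → ℝ} (hu : IsSolution Ω u)
include hΩ hu

/-- The second order Taylor bound at an interior point. -/
theorem exists_taylor_le {z : EuclideanSpace ℝ (Fin n)} (hz : z ∈ Ω) {η : ℝ} (hη : 0 < η) :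
    ∃ ε > 0, ∀ y, ‖y‖ < ε → z + y ∈ Ω ∧ u (z + y) ≤ u z + ⟪Du (closure Ω) u z, y⟫ +
      ⟪hessOp (closure Ω) u z y, y⟫ / 2 + η * ‖y‖ ^ 2 := by
  set A := hessOp (closure Ω) u z with hA
  set G := Du (closure Ω) u with hG
  have h1 : ∀ᶠ w in 𝓝 z, ‖G w - G z - A (w - z)‖ ≤ η * ‖w - z‖ :=
    (hasFDerivAt_Du hΩ hu hz).isLittleO.bound hη
  obtain ⟨ε, hε, hball⟩ := Metric.eventually_nhds_iff_ball.mp (h1.and (hΩ.isOpen.mem_nhds hz))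
  refine ⟨ε, hε, fun y hy => ?_⟩
  have hb : ∀ w, ‖w‖ ≤ ‖y‖ → ‖G (z + w) - G z - A w‖ ≤ η * ‖w‖ ∧ z + w ∈ Ω := fun w hw => by
    have := hball (z + w) (by simpa using hw.trans_lt hy)
    rwa [add_sub_cancel_left] at this
  refine ⟨(hb y le_rfl).2, ?_⟩
  -- The error of the quadratic Taylor polynomial has gradient Du(z+w) − Du(z) − Aw, of norm at most
  -- η|y| for |w| ≤ |y|. The mean value inequality turns this into η|y|².
  have hd : ∀ w ∈ Metric.closedBall (0 : EuclideanSpace ℝ (Fin n)) ‖y‖,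
      HasFDerivWithinAt (fun w => u (z + w) - ⟪G z, w⟫ - ⟪A w, w⟫ / 2)
        (innerSL ℝ (G (z + w) - G z - A w)) (Metric.closedBall 0 ‖y‖) w := by
    intro w hw
    have e1 : HasFDerivAt (fun w => u (z + w)) (innerSL ℝ (G (z + w))) w :=
      (hasFDerivAt_self hΩ hu (hb w (by simpa using hw)).2).comp w ((hasFDerivAt_id w).const_add z)
    have e2 : HasFDerivAt (fun w => ⟪G z, w⟫) (innerSL ℝ (G z)) w := (innerSL ℝ (G z)).hasFDerivAt
    have e3 := (A.hasFDerivAt (x := w)).inner ℝ (hasFDerivAt_id w)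
    have e4 := (e1.sub e2).sub (e3.mul_const (2⁻¹ : ℝ))
    refine (e4.congr_fderiv ?_).hasFDerivWithinAt
    ext v
    have : ⟪A v, w⟫ = ⟪A w, v⟫ := by
      rw [hessOp_symm hΩ hu (subset_closure hz), real_inner_comm]
    simp [this]
    ring
  have hbound : ∀ w ∈ Metric.closedBall (0 : EuclideanSpace ℝ (Fin n)) ‖y‖,
      ‖innerSL ℝ (G (z + w) - G z - A w)‖ ≤ η * ‖y‖ := fun w hw => by
    rw [innerSL_apply_norm]
    have hw' : ‖w‖ ≤ ‖y‖ := by simpa using hw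
    exact (hb w hw').1.trans (mul_le_mul_of_nonneg_left hw' hη.le)
  have h2 := (convex_closedBall (0 : EuclideanSpace ℝ (Fin n)) ‖y‖).norm_image_sub_le_of_norm_hasFDerivWithin_le
    hd hbound (x := 0) (y := y) (by simp) (by simp)
  have h3 := (le_abs_self _).trans h2
  simp only [add_zero, inner_zero_right, zero_div, sub_zero] at h3
  rw [pow_two, ← mul_assoc]
  linarith

/-- Inner balls of radius less than the smallest curvature radius are locally contained in the
sublevel set. -/
theorem exists_local_ball (hn : 2 ≤ n) {z : EuclideanSpace ℝ (Fin n)} (hz : z ∈ Ω)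
    (hz0 : Du (closure Ω) u z ≠ 0) {r : ℝ} (hr : 0 < r)
    (hrk : r * kappaMax (closure Ω) u z < 1) :
    ∃ ε > 0, ∀ y, ‖y‖ < ε →
      ‖y + r • ‖Du (closure Ω) u z‖⁻¹ • Du (closure Ω) u z‖ ≤ r → z + y ∈ Ω ∧ u (z + y) ≤ u z := by
  set A := hessOp (closure Ω) u z with hA
  set g := Du (closure Ω) u z with hg
  set k := kappaMax (closure Ω) u z with hk
  have hzc := subset_closure hz
  have hm : 0 < ‖g‖ := norm_pos_iff.mpr hz0
  set δ := 1 - r * k with hδ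
  have hδ0 : 0 < δ := by rw [hδ]; linarith
  -- The slack δ = 1 − rk is split in halves: η spends one on the Taylor error, and the second bound
  -- on ε spends the other on the Hessian terms involving the normal. The total in `h7` is then
  -- exactly 0.
  obtain ⟨ε₁, hε₁, hT⟩ := exists_taylor_le hΩ hu hz (η := ‖g‖ * δ / (4 * r)) (by positivity)
  refine ⟨min ε₁ (‖g‖ * (δ / 2) / (‖A‖ + 1)), lt_min hε₁ (by positivity), fun y hy hyr => ?_⟩
  obtain ⟨hmem, hle⟩ := hT y (hy.trans_le (min_le_left _ _))
  refine ⟨hmem, hle.trans ?_⟩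
  set ν := ‖g‖⁻¹ • g with hν
  have hνn : ‖ν‖ = 1 := by rw [hν, norm_smul, norm_inv, norm_norm, inv_mul_cancel₀ hm.ne']
  have hνν : ⟪ν, ν⟫ = 1 := by rw [real_inner_self_eq_norm_sq, hνn, one_pow]
  have hgν : g = ‖g‖ • ν := by rw [hν, smul_smul, mul_inv_cancel₀ hm.ne', one_smul]
  set σ := ⟪ν, y⟫ with hσ
  have hgy : ⟪g, y⟫ = ‖g‖ * σ := by rw [hσ, ← real_inner_smul_left, ← hgν]
  -- Membership in the ball, squared: the normal component σ is at most −|y|²/(2r).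
  have hσ1 : ‖y‖ ^ 2 + 2 * r * σ ≤ 0 := by
    have h1 : ‖y + r • ν‖ ^ 2 ≤ r ^ 2 := pow_le_pow_left₀ (norm_nonneg _) hyr 2
    rw [norm_add_sq_real, norm_smul, hνn, mul_one, real_inner_smul_right, real_inner_comm,
      Real.norm_of_nonneg hr.le] at h1
    linarith
  have hσ0 : σ ≤ 0 := by
    by_contra! hpos
    have := mul_pos hr hpos
    have := sq_nonneg ‖y‖
    linarith
  obtain ⟨w, hw⟩ : ∃ w, w = y - σ • ν := ⟨_, rfl⟩
  have hyw : y = w + σ • ν := by rw [hw]; abel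
  have hνw : ⟪ν, w⟫ = 0 := by
    rw [hw, inner_sub_right, real_inner_smul_right, hνν, mul_one, ← hσ, sub_self]
  have hgw : ⟪g, w⟫ = 0 := by rw [hgν, real_inner_smul_left, hνw, mul_zero]
  have hwy : ‖w‖ ^ 2 ≤ ‖y‖ ^ 2 := by
    rw [hyw, norm_add_sq_real, real_inner_smul_right, real_inner_comm, hνw]
    have := sq_nonneg ‖σ • ν‖
    linarith
  have hwy' : ‖w‖ ≤ ‖y‖ := le_of_sq_le_sq hwy (norm_nonneg _)
  have hk0 : ⟪A w, w⟫ ≤ ‖g‖ * k * ‖w‖ ^ 2 := by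
    have := mul_le_mul_of_nonneg_left (inner_hessOp_le_kappaMax hΩ hu hzc hgw) hm.le
    rwa [mul_inv_cancel_left₀ hm.ne', ← mul_assoc] at this
  have hkpos : 0 < k := kappaMax_pos hΩ hu hn hzc hz0
  have hk1 : ⟪A w, w⟫ ≤ ‖g‖ * k * ‖y‖ ^ 2 :=
    hk0.trans (mul_le_mul_of_nonneg_left hwy (by positivity))
  have hAy : ⟪A y, y⟫ = ⟪A w, w⟫ + σ * (⟪A ν, w⟫ + ⟪A ν, y⟫) := by
    have e : ⟪A w, ν⟫ = ⟪A ν, w⟫ := by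
      rw [hessOp_symm hΩ hu hzc, real_inner_comm]
    conv_lhs => rw [hyw]
    rw [map_add, map_smul]
    simp only [inner_add_left, inner_add_right, real_inner_smul_left, real_inner_smul_right, e]
    conv_rhs => rw [hyw]
    simp only [inner_add_right, real_inner_smul_right]
    ring
  have hAν : ∀ v, ‖v‖ ≤ ‖y‖ → -(‖A‖ * ‖y‖) ≤ ⟪A ν, v⟫ := fun v hv => by
    have h1 := abs_real_inner_le_norm (A ν) v
    have h2 : ‖A ν‖ ≤ ‖A‖ := by simpa [hνn] using A.le_opNorm ν
    have h3 := mul_le_mul h2 hv (norm_nonneg _) (norm_nonneg _)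
    have := neg_abs_le ⟪A ν, v⟫
    linarith
  have h1 : σ * (⟪A ν, w⟫ + ⟪A ν, y⟫) ≤ σ * (-2 * (‖A‖ * ‖y‖)) :=
    mul_le_mul_of_nonpos_left (by have := hAν w hwy'; have := hAν y le_rfl; linarith) hσ0
  have h2 : ‖A‖ * ‖y‖ ≤ ‖g‖ * (δ / 2) := by
    have h3 := (hy.trans_le (min_le_right _ _)).le
    rw [le_div_iff₀ (by positivity)] at h3
    have := norm_nonneg y
    linarith
  have h3 : σ * (-(‖A‖ * ‖y‖)) ≤ σ * (-(‖g‖ * (δ / 2))) :=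
    mul_le_mul_of_nonpos_left (by linarith) hσ0
  have h4 : σ ≤ -(‖y‖ ^ 2 / (2 * r)) := by
    rw [← neg_div, le_div_iff₀ (by positivity)]
    linarith
  have h5 : 0 ≤ ‖g‖ * (1 - δ / 2) := by
    have := mul_pos hr hkpos
    exact mul_nonneg hm.le (by rw [hδ]; linarith)
  have h6 := mul_le_mul_of_nonneg_left h4 h5
  have h7 : ‖g‖ * (1 - δ / 2) * -(‖y‖ ^ 2 / (2 * r)) + ‖g‖ * k * ‖y‖ ^ 2 / 2 +
      ‖g‖ * δ / (4 * r) * ‖y‖ ^ 2 = 0 := by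
    rw [hδ]
    field_simp
    ring
  rw [hgy, hAy]
  linarith

end Sublevel

/-! ### The lower gradient bound outside the sublevel set -/

section Gradient

variable {Ω : Set (EuclideanSpace ℝ (Fin n))} (hΩ : IsSmoothStrictlyConvexDomain Ω)
  {u : EuclideanSpace ℝ (Fin n) → ℝ} (hu : IsSolution Ω u)
include hΩ hu

/-- Comparison of `u` with the solution in a ball contained in a sublevel set and touching it. -/
theorem le_norm_Du_of_closedBall_subset (hn : 0 < n) {z ν : EuclideanSpace ℝ (Fin n)}
    {r : ℝ} (hr : 0 < r) (hν : ‖ν‖ = 1) (hz : z ∈ Ω)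
    (hsub : Metric.closedBall (z - r • ν) r ⊆ {x ∈ Ω | u x ≤ u z}) :
    r ≤ ⟪Du (closure Ω) u z, ν⟫ := by
  set a := z - r • ν with ha
  have hza : z - a = r • ν := by rw [ha]; abel
  have hzan : ‖z - a‖ = r := by
    rw [hza, norm_smul, hν, mul_one, Real.norm_of_nonneg hr.le]
  have hzB : z ∈ Metric.closedBall a r := mem_closedBall_iff_norm.mpr hzan.le
  have key : ∀ s ∈ Iio (1 : ℝ), s * r ≤ ⟪Du (closure Ω) u z, ν⟫ := by
    intro s hs
    set f : EuclideanSpace ℝ (Fin n) → ℝ := fun y => u y - s / 2 * ‖y - a‖ ^ 2 with hf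
    have hfc : ContinuousOn f (Metric.closedBall a r) :=
      (hu.smooth.continuousOn.mono fun y hy => subset_closure (hsub hy).1).sub (by fun_prop)
    obtain ⟨m, hm, hmax⟩ := (isCompact_closedBall a r).exists_isMaxOn ⟨z, hzB⟩ hfc
    -- At an interior maximum of f all eigenvalues of D²u would be at most s < 1, which is
    -- incompatible with product 1.
    have hmr : ‖m - a‖ = r := by
      refine le_antisymm (mem_closedBall_iff_norm.mp hm) (not_lt.mp fun hlt => ?_)
      have hmΩ : m ∈ Ω := (hsub hm).1
      have hloc : IsLocalMax f m := hmax.isLocalMax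
        (Metric.closedBall_mem_nhds_of_mem (by rwa [Metric.mem_ball, dist_eq_norm]))
      obtain ⟨b, l, hb, hl, hprod⟩ := exists_eigenbasis hΩ hu (subset_closure hmΩ)
      have hli : ∀ i, l i < 1 := fun i => by
        have h1 : ∀ y, HasLineDerivAt ℝ (fun y => s / 2 * ‖y - a‖ ^ 2) (s * ⟪y - a, b i⟫) y (b i) := by
          intro y
          have e := (((hasFDerivAt_id y).sub_const a).norm_sq.const_mul (s / 2)).hasLineDerivAt (b i)
          exact HasDerivAt.congr_deriv e (by simp [inner_sub_left]; ring)
        have h2 : HasLineDerivAt ℝ (fun y => s * ⟪y - a, b i⟫) s m (b i) := by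
          have e := ((((hasFDerivAt_id m).sub_const a).inner ℝ
            (hasFDerivAt_const (b i) m)).const_mul s).hasLineDerivAt (b i)
          exact HasDerivAt.congr_deriv e (by simp)
        have h3 := second_lineDeriv_nonpos_of_isLocalMax hloc
          (Filter.eventually_of_mem (hΩ.isOpen.mem_nhds hmΩ) fun y hy =>
            hasLineDerivAt_sub (hasLineDerivAt_dirDeriv hΩ.isOpen (contDiffOn_interior hu) hy (b i))
              (h1 y))
          (hasLineDerivAt_sub (hasLineDerivAt_dirDeriv hΩ.isOpen
            (contDiffOn_dirDeriv hΩ.isOpen (contDiffOn_interior hu) (b i)) hmΩ (b i)) h2)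
        rw [dirDeriv_dirDeriv_eq_inner hΩ hu hmΩ, hb, real_inner_smul_left,
          real_inner_self_eq_norm_sq, b.orthonormal.1 i] at h3
        have : s < 1 := hs
        linarith
      have hlt1 := Finset.prod_lt_prod_of_nonempty (f := l) (g := fun _ => (1 : ℝ))
        (s := Finset.univ) (fun i _ => hl i) (fun i _ => hli i) ⟨⟨0, hn⟩, Finset.mem_univ _⟩
      rw [hprod] at hlt1
      simp at hlt1
    -- On the sphere the quadratic term is constant and u ≤ u(z), so z is also a maximum. The
    -- derivative towards the center then gives s r ≤ ⟨Du(z), ν⟩.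
    have hzmax : IsMaxOn f (Metric.closedBall a r) z := fun y hy => by
      have h1 : f y ≤ f m := hmax hy
      have h2 : u m ≤ u z := (hsub hm).2
      simp only [hf, hmr] at h1
      simp only [mem_ofPred_eq, hf, hzan]
      linarith
    have hd : HasFDerivWithinAt f _ (Metric.closedBall a r) z :=
      ((hasFDerivAt_self hΩ hu hz).sub
        (((hasFDerivAt_id z).sub_const a).norm_sq.const_mul (s / 2))).hasFDerivWithinAt
    have h := hzmax.localize.hasFDerivWithinAt_nonpos hd
      (sub_mem_posTangentConeAt_of_segment_subset ((convex_closedBall a r).segment_subset hzB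
        (Metric.mem_closedBall_self hr.le)))
    have haz : a - z = -(r • ν) := by rw [← hza]; abel
    rw [haz] at h
    simp [hza] at h
    rw [real_inner_smul_right, real_inner_smul_right, real_inner_self_eq_norm_sq, hν] at h
    have h4 : r * (s * r) ≤ r * ⟪Du (closure Ω) u z, ν⟫ := by linarith
    exact le_of_mul_le_mul_left h4 hr
  have := le_on_closure key (f := fun s : ℝ => s * r) (by fun_prop) continuousOn_const
    (x := 1) (by simp)
  simpa using this

/-- The gradient bound on a sublevel set in terms of the curvature of its boundary. -/
theorem one_le_mul_norm_Du (hn : 2 ≤ n) {c : ℝ} (hc : c < 0) {x₁ : EuclideanSpace ℝ (Fin n)}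
    (hx₁ : x₁ ∈ Ω) (hx₁c : u x₁ < c) {k : ℝ}
    (hk : ∀ z ∈ Ω, u z = c → kappaMax (closure Ω) u z ≤ k) {x : EuclideanSpace ℝ (Fin n)}
    (hx : x ∈ Ω) (hxc : c ≤ u x) : 1 ≤ k * ‖Du (closure Ω) u x‖ := by
  set C := {x ∈ closure Ω | u x ≤ c} with hC
  have hCΩ : C ⊆ Ω := fun z hz => by
    by_contra hzΩ
    have : z ∈ frontier Ω := by rw [hΩ.frontier_eq]; exact ⟨hz.1, hzΩ⟩
    have h1 := hz.2
    rw [hu.eq_zero z this] at h1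
    linarith
  have hCcomp : IsCompact C := hΩ.isCompact_closure.of_isClosed_subset
    (hu.smooth.continuousOn.preimage_isClosed_of_isClosed isClosed_closure isClosed_Iic)
    (sep_subset _ _)
  have hCconv : Convex ℝ C := (convexOn_closure hΩ hu).convex_le c
  have hCne : C.Nonempty := ⟨x₁, subset_closure hx₁, hx₁c.le⟩
  -- support points lie on the level set, and the gradient there is the normal
  have hsupp : ∀ z ∈ C, ∀ p, p ≠ 0 → ⟪z, p⟫ = supportFn C p →
      u z = c ∧ Du (closure Ω) u z ≠ 0 ∧ ∃ s : ℝ, 0 < s ∧ p = s • Du (closure Ω) u z := by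
    intro z hz p hp hzp
    have hzΩ := hCΩ hz
    -- A direction that stays in C cannot increase ⟨·, p⟩ beyond its maximum at z.
    have hsmall : ∀ v, (∀ᶠ t in 𝓝[>] (0 : ℝ), u (z + t • v) ≤ c) → ⟪p, v⟫ ≤ 0 := by
      intro v hv
      have hmem : ∀ᶠ t in 𝓝[>] (0 : ℝ), z + t • v ∈ Ω := by
        have hcont : ContinuousAt (fun t : ℝ => z + t • v) 0 := by fun_prop
        exact (hcont.eventually (hΩ.isOpen.mem_nhds (by simpa using hzΩ))).filter_mono
          nhdsWithin_le_nhds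
      obtain ⟨t, ⟨ht1, ht2⟩, ht0⟩ := ((hv.and hmem).and self_mem_nhdsWithin).exists
      have h1 := inner_le_supportFn hCcomp (⟨subset_closure ht2, ht1⟩ : z + t • v ∈ C) p
      rw [← hzp, inner_add_left, real_inner_smul_left, real_inner_comm p v] at h1
      by_contra! hpos
      have := mul_pos (show (0 : ℝ) < t from ht0) hpos
      linarith
    have hucont : ∀ v, ContinuousAt (fun t : ℝ => u (z + t • v)) 0 := fun v => by
      have h1 : ContinuousAt u (z + (0 : ℝ) • v) := by
        simpa using (hasFDerivAt_self hΩ hu hzΩ).continuousAt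
      exact ContinuousAt.comp (f := fun t : ℝ => z + t • v) h1 (by fun_prop)
    -- If u(z) < c, the direction p itself would stay in C.
    have huz : u z = c := by
      refine le_antisymm hz.2 (not_lt.mp fun hlt => ?_)
      have := hsmall p (((hucont p).eventually (gt_mem_nhds (by simpa using hlt))).filter_mono
        nhdsWithin_le_nhds |>.mono fun t ht => ht.le)
      exact absurd this (not_le.mpr (real_inner_self_pos.mpr hp))
    have hg0 : Du (closure Ω) u z ≠ 0 :=
      Du_ne_zero_of_lt hΩ hu hz.1 (subset_closure hx₁) (by rwa [huz])
    obtain ⟨s, hs, hps⟩ := exists_smul_eq_of_inner_neg (p := p) hg0 fun v hv => by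
      refine hsmall v ?_
      have hl : HasDerivAt (fun t : ℝ => u (z + t • v)) ⟪Du (closure Ω) u z, v⟫ 0 :=
        (hasFDerivAt_self hΩ hu hzΩ).hasLineDerivAt v
      have h1 := hl.tendsto_slope_zero_right
      simp only [zero_add, zero_smul, add_zero] at h1
      filter_upwards [h1.eventually (gt_mem_nhds hv), self_mem_nhdsWithin] with t ht ht0
      rw [huz, smul_eq_mul] at ht
      by_contra! hcon
      have := mul_pos (inv_pos.mpr (show (0 : ℝ) < t from ht0)) (sub_pos.mpr hcon)
      linarith
    refine ⟨huz, hg0, s, lt_of_le_of_ne hs fun h0 => hp ?_, hps⟩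
    rw [hps, ← h0, zero_smul]
  have hnormal : ∀ (g : EuclideanSpace ℝ (Fin n)) (s : ℝ), 0 < s →
      ‖s • g‖⁻¹ • s • g = ‖g‖⁻¹ • g := fun g s hs => by
    rw [norm_smul, Real.norm_of_nonneg hs.le, mul_inv, smul_smul]
    congr 1
    field_simp
  -- the bound at support points
  have hbound : ∀ z ∈ C, ∀ p, p ≠ 0 → ⟪z, p⟫ = supportFn C p →
      1 ≤ k * ‖Du (closure Ω) u z‖ := by
    intro z hz p hp hzp
    obtain ⟨huz, hg0, s, hs, hps⟩ := hsupp z hz p hp hzp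
    have hzΩ := hCΩ hz
    have hk0 : 0 < k := (kappaMax_pos hΩ hu hn hz.1 hg0).trans_le (hk z hzΩ huz)
    have hm : 0 < ‖Du (closure Ω) u z‖ := norm_pos_iff.mpr hg0
    have hν : ‖‖Du (closure Ω) u z‖⁻¹ • Du (closure Ω) u z‖ = 1 := by
      rw [norm_smul, norm_inv, norm_norm, inv_mul_cancel₀ hm.ne']
    -- Every r < 1/k is strictly below all curvature radii of the level set, so the local ball lemma
    -- applies at every support point and the rolling theorem makes the ball at z global. Then r
    -- tends to 1/k.
    have hr : ∀ r, 0 < r → r < k⁻¹ → r ≤ ‖Du (closure Ω) u z‖ := by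
      intro r hr hrk
      have hball := closedBall_subset_of_local hCcomp hr (by
        intro z hz p hp hzp
        obtain ⟨huz, hg0, s, hs, hps⟩ := hsupp z hz p hp hzp
        have hrk' : r * kappaMax (closure Ω) u z < 1 :=
          (mul_le_mul_of_nonneg_left (hk z (hCΩ hz) huz) hr.le).trans_lt
            (by
              have := mul_lt_mul_of_pos_right hrk hk0
              rwa [inv_mul_cancel₀ hk0.ne'] at this)
        obtain ⟨ε, hε, h⟩ := exists_local_ball hΩ hu hn (hCΩ hz) hg0 hr hrk'
        refine ⟨ε, hε, fun y hy hyr => ?_⟩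
        rw [hps, hnormal _ _ hs] at hyr
        obtain ⟨h1, h2⟩ := h y hy hyr
        exact ⟨subset_closure h1, h2.trans hz.2⟩) (exists_ne_zero_inner_eq_zero hn) hCconv hz hp hzp
      rw [hps, hnormal _ _ hs] at hball
      have := le_norm_Du_of_closedBall_subset hΩ hu (by omega) hr hν hzΩ fun y hy => by
        have := hball hy
        exact ⟨hCΩ this, huz.symm ▸ this.2⟩
      rw [real_inner_smul_right, real_inner_self_eq_norm_sq] at this
      refine this.trans (le_of_eq ?_)
      field_simp
    have h1 : k⁻¹ ≤ ‖Du (closure Ω) u z‖ := by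
      refine le_of_forall_lt fun r hrk => ?_
      by_contra! hcon
      obtain ⟨r', h1, h2⟩ := exists_between (max_lt hrk (inv_pos.mpr hk0))
      have h3 := hr r' ((le_max_right _ _).trans_lt h1) h2
      have h4 := (le_max_left r 0).trans_lt h1
      linarith
    rwa [inv_le_iff_one_le_mul₀' hk0] at h1
  have hxg : Du (closure Ω) u x ≠ 0 :=
    Du_ne_zero_of_lt hΩ hu (subset_closure hx) (subset_closure hx₁) (by linarith)
  have hxle : ∀ y ∈ C, ⟪y, Du (closure Ω) u x⟫ ≤ ⟪x, Du (closure Ω) u x⟫ + (c - u x) := fun y hy => by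
    have h1 := gradient_ineq hΩ hu (subset_closure hx) hy.1
    have h2 : u y ≤ c := hy.2
    rw [inner_sub_right, real_inner_comm, real_inner_comm x] at h1
    linarith
  -- z is the point of {u = c} whose normal is parallel to Du(x), so Du(x) = s Du(z); the bound at z
  -- transfers once s ≥ 1.
  obtain ⟨z, hz, hzp⟩ := exists_inner_eq_supportFn hCcomp hCne (Du (closure Ω) u x)
  rcases hxc.eq_or_lt with heq | hlt
  · have hxC : x ∈ C := ⟨subset_closure hx, heq.ge⟩
    refine hbound x hxC _ hxg (le_antisymm (inner_le_supportFn hCcomp hxC _) ?_)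
    have := hxle z hz
    rw [hzp] at this
    linarith
  · obtain ⟨huz, hg0, s, hs, hps⟩ := hsupp z hz _ hxg hzp
    have h1 := hbound z hz _ hxg hzp
    have hk0 : 0 < k := (kappaMax_pos hΩ hu hn hz.1 hg0).trans_le (hk z (hCΩ hz) huz)
    refine h1.trans (mul_le_mul_of_nonneg_left ?_ hk0.le)
    have h2 := hxle z hz
    rw [hps, real_inner_smul_right, real_inner_smul_right] at h2
    have h3 := gradient_ineq hΩ hu (subset_closure hx) hz.1
    have h4 := gradient_ineq hΩ hu hz.1 (subset_closure hx)
    rw [hps, real_inner_smul_left, inner_sub_right] at h3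
    rw [inner_sub_right] at h4
    rw [real_inner_comm, real_inner_comm _ x] at h2
    have h5 : 0 < ⟪Du (closure Ω) u z, x⟫ - ⟪Du (closure Ω) u z, z⟫ := by
      by_contra! hcon
      have := mul_nonneg_of_nonpos_of_nonpos hcon (neg_nonpos.mpr hs.le)
      linarith
    -- The gradient inequalities at x and at z give s D ≥ u(x) − c ≥ D, where D = ⟨Du(z), x − z⟩ >
    -- 0.
    have h6 : 1 ≤ s := by
      by_contra! hcon
      have := mul_pos h5 (sub_pos.mpr hcon)
      linarith
    rw [hps, norm_smul, Real.norm_of_nonneg hs.le]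
    have := mul_le_mul_of_nonneg_right h6 (norm_nonneg (Du (closure Ω) u z))
    linarith

/-- The boundary of a sublevel set is the level set. -/
theorem frontier_sublevel {c : ℝ} (hc : c < 0) {x₁ : EuclideanSpace ℝ (Fin n)}
    (hx₁ : x₁ ∈ Ω) (hx₁c : u x₁ < c) :
    frontier {x ∈ Ω | u x < c} = {x ∈ closure Ω | u x = c} := by
  have hopen : IsOpen {x ∈ Ω | u x < c} :=
    (contDiffOn_interior hu).continuousOn.isOpen_inter_preimage hΩ.isOpen isOpen_Iio
  have hclosed : IsClosed {x ∈ closure Ω | u x ≤ c} :=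
    hu.smooth.continuousOn.preimage_isClosed_of_isClosed isClosed_closure isClosed_Iic
  rw [hopen.frontier_eq]
  ext x
  constructor
  · rintro ⟨hx, hx'⟩
    have h1 : x ∈ {x ∈ closure Ω | u x ≤ c} :=
      closure_minimal (show {x ∈ Ω | u x < c} ⊆ {x ∈ closure Ω | u x ≤ c} from
        fun y hy => ⟨subset_closure hy.1, hy.2.le⟩) hclosed hx
    refine ⟨h1.1, le_antisymm h1.2 (not_lt.mp fun hlt => hx' ⟨?_, hlt⟩)⟩
    by_contra hxΩ
    have : x ∈ frontier Ω := by rw [hΩ.frontier_eq]; exact ⟨h1.1, hxΩ⟩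
    rw [hu.eq_zero x this] at hlt
    linarith
  · rintro ⟨hx, hxc⟩
    refine ⟨?_, fun h => h.2.ne hxc⟩
    -- By convexity u < c on the segment from x to x₁, apart from x itself.
    have hseg : ∀ t ∈ Ioc (0 : ℝ) 1, x + t • (x₁ - x) ∈ {x ∈ Ω | u x < c} := fun t ht => by
      have h1 := (convexOn_closure hΩ hu).2 hx (subset_closure hx₁) (sub_nonneg.mpr ht.2) ht.1.le
        (by ring)
      have e : (1 - t) • x + t • x₁ = x + t • (x₁ - x) := by module
      rw [e, hxc, smul_eq_mul, smul_eq_mul] at h1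
      have h2 : u (x + t • (x₁ - x)) < c := by
        have := mul_pos ht.1 (sub_pos.mpr hx₁c)
        linarith
      refine ⟨?_, h2⟩
      by_contra hΩ'
      have : x + t • (x₁ - x) ∈ frontier Ω := by
        rw [hΩ.frontier_eq]
        exact ⟨hΩ.convex.closure.add_smul_sub_mem hx (subset_closure hx₁) ⟨ht.1.le, ht.2⟩, hΩ'⟩
      rw [hu.eq_zero _ this] at h2
      linarith
    have hlim : Filter.Tendsto (fun t : ℝ => x + t • (x₁ - x)) (𝓝[>] 0) (𝓝 x) := by
      have : ContinuousAt (fun t : ℝ => x + t • (x₁ - x)) 0 := by fun_prop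
      simpa [ContinuousAt] using this.mono_left nhdsWithin_le_nhds
    exact mem_closure_of_tendsto hlim (Filter.eventually_of_mem (Ioc_mem_nhdsGT zero_lt_one) hseg)

end Gradient

/-! ### Assembling the estimate -/

/-- Passing from a bound of `A` at the boundary to the bound of the quotient by a power of `g`. -/
theorem div_pow_lt_mul_pow_div_pow {A M g R k m : ℝ} {p N : ℕ} (hpN : p ≤ N) (hM : 0 < M)
    (hg : 0 < g) (hgR : g < R) (hm : 0 < m) (hA : A < M * R ^ p) (hk : 1 ≤ k * g)
    (hR : R * m ≤ 1) : A / g ^ p < M * k ^ N / m ^ N := by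
  -- R/g ≥ 1 is what lets the exponent rise from p to N; for H this means from 3 to n + 1.
  have h1 : 1 ≤ R / g := (one_le_div hg).mpr hgR.le
  have h2 : R / g ≤ k / m := (div_le_div_iff₀ hg hm).mpr (hR.trans hk)
  calc A / g ^ p < M * R ^ p / g ^ p := by gcongr
    _ = M * (R / g) ^ p := by rw [div_pow, mul_div_assoc]
    _ ≤ M * (R / g) ^ N := by gcongr
    _ ≤ M * (k / m) ^ N := by gcongr
    _ = M * k ^ N / m ^ N := by rw [div_pow, mul_div_assoc]

section Estimate

variable {Ω : Set (EuclideanSpace ℝ (Fin n))} (hΩ : IsSmoothStrictlyConvexDomain Ω)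
  {u : EuclideanSpace ℝ (Fin n) → ℝ} (hu : IsSolution Ω u)
include hΩ hu

omit hu in
theorem isCompact_frontier : IsCompact (frontier Ω) :=
  hΩ.isCompact_closure.of_isClosed_subset isClosed_frontier frontier_subset_closure

theorem exists_isGreatest_div_pow (hn : 0 < n) (hne : (frontier Ω).Nonempty)
    {f : EuclideanSpace ℝ (Fin n) → ℝ} (hf : ContinuousOn f (closure Ω)) (p : ℕ) :
    ∃ M, IsGreatest ((fun x => f x / ‖Du (closure Ω) u x‖ ^ p) '' frontier Ω) M :=
  ((isCompact_frontier hΩ).image_of_continuousOn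
    ((hf.mono frontier_subset_closure).div
      (((continuousOn_Du hΩ hu).mono frontier_subset_closure).norm.pow p) fun _ hx =>
        pow_ne_zero p (norm_ne_zero_iff.mpr (Du_ne_zero_of_mem_frontier hΩ hu hn hx)))).exists_isGreatest
    (hne.image _)

/-- A nonnegative function that is largest on the boundary only, divided by a power of `|Du|`, is
bounded by its maximum on the boundary. -/
theorem div_pow_lt_of_isGreatest (hn : 0 < n) {f : EuclideanSpace ℝ (Fin n) → ℝ}
    (hf : AttainsMaxOnlyOnBoundary Ω f) (hf0 : ∀ x ∈ closure Ω, 0 ≤ f x) {p N : ℕ} (hpN : p ≤ N)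
    {M : ℝ} (hM : IsGreatest ((fun x => f x / ‖Du (closure Ω) u x‖ ^ p) '' frontier Ω) M)
    {R k m : ℝ} (hR : ∀ y ∈ frontier Ω, ‖Du (closure Ω) u y‖ ≤ R) (hm : 0 < m) (hRm : R * m ≤ 1)
    {x : EuclideanSpace ℝ (Fin n)} (hx : x ∈ Ω) (hxR : ‖Du (closure Ω) u x‖ < R)
    (hk : 1 ≤ k * ‖Du (closure Ω) u x‖) :
    f x / ‖Du (closure Ω) u x‖ ^ p < M * k ^ N / m ^ N := by
  obtain ⟨y, hy, -, hlt⟩ := hf.exists_frontier hΩ.isOpen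
  have hy0 : 0 < ‖Du (closure Ω) u y‖ := norm_pos_iff.mpr (Du_ne_zero_of_mem_frontier hΩ hu hn hy)
  have hfy : 0 < f y := (hf0 x (subset_closure hx)).trans_lt (hlt x hx)
  have hyM : f y / ‖Du (closure Ω) u y‖ ^ p ≤ M := hM.2 ⟨y, hy, rfl⟩
  have hM0 : 0 < M := (div_pos hfy (pow_pos hy0 p)).trans_le hyM
  have hx0 : 0 < ‖Du (closure Ω) u x‖ := by
    refine lt_of_le_of_ne (norm_nonneg _) fun h => ?_
    rw [← h, mul_zero] at hk
    linarith
  refine div_pow_lt_mul_pow_div_pow hpN hM0 hx0 hxR hm ?_ hk hRm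
  refine (hlt x hx).trans_le (((div_le_iff₀ (pow_pos hy0 p)).mp hyM).trans ?_)
  gcongr
  exact hR y hy

end Estimate

end MongeAmpere

end

theorem corollary1p3 (n : ℕ) (hn : 2 ≤ n) (Ω : Set (EuclideanSpace ℝ (Fin n)))
    (hΩ : MongeAmpere.IsSmoothStrictlyConvexDomain Ω)
    (u : EuclideanSpace ℝ (Fin n) → ℝ) (hu : MongeAmpere.IsSolution Ω u) :
    MongeAmpere.AttainsMaxOnlyOnBoundary Ω
        (fun x => MongeAmpere.gaussCurvature (closure Ω) u x *
          ‖MongeAmpere.Du (closure Ω) u x‖ ^ (n + 1)) ∧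
      MongeAmpere.AttainsMaxOnlyOnBoundary Ω
        (fun x => MongeAmpere.meanCurvature (closure Ω) u x *
          ‖MongeAmpere.Du (closure Ω) u x‖ ^ 3) ∧
      ∀ c ∈ Ioo (sInf (u '' Ω)) 0, ∀ Ω' : Set (EuclideanSpace ℝ (Fin n)),
        Ω' = {x ∈ Ω | u x < c} →
        ∃ maxK maxH maxκ minκ : ℝ,
          IsGreatest (MongeAmpere.gaussCurvature (closure Ω) u '' frontier Ω) maxK ∧
          IsGreatest (MongeAmpere.meanCurvature (closure Ω) u '' frontier Ω) maxH ∧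
          IsGreatest ((fun y => MongeAmpere.kappaMax (closure Ω) u y ^ (n + 1)) ''
            frontier Ω') maxκ ∧
          IsLeast ((fun y => MongeAmpere.kappaMin (closure Ω) u y ^ (n + 1)) ''
            frontier Ω) minκ ∧
          0 < minκ ∧
          ∀ x ∈ Ω \ Ω',
            MongeAmpere.gaussCurvature (closure Ω) u x < maxK * maxκ / minκ ∧
            MongeAmpere.meanCurvature (closure Ω) u x < maxH * maxκ / minκ := by
  have hn0 : 0 < n := by omega
  simp only [MongeAmpere.gaussCurvature_mul, MongeAmpere.meanCurvature_mul]
  refine ⟨MongeAmpere.attainsMax_sigmaForm_self hΩ hu hn,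
    MongeAmpere.attainsMax_sigmaForm_two hΩ hu hn, ?_⟩
  rintro c ⟨hc1, hc⟩ Ω' rfl
  obtain ⟨-, ⟨x₁, hx₁, rfl⟩, hx₁c⟩ := exists_lt_of_csInf_lt (hΩ.nonempty.image u) hc1
  have hlevel := MongeAmpere.frontier_sublevel hΩ hu hc hx₁ hx₁c
  have hsub : frontier {x ∈ Ω | u x < c} ⊆ closure Ω := by
    rw [hlevel]
    exact sep_subset _ _
  obtain ⟨y, hy, hylt, hyle, hyκ⟩ := MongeAmpere.exists_norm_Du_mul_kappaMin_le hΩ hu hn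
  have hne : (frontier Ω).Nonempty := ⟨y, hy⟩
  -- Makes the whole space unbounded, so the bounded set {u < c} is a proper subset and has nonempty
  -- boundary.
  have : Nontrivial (EuclideanSpace ℝ (Fin n)) :=
    ⟨_, _, MongeAmpere.Du_ne_zero_of_mem_frontier hΩ hu hn0 hy⟩
  have hne' : (frontier {x ∈ Ω | u x < c}).Nonempty :=
    nonempty_frontier_iff.mpr ⟨⟨x₁, hx₁, hx₁c⟩, fun h => NormedSpace.unbounded_univ ℝ
      (EuclideanSpace ℝ (Fin n)) (h ▸ hΩ.isBounded.subset (sep_subset _ _))⟩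
  obtain ⟨maxK, hK⟩ := MongeAmpere.exists_isGreatest_div_pow hΩ hu hn0 hne
    (MongeAmpere.continuousOn_sigmaForm_self hΩ hu) (n + 1)
  obtain ⟨maxH, hH⟩ := MongeAmpere.exists_isGreatest_div_pow hΩ hu hn0 hne
    (MongeAmpere.continuousOn_sigmaForm_two hΩ hu) 3
  have hDu : ∀ x ∈ frontier {x ∈ Ω | u x < c}, MongeAmpere.Du (closure Ω) u x ≠ 0 := by
    intro x hx
    refine MongeAmpere.Du_ne_zero_of_lt hΩ hu (hsub hx) (subset_closure hx₁) ?_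
    rw [hlevel] at hx
    rwa [hx.2]
  obtain ⟨zM, hzM, hM⟩ := MongeAmpere.exists_kappaMax_le hΩ hu hn
    (hΩ.isCompact_closure.of_isClosed_subset isClosed_frontier hsub) hne' hsub hDu
  obtain ⟨zm, hzm, hm⟩ := MongeAmpere.exists_le_kappaMin hΩ hu hn
    (MongeAmpere.isCompact_frontier hΩ) hne frontier_subset_closure
    fun x hx => MongeAmpere.Du_ne_zero_of_mem_frontier hΩ hu hn0 hx
  have hpos : 0 < MongeAmpere.kappaMin (closure Ω) u zm :=
    MongeAmpere.kappaMin_pos hΩ hu hn (frontier_subset_closure hzm)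
      (MongeAmpere.Du_ne_zero_of_mem_frontier hΩ hu hn0 hzm)
  refine ⟨maxK, maxH, _, _, hK, hH, ⟨⟨zM, hzM, rfl⟩, ?_⟩, ⟨⟨zm, hzm, rfl⟩, ?_⟩,
    pow_pos hpos _, ?_⟩
  · rintro _ ⟨z, hz, rfl⟩
    exact pow_le_pow_left₀ (MongeAmpere.kappaMax_pos hΩ hu hn (hsub hz) (hDu z hz)).le (hM z hz) _
  · rintro _ ⟨z, hz, rfl⟩
    exact pow_le_pow_left₀ hpos.le (hm z hz) _
  · rintro x ⟨hx, hx'⟩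
    have hxc : c ≤ u x := not_lt.mp fun h => hx' ⟨hx, h⟩
    have hk := MongeAmpere.one_le_mul_norm_Du hΩ hu hn hc hx₁ hx₁c
      (fun z hz hzc => hM z (hlevel ▸ ⟨subset_closure hz, hzc⟩)) hx hxc
    -- The upper bound is known only at y, where |Du| is maximal; replacing κ_m(y) by the minimum of
    -- κ_m preserves it.
    have hR := (mul_le_mul_of_nonneg_left (hm y hy)
      (norm_nonneg (MongeAmpere.Du (closure Ω) u y))).trans hyκ
    exact ⟨MongeAmpere.div_pow_lt_of_isGreatest hΩ hu hn0
        (MongeAmpere.attainsMax_sigmaForm_self hΩ hu hn)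
        (fun _ h => MongeAmpere.sigmaForm_self_nonneg hΩ hu h) le_rfl hK hyle hpos hR hx
        (hylt x hx) hk,
      MongeAmpere.div_pow_lt_of_isGreatest hΩ hu hn0
        (MongeAmpere.attainsMax_sigmaForm_two hΩ hu hn)
        (fun _ h => MongeAmpere.sigmaForm_two_nonneg hΩ hu h) (by omega) hH hyle hpos hR hx
        (hylt x hx) hk⟩
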